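/- Let $d\ge 2$, let $\mathbb S=\mathbb R/\mathbb Z$ be the unit circle (the boundary of the open unit disk $\mathbb D$) and $\sigma_d(t)=dt \bmod 1$. A chord $\overline{ab}$ is the segment joining $a,b\in\mathbb S$ (a point if $a=b$), and $\sigma_d(\overline{ab})=\overline{\sigma_d(a)\sigma_d(b)}$. Two chords cross if their endpoints strictly alternate on $\mathbb S$. A non-degenerate chord is critical if its image is a point. A full critical collection $\mathcal C$ is a family of pairwise non-crossing critical chords such that, for every component $B$ of $\mathbb D\setminus\bigcup\mathcal C$, the map $\sigma_d$ restricted to $\partial B\cap \mathbb S$ is injective except for the endpoints of the chords of $\mathcal C$ contained in $\partial B$. Let $\mathcal C^+$ be the set of convex hulls of the components of $\bigcup\mathcal C$. A polygon in $\mathcal C^+$ is proper if it has no $\sigma_d$-periodic vertex. A $\mathcal C^+$-pullback of a chord $\ell$ is a chord $\ell'$ with $\sigma_d(\ell')=\ell$ that crosses no edge of a polygon in $\mathcal C^+$. Let $\mathcal Y_{\mathcal C}$ be the family of all iterated $\mathcal C^+$-pullbacks (including the zeroth) of edges of proper polygons in $\mathcal C^+$. A pile is an equivalence class of chords of $\mathcal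 Y_{\mathcal C}$, two chords being equivalent if a finite chain of consecutively non-disjoint chords of $\mathcal Y_{\mathcal C}$ connects them. Let $\overline{Y}_{\mathcal C}$ be the closure, in the space of chords, of the family consisting of all edges of convex hulls of piles and all points of $\mathbb S$. A $\sigma_d$-invariant (sibling-invariant) lamination is a closed family $\mathcal L$ of pairwise non-crossing chords, containing all points of $\mathbb S$, such that: $\ell\in\mathcal L$ implies $\sigma_d(\ell)\in\mathcal L$; every $\ell\in\mathcal L$ equals $\sigma_d(q)$ for some $q\in\mathcal L$; and every non-critical $\ell\in\mathcal L$ is one of $d$ pairwise disjoint chords of $\mathcal L$ with the same image. It is proper if no iterated image $\sigma_d^k(\ell)$, $k\ge 0$, of an $\ell\in\mathcal L$ joins a point of period $n$ to a point that is not of period $n$. Let $x\approx_{\mathcal L}y$ mean that a finite concatenation of chords of $\mathcal L$ joins $x$ to $y$. An invariant laminational equivalence relation is an equivalence relation $\sim$ on $\mathbb S$ such that: its graph is closed; distinct classes have disjoint convex hulls; classes are finite; the $\sigma_d$-image of a class is a class; the $\sigma_d$-preimage of a class is a union of classes; and for every class $g$ with more than two points and every component $(s,t)$ of $\mathbb S\setminus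 g$, either $\sigma_d(s)=\sigma_d(t)$ or $(\sigma_d(s),\sigma_d(t))$ is a component of $\mathbb S\setminus\sigma_d(g)$. Its q-lamination consists of all edges of convex hulls of classes and all points of $\mathbb S$. **Theorem.** Let $\mathcal C$ be a full critical collection. Then $\overline{Y}_{\mathcal C}$ is a proper $\sigma_d$-invariant lamination. Moreover, it generates a q-lamination, the preroot q-lamination of $\mathcal C$: the relation $\approx_{\overline{Y}_{\mathcal C}}$ is an invariant laminational equivalence relation, and the preroot q-lamination of $\mathcal C$ is the q-lamination of this relation. -/

import Mathlib

noncomputable section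

namespace Lamination

/-- The unit circle, parameterized by arguments in `ℝ/ℤ`. -/
abbrev S1 : Type := UnitAddCircle

/-- The point `exp (2 π i t)` of the complex plane with argument `t`. -/
def pt (t : S1) : ℂ := ((AddCircle.toCircle t : Circle) : ℂ)

/-- The map `σ_d : t ↦ d t` (that is, `z ↦ z ^ d`). -/
def sigma (d : ℕ) (t : S1) : S1 := d • t

/-! ### Chords -/

/-- A chord of the closed unit disk, given by its unordered pair of endpoints;
`s(a, a)` is the degenerate chord (point) `a`. -/
abbrev Chord : Type := Sym2 S1

/-- The chord as a closed segment in the plane. -/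
def Chord.seg (l : Chord) : Set ℂ := convexHull ℝ (pt '' {x | x ∈ l})

/-- The action of `σ_d` on chords. -/
def Chord.map (d : ℕ) (l : Chord) : Chord := Sym2.map (sigma d) l

/-- Two chords cross if their endpoints strictly alternate on the circle. -/
def Cross (l m : Chord) : Prop :=
  ∃ a b x y : S1, l = s(a, b) ∧ m = s(x, y) ∧ sbtw a x b ∧ sbtw b y a

/-- Two chords are disjoint (in the closed disk) if they have no common endpoint and do not
cross. -/
def DisjointChords (l m : Chord) : Prop :=
  (∀ x, x ∈ l → x ∉ m) ∧ ¬ Cross l m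

/-- A critical chord is a non-degenerate chord whose image is a point. -/
def IsCritical (d : ℕ) (l : Chord) : Prop := ¬ l.IsDiag ∧ (l.map d).IsDiag

/-- The edges of the convex hull of a set `X` of points of the circle: the chords joining the
endpoints `a ≠ b` of a hole `(a, b)` of `X`. -/
def hullEdges (X : Set S1) : Set Chord :=
  {e | ∃ a ∈ X, ∃ b ∈ X, a ≠ b ∧ e = s(a, b) ∧ Disjoint (Set.cIoo a b) X}

/-- The set of endpoints of the chords of a family. -/
def vertices (L : Set Chord) : Set S1 := {x | ∃ l ∈ L, x ∈ l}

/-- All degenerate chords, that is, all points of the circle. -/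
def points : Set Chord := {l | l.IsDiag}

/-- The ordered pairs of endpoints of the chords of a family. The space of chords (with the
Hausdorff metric) is the quotient of `S1 × S1` by the swap. -/
def endpointPairs (L : Set Chord) : Set (S1 × S1) := {p | s(p.1, p.2) ∈ L}

/-- A family of chords that is closed in the space of chords. -/
def IsClosedFamily (L : Set Chord) : Prop := IsClosed (endpointPairs L)

/-- The closure of a family of chords in the space of chords. -/
def closureFamily (L : Set Chord) : Set Chord :=
  {l | ∃ p ∈ closure (endpointPairs L), l = s(p.1, p.2)}

/-! ### Webs and laminations -/

/-- The sibling property: every non-critical chord `l` of the family belongs to a collection of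
`d` pairwise disjoint chords of the family with the same image as `l`. -/
def IsWeb (d : ℕ) (W : Set Chord) : Prop :=
  ∀ l ∈ W, ¬ IsCritical d l →
    ∃ f : Fin d → Chord, (∃ i, f i = l) ∧ (∀ i, f i ∈ W) ∧
      (∀ i, (f i).map d = l.map d) ∧ Pairwise fun i j => DisjointChords (f i) (f j)

structure IsInvariantWeb (d : ℕ) (W : Set Chord) : Prop where
  web : IsWeb d W
  forward : ∀ l ∈ W, l.map d ∈ W
  points_subset : points ⊆ W
  backward : ∀ l ∈ W, ∃ q ∈ W, q.map d = l

structure IsPrelamination (L : Set Chord) : Prop where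
  unlinked : ∀ l ∈ L, ∀ m ∈ L, ¬ Cross l m
  points_subset : points ⊆ L

/-- A (sibling) `σ_d`-invariant lamination. -/
structure IsInvariantLamination (d : ℕ) (L : Set Chord) : Prop where
  prelamination : IsPrelamination L
  invariantWeb : IsInvariantWeb d L
  closed : IsClosedFamily L

/-- `x` is periodic under `σ_d` with (minimal) period `n`. -/
def IsPeriodicOfPeriod (d n : ℕ) (x : S1) : Prop :=
  0 < n ∧ Function.minimalPeriod (sigma d) x = n

/-- A chord is proper if no image of it (including itself) joins a point of period `n` to a point
which is not of period `n`. -/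
def IsProperChord (d : ℕ) (l : Chord) : Prop :=
  ∀ (k n : ℕ) (x y : S1), ((Chord.map d)^[k] l) = s(x, y) →
    IsPeriodicOfPeriod d n x → IsPeriodicOfPeriod d n y

/-- A proper invariant lamination. -/
def IsProperInvariantLamination (d : ℕ) (L : Set Chord) : Prop :=
  IsInvariantLamination d L ∧ ∀ l ∈ L, IsProperChord d l

/-! ### Laminational equivalence relations and q-laminations -/

/-- A `σ_d`-invariant laminational equivalence relation. -/
structure IsInvariantLaminationalEquiv (d : ℕ) (r : Setoid S1) : Prop where
  closed : IsClosed {p : S1 × S1 | r p.1 p.2}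
  unlinked : ∀ g ∈ r.classes, ∀ h ∈ r.classes, g ≠ h →
    Disjoint (convexHull ℝ (pt '' g)) (convexHull ℝ (pt '' h))
  finite : ∀ g ∈ r.classes, g.Finite
  forward : ∀ g ∈ r.classes, sigma d '' g ∈ r.classes
  backward : ∀ g ∈ r.classes, ∃ A ⊆ r.classes, sigma d ⁻¹' g = ⋃₀ A
  /-- for every hole `(s, t)` of a class with more than two points, either its endpoints have the
  same image, or the arc between their images is a hole of the image of the class -/
  oriented : ∀ g ∈ r.classes, 2 < g.encard → ∀ s ∈ g, ∀ t ∈ g, s ≠ t →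
    Disjoint (Set.cIoo s t) g →
      sigma d s = sigma d t ∨ Disjoint (Set.cIoo (sigma d s) (sigma d t)) (sigma d '' g)

/-- The family of all edges of convex hulls of classes, together with all points of the circle. -/
def qLam (r : Setoid S1) : Set Chord := (⋃ g ∈ r.classes, hullEdges g) ∪ points

/-- `x` and `y` are equivalent if a finite concatenation of chords of `L` joins `x` to `y`. -/
def chainEquiv (L : Set Chord) : Setoid S1 :=
  Relation.EqvGen.setoid fun x y => s(x, y) ∈ L

/-- `Q` is the q-lamination generated by the proper invariant lamination `L`: the relation
`chainEquiv L` is an invariant laminational equivalence relation, and `Q` is its q-lamination. -/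
structure Generates (d : ℕ) (L Q : Set Chord) : Prop where
  proper : IsProperInvariantLamination d L
  laminational : IsInvariantLaminationalEquiv d (chainEquiv L)
  eq : Q = qLam (chainEquiv L)

/-! ### Full critical collections -/

/-- A collection of pairwise unlinked critical chords. -/
def IsCriticalCollection (d : ℕ) (C : Set Chord) : Prop :=
  (∀ l ∈ C, IsCritical d l) ∧ ∀ l ∈ C, ∀ m ∈ C, ¬ Cross l m

/-- The open unit disk minus the union of the chords of `C`. -/
def complementDisk (C : Set Chord) : Set ℂ := Metric.ball (0 : ℂ) 1 \ ⋃ l ∈ C, Chord.seg l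

/-- A critical collection `C` is full if for every component `B` of the complement of `⋃ C` in the
open disk, the map `σ_d` is injective on the points of the circle that lie on the boundary of `B`,
except for the endpoints of the chords of `C` that lie in the boundary of `B`. -/
def IsFullCriticalCollection (d : ℕ) (C : Set Chord) : Prop :=
  IsCriticalCollection d C ∧
    ∀ z ∈ complementDisk C, ∀ B, B = connectedComponentIn (complementDisk C) z →
      Set.InjOn (sigma d)
        ({x | pt x ∈ frontier B} \ vertices {l | l ∈ C ∧ Chord.seg l ⊆ frontier B})

/-- The vertex sets of the components of `⋃ C`; as the chords of `C` are unlinked, chords of one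
component are connected through common endpoints. The polygons of `C⁺` are the convex hulls of
these sets. -/
def critSets (C : Set Chord) : Set (Set S1) :=
  {V | ∃ v ∈ vertices C, V = {x | chainEquiv C v x}}

/-- A critical set is proper if none of its vertices is periodic, and a portal otherwise. -/
def IsProperCritSet (d : ℕ) (V : Set S1) : Prop := ∀ x ∈ V, x ∉ Function.periodicPts (sigma d)

/-- The edges of all polygons of `C⁺` (portals included). -/
def plusEdges (C : Set Chord) : Set Chord := ⋃ V ∈ critSets C, hullEdges V

/-- `l'` is a (immediate) `C⁺`-pullback of the chord `l`: it maps to `l` and is compatible with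
`C⁺`. For non-degenerate `l` this means that `l'` lies in the closure of one of the components of
the complement of the polygons of `C⁺`. -/
def IsPullback (d : ℕ) (C : Set Chord) (l l' : Chord) : Prop :=
  l'.map d = l ∧ ∀ e ∈ plusEdges C, ¬ Cross l' e

/-- The family `Y_C` of all iterated `C⁺`-pullbacks of edges of proper critical sets. -/
inductive YFamily (d : ℕ) (C : Set Chord) : Set Chord
  | base (V : Set S1) (hV : V ∈ critSets C) (hp : IsProperCritSet d V)
      (l : Chord) (hl : l ∈ hullEdges V) : YFamily d C l
  | pull (l l' : Chord) (hl : YFamily d C l) (h : IsPullback d C l l') : YFamily d C l'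

/-- The `Y_C`-piles: classes of chords of `Y_C` that are connected by finite chains of consecutively
non-disjoint chords of `Y_C`. -/
def piles (d : ℕ) (C : Set Chord) : Set (Set Chord) :=
  {P | ∃ l ∈ YFamily d C, P = {m | Relation.ReflTransGen
    (fun u v => u ∈ YFamily d C ∧ v ∈ YFamily d C ∧ ¬ DisjointChords u v) l m}}

/-- The family of all edges of convex hulls of `Y_C`-piles, together with all points of the
circle (which belong to every lamination). -/
def pileEdges (d : ℕ) (C : Set Chord) : Set Chord :=
  (⋃ P ∈ piles d C, hullEdges (vertices P)) ∪ points

/-- The closure of the family of edges of convex hulls of `Y_C`-piles. -/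
def YBar (d : ℕ) (C : Set Chord) : Set Chord := closureFamily (pileEdges d C)

/-- The preroot q-lamination of `C`. -/
def preroot (d : ℕ) (C : Set Chord) : Set Chord := qLam (chainEquiv (YBar d C))

end Lamination

end

noncomputable section

namespace Lamination

open Topology

/-! Fullness of `C` means, combinatorially, that on the boundary of a gap of `C⁺` the map `σ_d` is
monotone of degree one, onto the circle, with fibres contained in critical classes (`ang_sigma_le`,
`chain_of_unseparated`, `exists_unseparated_lift`). Two crossing pullbacks lie in the closure of one
gap, so their images share an endpoint or cross; by induction on generations, crossing chords of
`Y_C` are joined by chords of `Y_C` (`YFamily.rel_of_cross`). Hence piles are the nontrivial classes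
of the relation generated by `Y_C`. These classes are unlinked, and they are finite because an orbit
visits a vertex of a proper polygon at most once.

The second ingredient is `FiberMatching`: the fibres over related points are matched injectively by
related points. For unlinked classes, counting fibre points inside a hole shows that holes go to
holes unless the class collapses (`hole_image`). This yields siblings, forward and backward
invariance for the edges of piles. All of it survives closure: crossing is an open condition, there
are finitely many sibling permutations, and the circle is compact. Properness is proved for limit
chords: piles avoid periodic points, and expansion at a periodic point together with the absence of
crossings forces the other endpoint to have the same period.

What remains is finiteness of the classes of the closed lamination. If two iterates of a class
coincide, that iterate contains a periodic point (`exists_periodic_of_rel_iterate`) and is finite by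
properness. Otherwise the class wanders, and a wandering set has fewer points than the number of
critical vertices plus three (`Wandering.card_lt`). Finite unlinked classes then give a closed
relation, and the other axioms follow from fibre matching for the closure. -/

/-! ### Angular coordinates -/

/-- The length of the positively oriented arc from `z` to `x`, a number in `[0, 1)`. -/
def ang (z x : S1) : ℝ := (AddCircle.equivIco (1 : ℝ) 0 (x - z) : ℝ)

theorem ang_nonneg (z x : S1) : 0 ≤ ang z x := (AddCircle.equivIco (1 : ℝ) 0 (x - z)).2.1

theorem ang_lt_one (z x : S1) : ang z x < 1 :=
  (AddCircle.equivIco (1 : ℝ) 0 (x - z)).2.2.trans_eq (zero_add 1)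

theorem coe_ang (z x : S1) : ((ang z x : ℝ) : S1) = x - z :=
  AddCircle.coe_equivIco (p := (1 : ℝ)) (a := 0)

theorem add_coe_ang (z x : S1) : z + ((ang z x : ℝ) : S1) = x := by rw [coe_ang]; abel

theorem ang_add_coe (z : S1) {t : ℝ} (h0 : 0 ≤ t) (h1 : t < 1) : ang z (z + (t : S1)) = t := by
  unfold ang
  rw [add_sub_cancel_left]
  exact AddCircle.equivIco_coe_of_mem (p := (1 : ℝ)) (a := 0) ⟨h0, by simpa using h1⟩

theorem ang_eq_of {z x : S1} {t : ℝ} (h0 : 0 ≤ t) (h1 : t < 1) (h : x = z + (t : S1)) :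
    ang z x = t := by rw [h, ang_add_coe z h0 h1]

theorem ang_self (z : S1) : ang z z = 0 := ang_eq_of le_rfl one_pos (by simp)

theorem ang_inj {z x y : S1} (h : ang z x = ang z y) : x = y := by
  rw [← add_coe_ang z x, h, add_coe_ang]

theorem ang_eq_zero {z x : S1} : ang z x = 0 ↔ x = z :=
  ⟨fun h => ang_inj (h.trans (ang_self z).symm), fun h => by rw [h, ang_self]⟩

theorem ang_pos {z x : S1} : 0 < ang z x ↔ x ≠ z := by
  rw [(ang_nonneg z x).lt_iff_ne', Ne, ang_eq_zero]

theorem coe_one : ((1 : ℝ) : S1) = 0 := AddCircle.coe_period 1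

/-- Change of base point. -/
theorem ang_base (z a b : S1) :
    (ang z a ≤ ang z b ∧ ang a b = ang z b - ang z a) ∨
      (ang z b < ang z a ∧ ang a b = ang z b - ang z a + 1) := by
  have e : b = a + ((ang z b - ang z a : ℝ) : S1) := by
    rw [AddCircle.coe_sub, coe_ang, coe_ang]; abel
  rcases le_or_gt (ang z a) (ang z b) with h | h
  · exact Or.inl ⟨h, ang_eq_of (by linarith) (by linarith [ang_lt_one z b, ang_nonneg z a]) e⟩
  · refine Or.inr ⟨h, ang_eq_of (by linarith [ang_lt_one z a, ang_nonneg z b]) (by linarith) ?_⟩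
    rw [AddCircle.coe_add, coe_one, add_zero]; exact e

theorem sbtw_iff_ang {a b c : S1} : sbtw a b c ↔ 0 < ang a b ∧ ang a b < ang a c := by
  -- `btw` on the circle compares the representative of `c - a` in `[0, 1)` with that of `b - a` in
  -- `(0, 1]`. The two kinds of representative differ only at `0`, whence the case `b = a`.
  have key : btw a c b ↔ ang a c ≤ (AddCircle.equivIoc (1 : ℝ) 0 (b - a) : ℝ) := Iff.rfl
  rw [sbtw_iff_not_btw, btw_cyclic, key, not_le]
  rcases eq_or_ne b a with h | h
  · subst h
    rw [sub_self, ang_self]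
    have : ((AddCircle.equivIoc (1 : ℝ) 0 0 : Set.Ioc (0 : ℝ) (0 + 1)) : ℝ) = 1 := by
      have := AddCircle.equivIoc_coe_of_mem (p := (1 : ℝ)) (a := 0) (y := 1) (by simp)
      rwa [coe_one] at this
    rw [this]
    constructor
    · intro h; linarith [ang_lt_one b c]
    · rintro ⟨h, -⟩; exact absurd h (lt_irrefl _)
  · have hp := ang_pos.2 h
    have : (AddCircle.equivIoc (1 : ℝ) 0 (b - a) : ℝ) = ang a b := by
      have := AddCircle.equivIoc_coe_of_mem (p := (1 : ℝ)) (a := 0) (y := ang a b)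
        ⟨hp, by simpa using (ang_lt_one a b).le⟩
      rwa [coe_ang] at this
    rw [this]; exact ⟨fun h => ⟨hp, h⟩, fun h => h.2⟩

/-- The cyclic order in the coordinate with an arbitrary base point. -/
theorem sbtw_iff_base (z : S1) {a b c : S1} : sbtw a b c ↔
    (ang z a < ang z b ∧ ang z b < ang z c) ∨ (ang z b < ang z c ∧ ang z c < ang z a) ∨
      (ang z c < ang z a ∧ ang z a < ang z b) := by
  rw [sbtw_iff_ang]
  have h1 := ang_base z a b
  have h2 := ang_base z a c
  have := ang_nonneg z a; have := ang_nonneg z b; have := ang_nonneg z c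
  have := ang_lt_one z a; have := ang_lt_one z b; have := ang_lt_one z c
  rcases h1 with ⟨h1, e1⟩ | ⟨h1, e1⟩ <;> rcases h2 with ⟨h2, e2⟩ | ⟨h2, e2⟩ <;> rw [e1, e2] <;>
    grind

/-! ### Crossing chords -/

theorem cross_mk {a b x y : S1} : Cross s(a, b) s(x, y) ↔
    (sbtw a x b ∧ sbtw b y a) ∨ (sbtw a y b ∧ sbtw b x a) := by
  constructor
  · rintro ⟨a', b', x', y', h1, h2, h3, h4⟩
    rw [Sym2.eq_iff] at h1 h2
    rcases h1 with ⟨rfl, rfl⟩ | ⟨rfl, rfl⟩ <;> rcases h2 with ⟨rfl, rfl⟩ | ⟨rfl, rfl⟩ <;> tauto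
  · rintro (⟨h1, h2⟩ | ⟨h1, h2⟩)
    · exact ⟨a, b, x, y, rfl, rfl, h1, h2⟩
    · exact ⟨a, b, y, x, rfl, Sym2.eq_swap, h1, h2⟩

/-- Crossing in terms of a coordinate. -/
theorem cross_iff_base (z : S1) {a b x y : S1} : Cross s(a, b) s(x, y) ↔
    (ang z a < ang z x ∧ ang z x < ang z b ∧ (ang z b < ang z y ∨ ang z y < ang z a)) ∨
    (ang z a < ang z y ∧ ang z y < ang z b ∧ (ang z b < ang z x ∨ ang z x < ang z a)) ∨
    (ang z b < ang z x ∧ ang z x < ang z a ∧ (ang z a < ang z y ∨ ang z y < ang z b)) ∨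
    (ang z b < ang z y ∧ ang z y < ang z a ∧ (ang z a < ang z x ∨ ang z x < ang z b)) := by
  rw [cross_mk, sbtw_iff_base z, sbtw_iff_base z, sbtw_iff_base z, sbtw_iff_base z]
  generalize ang z a = a, ang z b = b, ang z x = x, ang z y = y
  grind

theorem cross_comm {l m : Chord} : Cross l m ↔ Cross m l := by
  induction l using Sym2.ind with | _ a b
  induction m using Sym2.ind with | _ x y
  rw [cross_iff_base 0, cross_iff_base 0]
  generalize ang 0 a = a, ang 0 b = b, ang 0 x = x, ang 0 y = y
  grind

theorem not_cross_diag_left (a : S1) (m : Chord) : ¬ Cross s(a, a) m := by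
  induction m using Sym2.ind with | _ x y
  rw [cross_iff_base 0]
  grind

theorem not_cross_diag_right (a : S1) (m : Chord) : ¬ Cross m s(a, a) := fun h =>
  not_cross_diag_left a m (cross_comm.1 h)

/-! ### Chains of chords -/

theorem chainEquiv_iff {L : Set Chord} {x y : S1} :
    chainEquiv L x y ↔ Relation.ReflTransGen (fun x y => s(x, y) ∈ L) x y := by
  constructor
  · intro h
    change Relation.EqvGen _ x y at h
    induction h with
    | rel x y h => exact Relation.ReflTransGen.single h
    | refl x => exact Relation.ReflTransGen.refl
    | symm x y _ ih =>
      have : Std.Symm fun x y : S1 => s(x, y) ∈ L := ⟨fun a b h => by rw [Sym2.eq_swap]; exact h⟩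
      exact Relation.ReflTransGen.stdSymm.symm _ _ ih
    | trans x y z _ _ ih1 ih2 => exact ih1.trans ih2
  · intro h
    induction h with
    | refl => exact (chainEquiv L).refl _
    | tail _ h ih => exact (chainEquiv L).trans ih (Relation.EqvGen.rel _ _ h)

theorem chainEquiv_of_mem {L : Set Chord} {x y : S1} (h : s(x, y) ∈ L) : chainEquiv L x y :=
  Relation.EqvGen.rel _ _ h

/-- A chain joining two points separated by a chord passes through an endpoint of the chord or
contains a chord crossing it. -/
theorem exists_cross_of_chain {L : Set Chord} {x y a b : S1} (hxy : chainEquiv L x y)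
    (ha : ¬ chainEquiv L x a) (hb : ¬ chainEquiv L x b) (hc : Cross s(a, b) s(x, y)) :
    ∃ u v, chainEquiv L x u ∧ chainEquiv L x v ∧ s(u, v) ∈ L ∧ Cross s(a, b) s(u, v) := by
  by_contra hno
  push Not at hno
  -- A chain that avoids `a` and `b` and has no chord crossing `ab` stays on one side of `ab`.
  have key : ∀ w, chainEquiv L x w → (sbtw a x b ↔ sbtw a w b) := by
    intro w hw
    have hw' := chainEquiv_iff.1 hw
    induction hw' with
    | refl => rfl
    | @tail u v hu huv ih =>
      have hxu := chainEquiv_iff.2 hu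
      have h := hno u v hxu hw huv
      refine (ih hxu).trans ?_
      have n1 : a ≠ u := fun h => ha (h ▸ hxu)
      have n2 : a ≠ v := fun h => ha (h ▸ hw)
      have n3 : b ≠ u := fun h => hb (h ▸ hxu)
      have n4 : b ≠ v := fun h => hb (h ▸ hw)
      rw [cross_iff_base a] at h
      rw [sbtw_iff_ang, sbtw_iff_ang]
      have := ang_pos.2 n1.symm
      have := ang_pos.2 n2.symm
      have m3 : ang a b ≠ ang a u := fun h => n3 (ang_inj h)
      have m4 : ang a b ≠ ang a v := fun h => n4 (ang_inj h)
      rw [ang_self] at h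
      have := ang_nonneg a b
      grind
  have := key y hxy
  rw [cross_iff_base a] at hc
  rw [sbtw_iff_ang, sbtw_iff_ang] at this
  rw [ang_self] at hc
  have := ang_nonneg a b; have := ang_nonneg a x; have := ang_nonneg a y
  grind

/-- Two families without mutual crossings have unlinked or intersecting classes. -/
theorem chain_meet_of_cross {L M : Set Chord} (hLM : ∀ l ∈ L, ∀ m ∈ M, ¬ Cross l m)
    {a b x y : S1} (hab : chainEquiv L a b) (hxy : chainEquiv M x y)
    (hc : Cross s(a, b) s(x, y)) : ∃ w, chainEquiv L a w ∧ chainEquiv M x w := by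
  by_contra hno
  push Not at hno
  obtain ⟨u, v, hu, hv, huv, hc1⟩ := exists_cross_of_chain hxy
    (fun h => hno a ((chainEquiv L).refl a) h) (fun h => hno b hab h) hc
  obtain ⟨u', v', -, -, huv', hc2⟩ := exists_cross_of_chain hab
    (fun h => hno u h hu) (fun h => hno v h hv) (cross_comm.1 hc1)
  exact hLM _ huv' _ huv (cross_comm.1 hc2)

/-- If crossing chords of a family are always connected, then so are crossing pairs of connected
points. -/
theorem chain_of_cross {L : Set Chord}
    (hL : ∀ a b x y, s(a, b) ∈ L → s(x, y) ∈ L → Cross s(a, b) s(x, y) → chainEquiv L a x)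
    {a b x y : S1} (hab : chainEquiv L a b) (hxy : chainEquiv L x y)
    (hc : Cross s(a, b) s(x, y)) : chainEquiv L a x := by
  by_contra hno
  have T := @(chainEquiv L).trans
  have S := @(chainEquiv L).symm
  obtain ⟨u, v, hu, hv, huv, hc1⟩ := exists_cross_of_chain hxy
    (fun h => hno (S h)) (fun h => hno (T hab (S h))) hc
  obtain ⟨u', v', hu', -, huv', hc2⟩ := exists_cross_of_chain hab
    (fun h => hno (T h (S hu))) (fun h => hno (T h (S hv))) (cross_comm.1 hc1)
  exact hno (T hu' (T (hL _ _ _ _ huv' huv (cross_comm.1 hc2)) (S hu)))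

/-- Classes of an equivalence relation are unlinked. -/
def Unlinked (r : Setoid S1) : Prop :=
  ∀ a b x y, r a b → r x y → Cross s(a, b) s(x, y) → r a x

theorem unlinked_chainEquiv {L : Set Chord} (hL : ∀ l ∈ L, ∀ m ∈ L, ¬ Cross l m) :
    Unlinked (chainEquiv L) := fun _ _ _ _ hab hxy hc =>
  chain_of_cross (fun _ _ _ _ h1 h2 h3 => absurd h3 (hL _ h1 _ h2)) hab hxy hc

/-! ### Successors in finite sets -/

theorem exists_next {X : Set S1} (hX : X.Finite) {x : S1} (hne : ∃ y ∈ X, y ≠ x) :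
    ∃ y ∈ X, y ≠ x ∧ Disjoint (Set.cIoo x y) X := by
  obtain ⟨y, ⟨hy, hyx⟩, hmin⟩ := (hX.sep (· ≠ x)).exists_minimalFor (ang x) _ hne
  refine ⟨y, hy, hyx, Set.disjoint_left.2 fun w hw hwX => ?_⟩
  rw [Set.mem_cIoo, sbtw_iff_ang] at hw
  have := hmin ⟨hwX, ang_pos.1 hw.1⟩ hw.2.le
  linarith

theorem exists_prev {X : Set S1} (hX : X.Finite) {x : S1} (hne : ∃ y ∈ X, y ≠ x) :
    ∃ y ∈ X, y ≠ x ∧ Disjoint (Set.cIoo y x) X := by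
  obtain ⟨y, ⟨hy, hyx⟩, hmin⟩ := (hX.sep (· ≠ x)).exists_maximalFor (ang x) _ hne
  refine ⟨y, hy, hyx, Set.disjoint_left.2 fun w hw hwX => ?_⟩
  rw [Set.mem_cIoo, sbtw_iff_base x, ang_self] at hw
  have h0 := ang_nonneg x y
  have h2 := ang_nonneg x w
  have h1 : ang x y < ang x w := by grind
  have := hmin ⟨hwX, ang_pos.1 (h0.trans_lt h1)⟩ h1.le
  linarith

theorem prev_unique {X : Set S1} {x x' y : S1} (hx : x ∈ X) (hx' : x' ∈ X) (h1 : y ≠ x)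
    (h2 : y ≠ x') (hd : Disjoint (Set.cIoo x y) X) (hd' : Disjoint (Set.cIoo x' y) X) : x = x' := by
  have a1 : ¬ sbtw x x' y := fun h => Set.disjoint_left.1 hd h hx'
  have a2 : ¬ sbtw x' x y := fun h => Set.disjoint_left.1 hd' h hx
  rw [sbtw_iff_base y, ang_self] at a1 a2
  have := ang_pos.2 h1.symm
  have := ang_pos.2 h2.symm
  apply ang_inj (z := y)
  grind

theorem next_unique {X : Set S1} {x y y' : S1} (hy : y ∈ X) (hy' : y' ∈ X) (h1 : y ≠ x)
    (h2 : y' ≠ x) (hd : Disjoint (Set.cIoo x y) X) (hd' : Disjoint (Set.cIoo x y') X) :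
    y = y' := by
  have a1 : ¬ sbtw x y' y := fun h => Set.disjoint_left.1 hd h hy'
  have a2 : ¬ sbtw x y y' := fun h => Set.disjoint_left.1 hd' h hy
  rw [sbtw_iff_ang] at a1 a2
  have := ang_pos.2 h1
  have := ang_pos.2 h2
  apply ang_inj (z := x)
  grind

/-- The edges of the convex hull of a finite set connect all its points. -/
theorem chainEquiv_hullEdges {X : Set S1} (hX : X.Finite) {x y : S1} (hx : x ∈ X) (hy : y ∈ X) :
    chainEquiv (hullEdges X) x y := by
  by_contra hno
  obtain ⟨u, ⟨hu, hux⟩, hmin⟩ :=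
    (hX.sep (fun u => ¬ chainEquiv (hullEdges X) x u)).exists_minimalFor
    (ang x) _ ⟨y, hy, hno⟩
  have hne : u ≠ x := fun h => hux (h ▸ (chainEquiv _).refl x)
  -- `u` is the first point, counted from `x`, that is not connected to `x`; its predecessor `p`
  -- would be an earlier one.
  obtain ⟨p, hp, hpu, hd⟩ := exists_prev hX (x := u) ⟨x, hx, hne.symm⟩
  have hmem : s(p, u) ∈ hullEdges X := ⟨p, hp, u, hu, hpu, rfl, hd⟩
  have hnp : ¬ chainEquiv (hullEdges X) x p := fun h =>
    hux ((chainEquiv _).trans h (chainEquiv_of_mem hmem))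
  have hx' : ¬ sbtw p x u := fun h => Set.disjoint_left.1 hd h hx
  have hpx : p ≠ x := fun h => hnp (h ▸ (chainEquiv _).refl x)
  have h1 := hmin ⟨hp, hnp⟩
  rw [sbtw_iff_base x, ang_self] at hx'
  have := ang_pos.2 hpx
  have := ang_pos.2 hne
  have h2 : ang x p ≠ ang x u := fun h => hpu (ang_inj h)
  grind

theorem not_cross_hullEdges {X : Set S1} {e : Chord} (he : e ∈ hullEdges X) {x y : S1}
    (hx : x ∈ X) (hy : y ∈ X) : ¬ Cross e s(x, y) := by
  obtain ⟨a, ha, b, hb, hab, rfl, hd⟩ := he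
  intro h
  rw [cross_mk] at h
  rcases h with h | h
  · exact Set.disjoint_left.1 hd h.1 hx
  · exact Set.disjoint_left.1 hd h.1 hy

/-- If two points of a finite set separate `z` from `y`, then some edge of its convex hull does. -/
theorem exists_hullEdge_cross {W : Set S1} (hW : W.Finite) {z y p q : S1} (hy : y ∉ W) (hp : p ∈ W)
    (hq : q ∈ W) (hc : Cross s(z, y) s(p, q)) : ∃ e ∈ hullEdges W, Cross s(z, y) e := by
  have hpy : p ≠ y := fun h => hy (h ▸ hp)
  -- `t` and `s` bound the hole of `W` containing `y`, so `st` is the edge facing `y`, and `p`, `q`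
  -- lie weakly behind it.
  obtain ⟨t, ht, hty, hd⟩ := exists_next hW (x := y) ⟨p, hp, hpy⟩
  obtain ⟨s, hs, hsy, hd'⟩ := exists_prev hW (x := y) ⟨p, hp, hpy⟩
  have key : ∀ w ∈ W, ang y t ≤ ang y w ∧ ang y w ≤ ang y s := by
    intro w hw
    have hwy : w ≠ y := fun h => hy (h ▸ hw)
    have h1 : ¬ sbtw y w t := fun h => Set.disjoint_left.1 hd h hw
    have h2 : ¬ sbtw s w y := fun h => Set.disjoint_left.1 hd' h hw
    rw [sbtw_iff_ang] at h1
    rw [sbtw_iff_base y, ang_self] at h2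
    have := ang_pos.2 hwy
    have := ang_pos.2 hsy
    grind
  have hp' := key p hp
  have hq' := key q hq
  rw [cross_iff_base y, ang_self] at hc
  have := ang_nonneg y z
  have hst : ang y t < ang y s := by grind
  refine ⟨s(s, t), ⟨s, hs, t, ht, fun h => by rw [h] at hst; exact lt_irrefl _ hst, rfl, ?_⟩, ?_⟩
  · refine Set.disjoint_left.2 fun w hw hwW => ?_
    have := key w hwW
    rw [Set.mem_cIoo, sbtw_iff_base y] at hw
    grind
  · rw [cross_iff_base y, ang_self]
    have := ang_pos.2 hty
    grind

/-! ### The map `σ_d` -/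

theorem sigma_add_coe (d : ℕ) (z : S1) (t : ℝ) :
    sigma d (z + (t : S1)) = sigma d z + ((d * t : ℝ) : S1) := by
  unfold sigma
  rw [smul_add, ← AddCircle.coe_nsmul, nsmul_eq_mul]

theorem sigma_eq (d : ℕ) (z x : S1) : sigma d x = sigma d z + ((d * ang z x : ℝ) : S1) := by
  rw [← sigma_add_coe, add_coe_ang]

theorem continuous_sigma (d : ℕ) : Continuous (sigma d) := by
  unfold sigma; fun_prop

theorem sigma_iterate (d k : ℕ) : (sigma d)^[k] = sigma (d ^ k) := by
  induction k with
  | zero => ext x; simp [sigma]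
  | succ k ih =>
    ext x
    rw [Function.iterate_succ_apply', ih]
    simp only [sigma]
    rw [pow_succ', mul_smul]

theorem finite_fiber {n : ℕ} (hn : 0 < n) (c : S1) : {x | sigma n x = c}.Finite := by
  by_cases h : ∃ x0, sigma n x0 = c
  · obtain ⟨x0, rfl⟩ := h
    refine ((AddCircle.finite_torsion (1 : ℝ) hn).image (fun u => x0 + u)).subset fun x hx => ?_
    refine ⟨x - x0, ?_, by simp⟩
    simp only [sigma, Set.mem_ofPred_eq] at hx ⊢
    rw [smul_sub, hx, sub_self]
  · convert Set.finite_empty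
    ext x
    simp only [Set.mem_ofPred_eq, Set.mem_empty_iff_false, iff_false]
    exact fun hx => h ⟨x, hx⟩

theorem finite_preimage_sigma {n : ℕ} (hn : 0 < n) {X : Set S1} (hX : X.Finite) :
    (sigma n ⁻¹' X).Finite := by
  have : sigma n ⁻¹' X = ⋃ c ∈ X, {x | sigma n x = c} := by ext; simp
  rw [this]
  exact hX.biUnion fun c _ => finite_fiber hn c

theorem coe_eq_coe_iff {s t : ℝ} : (s : S1) = (t : S1) ↔ ∃ k : ℤ, s - t = k := by
  rw [← sub_eq_zero, ← AddCircle.coe_sub, AddCircle.coe_eq_zero_iff]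
  constructor
  · rintro ⟨n, hn⟩; exact ⟨n, by rw [← hn]; simp⟩
  · rintro ⟨n, hn⟩; exact ⟨n, by rw [hn]; simp⟩

/-- Points with equal images differ by a multiple of `1 / d`. -/
theorem sigma_eq_sigma_iff {d : ℕ} {z x : S1} :
    sigma d x = sigma d z ↔ ∃ k : ℤ, d * ang z x = k := by
  rw [sigma_eq d z x]
  constructor
  · intro h
    have : ((d * ang z x : ℝ) : S1) = ((0 : ℝ) : S1) := by simpa using h
    simpa using coe_eq_coe_iff.1 this
  · rintro ⟨k, hk⟩
    have : ((d * ang z x : ℝ) : S1) = ((0 : ℝ) : S1) := coe_eq_coe_iff.2 ⟨k, by simp [hk]⟩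
    rw [this]; simp

theorem ang_sigma_of_lt {d : ℕ} {z x : S1} (h : d * ang z x < 1) :
    ang (sigma d z) (sigma d x) = d * ang z x :=
  ang_eq_of (mul_nonneg (by positivity) (ang_nonneg _ _)) h (sigma_eq d z x)

theorem sigma_add_div {d : ℕ} (hd : 0 < d) (x : S1) (j : ℕ) :
    sigma d (x + ((j / d : ℝ) : S1)) = sigma d x := by
  rw [sigma_add_coe]
  have : (d : ℝ) * (j / d) = j := by field_simp
  rw [this]
  have : ((j : ℝ) : S1) = ((0 : ℝ) : S1) := coe_eq_coe_iff.2 ⟨j, by simp⟩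
  rw [this]; simp

theorem exists_sigma_eq {d : ℕ} (hd : 0 < d) (c : S1) : ∃ x, sigma d x = c := by
  refine ⟨0 + ((ang 0 c / d : ℝ) : S1), ?_⟩
  rw [sigma_add_coe, mul_div_cancel₀ _ (by positivity), coe_ang]
  simp [sigma]

/-- The fibre of `σ_d` through `x`. -/
theorem exists_fin_of_sigma_eq {d : ℕ} (hd : 0 < d) {x y : S1} (h : sigma d y = sigma d x) :
    ∃ j : Fin d, y = x + ((j / d : ℝ) : S1) := by
  obtain ⟨k, hk⟩ := sigma_eq_sigma_iff.1 h
  have hd' : (0 : ℝ) < d := by exact_mod_cast hd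
  have h0 : (0 : ℝ) ≤ k := hk ▸ mul_nonneg hd'.le (ang_nonneg x y)
  have h1 : (k : ℝ) < d := by
    rw [← hk]; nlinarith [ang_lt_one x y]
  have h0' : 0 ≤ k := by exact_mod_cast h0
  obtain ⟨n, rfl⟩ := Int.eq_ofNat_of_zero_le h0'
  have h1' : n < d := by exact_mod_cast h1
  refine ⟨⟨n, h1'⟩, ?_⟩
  have : ang x y = n / d := by rw [eq_div_iff hd'.ne', mul_comm, hk]; simp
  rw [← this, add_coe_ang]

theorem fin_add_div_injective {d : ℕ} (hd : 0 < d) (x : S1) :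
    Function.Injective fun j : Fin d => x + (((j : ℕ) / d : ℝ) : S1) := by
  intro i j h
  have hd' : (0 : ℝ) < d := by exact_mod_cast hd
  have key : ∀ j : Fin d, ang x (x + (((j : ℕ) / d : ℝ) : S1)) = (j : ℕ) / d := fun j =>
    ang_add_coe x (by positivity) (by rw [div_lt_one hd']; exact_mod_cast j.2)
  have := (key i).symm.trans ((congrArg (ang x) h).trans (key j))
  rw [div_left_inj' hd'.ne'] at this
  exact Fin.ext (by exact_mod_cast this)

/-! ### Topology of the cyclic order -/

/-- The set is the image, under the open quotient map, of the triples of reals with `α < β < γ < α +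
1`. -/
theorem isOpen_sbtw : IsOpen {p : S1 × S1 × S1 | sbtw p.1 p.2.1 p.2.2} := by
  have hopen : IsOpenMap ((↑) : ℝ → S1) := QuotientAddGroup.isOpenMap_coe
  have hO : IsOpen {p : ℝ × ℝ × ℝ | p.1 < p.2.1 ∧ p.2.1 < p.2.2 ∧ p.2.2 < p.1 + 1} := by
    have c1 : Continuous fun p : ℝ × ℝ × ℝ => p.1 := by fun_prop
    have c2 : Continuous fun p : ℝ × ℝ × ℝ => p.2.1 := by fun_prop
    have c3 : Continuous fun p : ℝ × ℝ × ℝ => p.2.2 := by fun_prop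
    exact (isOpen_lt c1 c2).inter ((isOpen_lt c2 c3).inter (isOpen_lt c3 (c1.add_const 1)))
  have := (hopen.prodMap (hopen.prodMap hopen)) _ hO
  convert this
  ext ⟨a, b, c⟩
  simp only [Set.mem_ofPred_eq, Set.mem_image, Prod.exists, Prod.map_apply, Prod.mk.injEq]
  constructor
  · intro h
    rw [sbtw_iff_ang] at h
    have e : ∀ x, ((ang 0 a + ang a x : ℝ) : S1) = x := fun x => by
      rw [AddCircle.coe_add, coe_ang, coe_ang]; simp
    refine ⟨ang 0 a, ang 0 a + ang a b, ang 0 a + ang a c, ⟨by linarith, by linarith, ?_⟩, ?_, e b,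
      e c⟩
    · linarith [ang_lt_one a c]
    · rw [coe_ang]; simp
  · rintro ⟨α, β, γ, ⟨h1, h2, h3⟩, rfl, rfl, rfl⟩
    have e : ∀ t : ℝ, α < t → t < α + 1 → ang (α : S1) (t : S1) = t - α := fun t h h' =>
      ang_eq_of (by linarith) (by linarith) (by rw [AddCircle.coe_sub]; abel)
    rw [sbtw_iff_ang, e β h1 (by linarith), e γ (by linarith) h3]
    constructor <;> linarith

theorem isOpen_cross : IsOpen {p : (S1 × S1) × (S1 × S1) |
    Cross s(p.1.1, p.1.2) s(p.2.1, p.2.2)} := by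
  simp only [cross_mk]
  refine IsOpen.union (IsOpen.inter ?_ ?_) (IsOpen.inter ?_ ?_)
  · exact isOpen_sbtw.preimage
      (f := fun p : (S1 × S1) × (S1 × S1) => (p.1.1, p.2.1, p.1.2)) (by fun_prop)
  · exact isOpen_sbtw.preimage
      (f := fun p : (S1 × S1) × (S1 × S1) => (p.1.2, p.2.2, p.1.1)) (by fun_prop)
  · exact isOpen_sbtw.preimage
      (f := fun p : (S1 × S1) × (S1 × S1) => (p.1.1, p.2.2, p.1.2)) (by fun_prop)
  · exact isOpen_sbtw.preimage
      (f := fun p : (S1 × S1) × (S1 × S1) => (p.1.2, p.2.1, p.1.1)) (by fun_prop)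

theorem sbtw_or_sbtw {p q w : S1} (h1 : p ≠ q) (h2 : p ≠ w) (h3 : q ≠ w) :
    sbtw p q w ∨ sbtw p w q := by
  rw [sbtw_iff_ang, sbtw_iff_ang]
  have := ang_pos.2 h1.symm
  have := ang_pos.2 h2.symm
  have : ang p q ≠ ang p w := fun h => h3 (ang_inj h)
  grind

/-- Which of the two crossings occurs depends on which of `p₁`, `p₂` comes first: if `p₂` follows
`p₁`, then `p₁q₁` separates `p₂` from `w₂`; otherwise `p₁w₁` separates `p₂` from `q₂`. -/
theorem cross_of_sbtw {p₁ p₂ q₁ q₂ w₁ w₂ : S1} (hp : p₁ ≠ p₂) (h12 : sbtw p₁ q₁ w₂)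
    (h11 : sbtw p₁ q₂ w₁) (h21 : sbtw p₂ q₂ w₁) (h' : sbtw p₁ q₁ w₁)
    (h'' : sbtw p₁ q₂ w₂) (h3 : sbtw p₂ q₁ w₁) :
    Cross s(p₁, q₁) s(p₂, w₂) ∨ Cross s(p₁, w₁) s(p₂, q₂) := by
  rw [cross_iff_base p₁, cross_iff_base p₁]
  rw [sbtw_iff_base p₁] at h12 h11 h21 h' h'' h3
  have := ang_pos.2 hp.symm
  rw [ang_self] at *
  grind

/-- Two unlinked disjoint sets cannot both come close to three distinct points. -/
theorem exists_nhds_cross {p q w : S1} (h1 : p ≠ q) (h2 : p ≠ w) (h3 : q ≠ w) :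
    ∃ U ∈ 𝓝 p, ∃ V ∈ 𝓝 q, ∃ W ∈ 𝓝 w, ∀ p₁ ∈ U, ∀ p₂ ∈ U, ∀ q₁ ∈ V, ∀ q₂ ∈ V, ∀ w₁ ∈ W, ∀ w₂ ∈ W,
      p₁ ≠ p₂ → Cross s(p₁, q₁) s(p₂, w₂) ∨ Cross s(p₁, w₁) s(p₂, q₂) := by
  have key : ∀ q w : S1, sbtw p q w → ∃ U ∈ 𝓝 p, ∃ V ∈ 𝓝 q, ∃ W ∈ 𝓝 w,
      ∀ p' ∈ U, ∀ q' ∈ V, ∀ w' ∈ W, sbtw p' q' w' := by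
    intro q w h
    have := isOpen_sbtw.mem_nhds (x := (p, q, w)) h
    rw [nhds_prod_eq, nhds_prod_eq, Filter.mem_prod_iff] at this
    obtain ⟨U, hU, T, hT, hUT⟩ := this
    obtain ⟨V, hV, W, hW, hVW⟩ := Filter.mem_prod_iff.1 hT
    exact ⟨U, hU, V, hV, W, hW, fun p' hp q' hq w' hw =>
      hUT (show (p', q', w') ∈ U ×ˢ T from ⟨hp, hVW (show (q', w') ∈ V ×ˢ W from ⟨hq, hw⟩)⟩)⟩
  rcases sbtw_or_sbtw h1 h2 h3 with h | h
  · obtain ⟨U, hU, V, hV, W, hW, H⟩ := key q w h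
    refine ⟨U, hU, V, hV, W, hW, fun p₁ hp₁ p₂ hp₂ q₁ hq₁ q₂ hq₂ w₁ hw₁ w₂ hw₂ hne => ?_⟩
    apply cross_of_sbtw hne <;> apply H <;> assumption
  · obtain ⟨U, hU, W, hW, V, hV, H⟩ := key w q h
    refine ⟨U, hU, V, hV, W, hW, fun p₁ hp₁ p₂ hp₂ q₁ hq₁ q₂ hq₂ w₁ hw₁ w₂ hw₂ hne => ?_⟩
    refine Or.symm ?_
    apply cross_of_sbtw hne <;> apply H <;> assumption

/-! ### Convex hulls -/

theorem pt_add_coe (s : S1) (t : ℝ) :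
    pt (s + (t : S1)) = pt s * Complex.exp ((2 * Real.pi * t : ℝ) * Complex.I) := by
  unfold pt
  rw [AddCircle.toCircle_add, Circle.coe_mul, AddCircle.toCircle_apply_mk, Circle.coe_exp]
  simp

theorem norm_pt (s : S1) : ‖pt s‖ = 1 := Circle.norm_coe _

theorem pt_injective : Function.Injective pt := fun _ _ h =>
  AddCircle.injective_toCircle one_ne_zero (Circle.ext h)

/-- The linear functional separating the arc of length `L` starting at `s` from the
complementary arc. -/
theorem re_pt_mul (s x : S1) (L : ℝ) :
    (pt x * (starRingEnd ℂ) (pt (s + ((L / 2 : ℝ) : S1)))).re =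
      Real.cos (Real.pi * (2 * ang s x - L)) := by
  have h1 : pt x = pt s * Complex.exp ((2 * Real.pi * ang s x : ℝ) * Complex.I) := by
    rw [← pt_add_coe, add_coe_ang]
  have hs : pt s * (starRingEnd ℂ) (pt s) = 1 := by
    rw [Complex.mul_conj, Complex.normSq_eq_norm_sq, norm_pt]; simp
  rw [h1, pt_add_coe, map_mul, ← Complex.exp_conj]
  have : pt s * Complex.exp ((2 * Real.pi * ang s x : ℝ) * Complex.I) *
      ((starRingEnd ℂ) (pt s) * Complex.exp ((starRingEnd ℂ)
        ((2 * Real.pi * (L / 2) : ℝ) * Complex.I))) =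
      (pt s * (starRingEnd ℂ) (pt s)) *
        Complex.exp (((Real.pi * (2 * ang s x - L) : ℝ) : ℂ) * Complex.I) := by
    rw [mul_mul_mul_comm, ← Complex.exp_add]
    congr 2
    rw [map_mul, Complex.conj_ofReal, Complex.conj_I]
    push_cast; ring
  rw [this, hs, one_mul, Complex.exp_ofReal_mul_I_re]

/-- The real part of the product with the conjugate of the midpoint of the arc takes the value `cos
(π L)` at both ends of the arc, larger values inside and at most this value outside. -/
theorem disjoint_convexHull_of_arc {X Y : Set S1} {s : S1} {L : ℝ} (hL : L ≤ 1)
    (hX : ∀ x ∈ X, 0 < ang s x ∧ ang s x < L) (hY : ∀ y ∈ Y, y = s ∨ L ≤ ang s y) :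
    Disjoint (convexHull ℝ (pt '' X)) (convexHull ℝ (pt '' Y)) := by
  rcases X.eq_empty_or_nonempty with rfl | ⟨x0, hx0⟩
  · simp
  have hL0 : 0 < L := (hX x0 hx0).1.trans (hX x0 hx0).2
  set c := Real.cos (Real.pi * L)
  let φ : ℂ → ℝ := fun z => (z * (starRingEnd ℂ) (pt (s + ((L / 2 : ℝ) : S1)))).re
  have hφ : IsLinearMap ℝ φ := by
    constructor
    · intro x y; simp [φ, add_mul]; ring
    · intro a x; simp [φ]; ring
  have h1 : convexHull ℝ (pt '' X) ⊆ {z | c < φ z} := by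
    refine convexHull_min ?_ (convex_halfSpace_gt hφ c)
    rintro _ ⟨x, hx, rfl⟩
    obtain ⟨ha, hb⟩ := hX x hx
    change c < φ (pt x)
    simp only [φ]
    rw [re_pt_mul, ← Real.cos_abs (Real.pi * (2 * ang s x - L))]
    apply Real.cos_lt_cos_of_nonneg_of_le_pi (abs_nonneg _)
    · nlinarith [Real.pi_pos]
    · rw [abs_mul, abs_of_pos Real.pi_pos]
      refine mul_lt_mul_of_pos_left ?_ Real.pi_pos
      rw [abs_lt]; constructor <;> linarith
  have h2 : convexHull ℝ (pt '' Y) ⊆ {z | φ z ≤ c} := by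
    refine convexHull_min ?_ (convex_halfSpace_le hφ c)
    rintro _ ⟨y, hy, rfl⟩
    change φ (pt y) ≤ c
    simp only [φ]
    rw [re_pt_mul]
    rcases hY y hy with rfl | h
    · rw [ang_self]
      apply le_of_eq
      rw [← Real.cos_neg]
      congr 1; ring
    · rcases le_total (2 * ang s y - L) 1 with h' | h'
      · apply Real.cos_le_cos_of_nonneg_of_le_pi (mul_nonneg Real.pi_pos.le hL0.le)
        · nlinarith [Real.pi_pos]
        · exact mul_le_mul_of_nonneg_left (by linarith) Real.pi_pos.le
      · rw [← Real.cos_two_pi_sub (Real.pi * (2 * ang s y - L))]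
        apply Real.cos_le_cos_of_nonneg_of_le_pi (mul_nonneg Real.pi_pos.le hL0.le)
        · nlinarith [Real.pi_pos]
        · have := ang_lt_one s y
          nlinarith [Real.pi_pos]
  exact Set.disjoint_left.2 fun z hz hw =>
    absurd (show c < φ z from h1 hz) (not_lt.2 (show φ z ≤ c from h2 hw))

/-- Unlinked disjoint finite sets have disjoint convex hulls. -/
theorem disjoint_convexHull_of_unlinked {X Y : Set S1} (hX : X.Finite) (hXY : Disjoint X Y)
    (hc : ∀ a ∈ X, ∀ b ∈ X, ∀ x ∈ Y, ∀ y ∈ Y, ¬ Cross s(a, b) s(x, y)) :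
    Disjoint (convexHull ℝ (pt '' X)) (convexHull ℝ (pt '' Y)) := by
  rcases X.eq_empty_or_nonempty with rfl | hXn
  · simp
  rcases Y.eq_empty_or_nonempty with rfl | ⟨y, hy⟩
  · simp
  have hne : ∀ x ∈ X, ∀ z ∈ Y, x ≠ z := fun x hx z hz h => Set.disjoint_left.1 hXY hx (h ▸ hz)
  -- Seen from `y ∈ Y`, the set `X` fills an arc from `t` to `s`. Being unlinked with `X`, all of
  -- `Y` lies in the open arc from `s` to `t`.
  obtain ⟨t, ht, hmin⟩ := hX.exists_minimalFor (ang y) _ hXn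
  obtain ⟨s, hs, hmax⟩ := hX.exists_maximalFor (ang y) _ hXn
  have hmin' : ∀ x ∈ X, ang y t ≤ ang y x := fun x hx => by
    by_contra h; exact h (hmin hx (not_le.1 h).le)
  have hmax' : ∀ x ∈ X, ang y x ≤ ang y s := fun x hx => by
    by_contra h; exact h (hmax hx (not_le.1 h).le)
  have hy' : ∀ z ∈ Y, ang y z < ang y t ∨ ang y s < ang y z := by
    intro z hz
    by_contra hcon
    push Not at hcon
    have h1 := hc t ht s hs y hy z hz
    rw [cross_iff_base y, ang_self] at h1
    have m1 : ang y t ≠ ang y z := fun h => hne t ht z hz (ang_inj h)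
    have m2 : ang y s ≠ ang y z := fun h => hne s hs z hz (ang_inj h)
    have := ang_pos.2 (hne t ht y hy)
    have := ang_pos.2 (hne s hs y hy)
    grind
  have hts := hmin' s hs
  symm
  -- If `X` is a single point, the complementary arc goes once around the circle, so its length is
  -- `1` rather than `ang s s = 0`.
  set L := if s = t then 1 else ang s t with hLdef
  have hL : L = ang y t - ang y s + 1 := by
    rw [hLdef]; split_ifs with h
    · rw [h]; ring
    · rcases ang_base y s t with ⟨h1, e⟩ | ⟨h1, e⟩
      · exact absurd (ang_inj (le_antisymm h1 hts)) h
      · exact e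
  refine disjoint_convexHull_of_arc (s := s) (L := L) (by rw [hL]; linarith) ?_ ?_
  · intro z hz
    refine ⟨ang_pos.2 (hne s hs z hz).symm, ?_⟩
    have := hy' z hz
    have := ang_base y s z
    have := ang_lt_one y z; have := ang_nonneg y t; have := ang_pos.2 (hne t ht y hy)
    grind
  · intro x hx
    rcases eq_or_ne x s with h | h
    · exact Or.inl h
    · right
      have h1 := hmin' x hx
      have h2 := hmax' x hx
      have h3 : ang y x ≠ ang y s := fun h' => h (ang_inj h')
      have := ang_base y s x
      grind

/-! ### Critical collections -/

theorem exists_pos_lt_of_finite {α : Type*} {X : Set α} (hX : X.Finite) (f : α → ℝ)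
    (hf : ∀ x ∈ X, 0 < f x) : ∃ ε > 0, ∀ x ∈ X, ε < f x := by
  rcases X.eq_empty_or_nonempty with rfl | hne
  · exact ⟨1, one_pos, by simp⟩
  · obtain ⟨x0, hx0, hmin⟩ := hX.exists_minimalFor f _ hne
    refine ⟨f x0 / 2, half_pos (hf x0 hx0), fun x hx => ?_⟩
    have := hf x0 hx0
    by_contra h
    have := hmin hx (by linarith)
    linarith

theorem ang_add {x q p : S1} (h : ang x q + ang q p < 1) : ang x p = ang x q + ang q p := by
  rcases ang_base x q p with ⟨h1, e⟩ | ⟨h1, e⟩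
  · linarith
  · have := ang_nonneg x p; linarith

section Crit

variable {d : ℕ} {C : Set Chord}

theorem IsCriticalCollection.ne (hC : IsCriticalCollection d C) {a b : S1} (h : s(a, b) ∈ C) :
    a ≠ b := fun e => (hC.1 _ h).1 e

theorem IsCriticalCollection.sigma_eq (hC : IsCriticalCollection d C) {a b : S1}
    (h : s(a, b) ∈ C) : sigma d a = sigma d b := (hC.1 _ h).2

theorem mem_vertices_left {a b : S1} (h : s(a, b) ∈ C) : a ∈ vertices C :=
  ⟨_, h, Sym2.mem_mk_left a b⟩

theorem mem_vertices_right {a b : S1} (h : s(a, b) ∈ C) : b ∈ vertices C :=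
  ⟨_, h, Sym2.mem_mk_right a b⟩

theorem exists_of_mem_vertices {L : Set Chord} {a : S1} (h : a ∈ vertices L) :
    ∃ b, s(a, b) ∈ L := by
  obtain ⟨l, hl, b, rfl⟩ := h
  exact ⟨b, hl⟩

theorem IsCriticalCollection.sigma_eq_of_chain (hC : IsCriticalCollection d C) {a b : S1}
    (h : chainEquiv C a b) : sigma d a = sigma d b := by
  rw [chainEquiv_iff] at h
  induction h with
  | refl => rfl
  | tail _ h ih => exact ih.trans (hC.sigma_eq h)

theorem IsCriticalCollection.finite_class (hC : IsCriticalCollection d C) (hd : 0 < d) (a : S1) :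
    {x | chainEquiv C a x}.Finite :=
  (finite_fiber hd (sigma d a)).subset fun _ hx => (hC.sigma_eq_of_chain hx).symm

theorem IsCriticalCollection.unlinked (hC : IsCriticalCollection d C) : Unlinked (chainEquiv C) :=
  unlinked_chainEquiv hC.2

theorem eq_of_chain_of_not_mem {L : Set Chord} {a b : S1} (ha : a ∉ vertices L)
    (h : chainEquiv L a b) : a = b := by
  rw [chainEquiv_iff, Relation.ReflTransGen.cases_head_iff] at h
  rcases h with h | ⟨c, h, -⟩
  · exact h
  · exact absurd (mem_vertices_left h) ha

theorem mem_vertices_of_chain {L : Set Chord} {a b : S1} (ha : a ∈ vertices L)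
    (h : chainEquiv L a b) : b ∈ vertices L := by
  by_contra hb
  exact hb (eq_of_chain_of_not_mem hb ((chainEquiv L).symm h) ▸ ha)

/-- A critical chord spans `j / d` of the circle with `0 < j < d`. Two chords with the same `j` that
start less than `1 / d` apart would cross, so for each `j` the starting points have distinct values
of `⌊d * ang 0 a⌋₊` below `d`. -/
theorem IsCriticalCollection.finite_vertices (hC : IsCriticalCollection d C) (hd : 0 < d) :
    (vertices C).Finite := by
  have hd' : (0 : ℝ) < d := by exact_mod_cast hd
  have hsub : vertices C ⊆ ⋃ j : Fin d, {a | s(a, a + (((j : ℕ) / d : ℝ) : S1)) ∈ C} := by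
    intro a ha
    obtain ⟨b, hb⟩ := exists_of_mem_vertices ha
    obtain ⟨j, rfl⟩ := exists_fin_of_sigma_eq hd (hC.sigma_eq hb).symm
    exact Set.mem_iUnion.2 ⟨j, hb⟩
  refine Set.Finite.subset (Set.finite_iUnion fun j => ?_) hsub
  have far : ∀ a ∈ {a | s(a, a + (((j : ℕ) / d : ℝ) : S1)) ∈ C},
      ∀ a' ∈ {a | s(a, a + (((j : ℕ) / d : ℝ) : S1)) ∈ C}, a' ≠ a → 1 ≤ d * ang a a' := by
    intro a ha a' ha' hne
    by_contra hlt
    push Not at hlt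
    have hj0 : 0 < (j : ℕ) := by
      rcases Nat.eq_zero_or_pos j with h | h
      · exact absurd (by simp [h]) (hC.ne ha)
      · exact h
    have hj1 : (1 : ℝ) ≤ (j : ℕ) := by exact_mod_cast hj0
    have hj2 : ((j : ℕ) : ℝ) + 1 ≤ d := by exact_mod_cast j.2
    have hp := ang_pos.2 hne
    have hlt' : ang a a' < 1 / d := by rw [lt_div_iff₀ hd']; linarith
    have e1 : ang a (a + (((j : ℕ) / d : ℝ) : S1)) = (j : ℕ) / d :=
      ang_add_coe a (by positivity) (by rw [div_lt_one hd']; linarith)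
    have h12 : 1 / (d : ℝ) ≤ (j : ℕ) / d := by gcongr
    have h13 : ((j : ℕ) : ℝ) / d + 1 / d ≤ 1 := by rw [← add_div, div_le_one hd']; linarith
    have e2 : ang a (a' + (((j : ℕ) / d : ℝ) : S1)) = ang a a' + (j : ℕ) / d := by
      apply ang_eq_of
      · positivity
      · linarith
      · rw [AddCircle.coe_add, ← add_assoc, add_coe_ang]
    refine hC.2 _ ha _ ha' ?_
    rw [cross_iff_base a, ang_self, e1, e2]
    left
    exact ⟨hp, by linarith, Or.inl (by linarith)⟩
  refine Set.Finite.of_injOn (f := fun a => ⌊d * ang 0 a⌋₊) (t := Set.Iio d) ?_ ?_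
    (Set.finite_Iio d)
  · intro a _
    simp only [Set.mem_Iio]
    rw [Nat.floor_lt (mul_nonneg hd'.le (ang_nonneg _ _))]
    nlinarith [ang_lt_one 0 a]
  · intro a ha a' ha' h
    by_contra hne
    have f1 := far a ha a' ha' (Ne.symm hne)
    have f2 := far a' ha' a ha hne
    simp only at h
    have g1 := Nat.floor_le (mul_nonneg hd'.le (ang_nonneg 0 a))
    have g2 := Nat.floor_le (mul_nonneg hd'.le (ang_nonneg 0 a'))
    have g3 := Nat.lt_floor_add_one (d * ang 0 a)
    have g4 := Nat.lt_floor_add_one (d * ang 0 a')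
    rw [h] at g1 g3
    rcases ang_base 0 a a' with ⟨h1, e⟩ | ⟨h1, e⟩
    · rw [e] at f1; nlinarith
    · rcases ang_base 0 a' a with ⟨h1', e'⟩ | ⟨h1', e'⟩
      · rw [e'] at f2; nlinarith
      · linarith

/-- In a full critical collection, points with equal images that are not endpoints of critical
chords are separated by a critical chord. -/
theorem IsFullCriticalCollection.exists_cross (hC : IsFullCriticalCollection d C) {u v : S1}
    (hu : u ∉ vertices C) (hv : v ∉ vertices C) (huv : u ≠ v) (hσ : sigma d u = sigma d v) :
    ∃ c ∈ C, Cross s(u, v) c := by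
  by_contra hno
  push Not at hno
  have hpt : pt u ≠ pt v := fun h => huv (pt_injective h)
  -- If no critical chord separates `u` from `v`, the open segment between them lies in one
  -- component of the complement. Both points are then on its frontier, where fullness makes `σ_d`
  -- injective.
  have hdisj : ∀ c ∈ C, Disjoint (openSegment ℝ (pt u) (pt v)) (Chord.seg c) := by
    intro c hc
    have h1 : Disjoint (convexHull ℝ (pt '' {u, v})) (convexHull ℝ (pt '' {x | x ∈ c})) := by
      induction c using Sym2.ind with | _ a b
      have e : {x | x ∈ s(a, b)} = ({a, b} : Set S1) := by ext; simp
      rw [e]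
      have hau : a ≠ u := fun h => hu (h ▸ mem_vertices_left hc)
      have hav : a ≠ v := fun h => hv (h ▸ mem_vertices_left hc)
      have hbu : b ≠ u := fun h => hu (h ▸ mem_vertices_right hc)
      have hbv : b ≠ v := fun h => hv (h ▸ mem_vertices_right hc)
      refine disjoint_convexHull_of_unlinked (by simp) ?_ ?_
      · rw [Set.disjoint_left]
        rintro x (rfl | rfl) (h | h)
        exacts [hau h.symm, hbu h.symm, hav h.symm, hbv h.symm]
      · have h := hno _ hc
        have h' : ¬ Cross s(v, u) s(a, b) := by rwa [Sym2.eq_swap]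
        have h2 : ¬ Cross s(u, v) s(b, a) := by rwa [Sym2.eq_swap (a := b)]
        have h3 : ¬ Cross s(v, u) s(b, a) := by rwa [Sym2.eq_swap (a := b)]
        rintro p (rfl | rfl) q (rfl | rfl) x (rfl | rfl) y (rfl | rfl) <;>
          first
          | exact not_cross_diag_left _ _
          | exact not_cross_diag_right _ _
          | assumption
    refine h1.mono_left ?_
    rw [Set.image_pair, convexHull_pair]
    exact openSegment_subset_segment ℝ _ _
  have hball : openSegment ℝ (pt u) (pt v) ⊆ Metric.ball 0 1 :=
    openSegment_subset_ball_of_ne (by simp [norm_pt]) (by simp [norm_pt]) hpt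
  have hsub : openSegment ℝ (pt u) (pt v) ⊆ complementDisk C := by
    intro z hz
    refine ⟨hball hz, ?_⟩
    simp only [Set.mem_iUnion, not_exists]
    exact fun c hc hz' => Set.disjoint_left.1 (hdisj c hc) hz hz'
  obtain ⟨z, hz⟩ : (openSegment ℝ (pt u) (pt v)).Nonempty :=
    ⟨_, midpoint_mem_openSegment (𝕜 := ℝ) (pt u) (pt v)⟩
  set B := connectedComponentIn (complementDisk C) z with hB
  have hSB : openSegment ℝ (pt u) (pt v) ⊆ B :=
    (convex_openSegment (𝕜 := ℝ) (pt u) (pt v)).isPreconnected.subset_connectedComponentIn hz hsub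
  have hcl : segment ℝ (pt u) (pt v) ⊆ closure B := by
    rw [← closure_openSegment]; exact closure_mono hSB
  have hfr : ∀ w, pt w ∈ closure B → pt w ∈ frontier B := by
    intro w hw
    refine ⟨hw, fun h => ?_⟩
    have h1 := (connectedComponentIn_subset _ _ (interior_subset h)).1
    rw [mem_ball_zero_iff, norm_pt] at h1
    exact lt_irrefl _ h1
  have hnv : ∀ w, w ∉ vertices C → w ∉ vertices {l | l ∈ C ∧ Chord.seg l ⊆ frontier B} :=
    fun w hw ⟨l, hl, hwl⟩ => hw ⟨l, hl.1, hwl⟩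
  exact huv (hC.2 z (hsub hz) B hB
    ⟨hfr u (hcl (left_mem_segment ℝ _ _)), hnv u hu⟩
    ⟨hfr v (hcl (right_mem_segment ℝ _ _)), hnv v hv⟩ hσ)

/-! ### Saturated arcs -/

/-- A set that contains with one endpoint of a chord of `C` also the other one. -/
def Saturated (C : Set Chord) (I : Set S1) : Prop := ∀ u v, s(u, v) ∈ C → u ∈ I → v ∈ I

theorem Saturated.chain {I : Set S1} (h : Saturated C I) {u v : S1} (huv : chainEquiv C u v)
    (hu : u ∈ I) : v ∈ I := by
  rw [chainEquiv_iff] at huv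
  induction huv with
  | refl => exact hu
  | tail _ huv ih => exact h _ _ huv ih

/-- The open arc of length `t` starting at `z`. -/
def arc (z : S1) (t : ℝ) : Set S1 := {p | 0 < ang z p ∧ ang z p < t}

/-- A saturated half-open arc (closed on the left) with endpoints in one fibre does not exist. -/
theorem IsFullCriticalCollection.false_of_saturated (hC : IsFullCriticalCollection d C)
    (hd : 0 < d) {y y' : S1} (hne : y ≠ y') (hσ : sigma d y = sigma d y')
    (hS : Saturated C {p | ang y p < ang y y'}) : False := by
  have hfin := hC.1.finite_vertices hd
  obtain ⟨ε₁, h1, H1⟩ := exists_pos_lt_of_finite (hfin.sep (· ≠ y)) (fun w => ang w y)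
    fun w hw => ang_pos.2 hw.2.symm
  obtain ⟨ε₂, h2, H2⟩ := exists_pos_lt_of_finite (hfin.sep (· ≠ y')) (fun w => ang w y')
    fun w hw => ang_pos.2 hw.2.symm
  have hA := ang_pos.2 hne.symm
  have hA1 := ang_lt_one y y'
  set A := ang y y' with hAdef
  obtain ⟨ε, hε, hε'⟩ := exists_between
    (show 0 < min (min ε₁ ε₂) (min A (1 - A)) from
      lt_min (lt_min h1 h2) (lt_min hA (by linarith)))
  simp only [lt_min_iff] at hε'
  obtain ⟨⟨e1, e2⟩, e3, e4⟩ := hε'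
  -- Both endpoints are rotated backwards by the same small angle. Their images still agree, but no
  -- vertex lies in `[u, y)` or `[u', y')`, so a critical chord separating `u` from `u'` would have
  -- to leave the saturated arc.
  set u := y + ((-ε : ℝ) : S1) with hu
  set u' := y' + ((-ε : ℝ) : S1) with hu'
  have huy : ang u y = ε := ang_eq_of hε.le (by linarith) (by rw [hu]; simp)
  have huy' : ang u' y' = ε := ang_eq_of hε.le (by linarith) (by rw [hu']; simp)
  have base : ∀ p, ang u p < ε ∨ (ε ≤ ang u p ∧ ang u p = ε + ang y p) := by
    intro p
    rcases ang_base u y p with ⟨g1, g2⟩ | ⟨g1, g2⟩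
    · right; rw [huy] at g1 g2; exact ⟨g1, by linarith⟩
    · left; rw [huy] at g1; exact g1
  have huy2 : ang u y' = A + ε := by
    rw [show A + ε = ang u y + ang y y' by rw [huy]; ring]
    exact ang_add (by rw [huy]; linarith)
  have huu' : ang u u' = A := by
    apply ang_eq_of hA.le hA1
    rw [hu, hu', AddCircle.coe_neg, ← add_coe_ang y y', ← hAdef]; abel
  have nv : ∀ w ∈ vertices C, ¬ (ang u w < ε) := by
    intro w hw hlt
    rcases ang_base u w y with ⟨g1, g2⟩ | ⟨g1, g2⟩
    · have hwy : w ≠ y := by rintro rfl; rw [huy] at hlt; exact lt_irrefl _ hlt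
      have := H1 w ⟨hw, hwy⟩
      rw [huy] at g2
      linarith [ang_nonneg u w]
    · rw [huy] at g1; linarith
  have nv' : ∀ w ∈ vertices C, ¬ (A ≤ ang u w ∧ ang u w < A + ε) := by
    rintro w hw ⟨hlt0, hlt⟩
    rcases ang_base u w y' with ⟨g1, g2⟩ | ⟨g1, g2⟩
    · have hwy : w ≠ y' := by rintro rfl; rw [huy2] at hlt; exact lt_irrefl _ hlt
      have := H2 w ⟨hw, hwy⟩
      rw [huy2] at g2
      linarith
    · rw [huy2] at g1; linarith
  have hun : u ∉ vertices C := fun h => nv u h (by rw [ang_self]; exact hε)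
  have hun' : u' ∉ vertices C := fun h => nv' u' h (by rw [huu']; exact ⟨le_rfl, by linarith⟩)
  have huu : u ≠ u' := fun h => by rw [← h, ang_self] at huu'; linarith
  obtain ⟨c, hc, hcr⟩ := hC.exists_cross hun hun' huu (by
    rw [hu, hu', sigma_add_coe, sigma_add_coe, hσ])
  induction c using Sym2.ind with | _ p q
  have main : ∀ p q, s(p, q) ∈ C → ang u p < A → A < ang u q → False := by
    intro p q hpq h1 h2
    have g1 := nv p (mem_vertices_left hpq)
    have g2 := nv' q (mem_vertices_right hpq)
    have b1 := base p
    have b2 := base q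
    have hp : ang y p < A := by rcases b1 with b1 | b1 <;> [exact absurd b1 g1; linarith]
    have hq : ang y q < A := hS p q hpq hp
    rcases b2 with b2 | b2
    · linarith
    · exact g2 ⟨h2.le, by linarith⟩
  rw [cross_iff_base u, ang_self, huu'] at hcr
  have := ang_nonneg u p
  have := ang_nonneg u q
  have hswap : s(q, p) ∈ C := by rwa [Sym2.eq_swap]
  rcases hcr with h | h | h | h
  · rcases h.2.2 with h' | h'
    · exact main p q hc h.2.1 h'
    · linarith
  · rcases h.2.2 with h' | h'
    · exact main q p hswap h.2.1 h'
    · linarith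
  · linarith
  · linarith

end Crit

/-! ### Lifts along saturated arcs and monotonicity of `σ_d` -/

section Crit

variable {d : ℕ} {C : Set Chord}

/-- A saturated half-open arc (closed on the right) with endpoints in one fibre does not exist. -/
theorem IsFullCriticalCollection.false_of_saturated_left (hC : IsFullCriticalCollection d C)
    (hd : 0 < d) {y y' : S1} (hne : y ≠ y') (hσ : sigma d y = sigma d y')
    (hS : Saturated C {p | 0 < ang y p ∧ ang y p ≤ ang y y'}) : False := by
  have hfin := hC.1.finite_vertices hd
  have hA := ang_pos.2 hne.symm
  have hA1 := ang_lt_one y y'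
  set A := ang y y' with hAdef
  obtain ⟨ε₁, h1, H1⟩ := exists_pos_lt_of_finite (hfin.sep (fun w => 0 < ang y w))
    (fun w => ang y w) fun w hw => hw.2
  obtain ⟨ε₂, h2, H2⟩ := exists_pos_lt_of_finite (hfin.sep (fun w => A < ang y w))
    (fun w => ang y w - A) fun w hw => sub_pos.2 hw.2
  obtain ⟨ε, hε, hε'⟩ := exists_between
    (show 0 < min (min ε₁ ε₂) (min A (1 - A)) from
      lt_min (lt_min h1 h2) (lt_min hA (by linarith)))
  simp only [lt_min_iff] at hε'
  obtain ⟨⟨e1, e2⟩, e3, e4⟩ := hε'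
  -- Since the arc is closed on the right, the endpoints are now rotated forwards.
  set u := y + ((ε : ℝ) : S1) with hu
  set u' := y' + ((ε : ℝ) : S1) with hu'
  have hyu : ang y u = ε := ang_add_coe y hε.le (by linarith)
  have hyu' : ang y u' = A + ε := by
    apply ang_eq_of (by linarith) (by linarith)
    rw [hu', AddCircle.coe_add, ← add_assoc, hAdef, add_coe_ang]
  have nv : ∀ w ∈ vertices C, ¬ (0 < ang y w ∧ ang y w ≤ ε) := fun w hw h => by
    have := H1 w ⟨hw, h.1⟩; linarith [h.2]
  have nv' : ∀ w ∈ vertices C, ¬ (A < ang y w ∧ ang y w ≤ A + ε) := fun w hw h => by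
    have := H2 w ⟨hw, h.1⟩; linarith [h.2]
  have hun : u ∉ vertices C := fun h => nv u h (by rw [hyu]; exact ⟨hε, le_rfl⟩)
  have hun' : u' ∉ vertices C := fun h => nv' u' h (by rw [hyu']; exact ⟨by linarith, le_rfl⟩)
  have huu : u ≠ u' := fun h => by rw [← h, hyu] at hyu'; linarith
  obtain ⟨c, hc, hcr⟩ := hC.exists_cross hun hun' huu (by
    rw [hu, hu', sigma_add_coe, sigma_add_coe, hσ])
  induction c using Sym2.ind with | _ p q
  have main : ∀ p q, s(p, q) ∈ C → ε < ang y p → ang y p < A + ε →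
      (A + ε < ang y q ∨ ang y q < ε) → False := by
    intro p q hpq h1 h2 h3
    have g1 := nv' p (mem_vertices_left hpq)
    have g2 := nv q (mem_vertices_right hpq)
    have hp : ang y p ≤ A := by
      by_contra hlt; exact g1 ⟨not_le.1 hlt, h2.le⟩
    have hq := hS p q hpq ⟨by linarith, hp⟩
    obtain ⟨hq1, hq2⟩ := hq
    rcases h3 with h3 | h3
    · linarith
    · exact g2 ⟨hq1, h3.le⟩
  rw [cross_iff_base y, hyu, hyu'] at hcr
  have hswap : s(q, p) ∈ C := by rwa [Sym2.eq_swap]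
  rcases hcr with h | h | h | h
  · exact main p q hc h.1 h.2.1 h.2.2
  · exact main q p hswap h.1 h.2.1 h.2.2
  · linarith
  · linarith

/-- Lifting inside a saturated arc. -/
theorem IsCriticalCollection.exists_lift_in_arc (hC : IsCriticalCollection d C) (hd : 0 < d)
    (n : ℕ) : ∀ (x : S1) (T π τ : ℝ), 0 < T → T ≤ 1 → (vertices C ∩ arc x T).ncard ≤ n →
      Saturated C (arc x T) → ((d * T : ℝ) : S1) = (π : S1) → 0 < τ → τ < π → π ≤ 1 →
      ∃ p ∈ arc x T, Saturated C (arc x (ang x p)) ∧ sigma d p = sigma d x + (τ : S1) := by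
  have hd' : (0 : ℝ) < d := by exact_mod_cast hd
  have hd1 : (1 : ℝ) ≤ d := by exact_mod_cast hd
  have hfin := hC.finite_vertices hd
  have direct : ∀ (x : S1) (T π τ : ℝ), 0 < T → ((d * T : ℝ) : S1) = (π : S1) → 0 < τ → τ < π →
      π ≤ 1 → (∀ w ∈ vertices C ∩ arc x T, τ / d ≤ ang x w) →
      ∃ p ∈ arc x T, Saturated C (arc x (ang x p)) ∧ sigma d p = sigma d x + (τ : S1) := by
    intro x T π τ hT hπ h0 h1 h2 hv
    -- From `0 < d * T` and `π ≤ 1` one gets `k ≥ 0`, so `π ≤ d * T`, and the point at distance `τ /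
    -- d` lies in the arc.
    obtain ⟨k, hk⟩ := coe_eq_coe_iff.1 hπ
    have hk0 : 0 ≤ k := by
      have : (-1 : ℝ) < k := by rw [← hk]; nlinarith
      have : (-1 : ℤ) < k := by exact_mod_cast this
      omega
    have hk0' : (0 : ℝ) ≤ k := by exact_mod_cast hk0
    have hlt : τ / d < T := by rw [div_lt_iff₀ hd']; nlinarith
    have hlt1 : τ / d < 1 := by rw [div_lt_one hd']; linarith
    have e : ang x (x + ((τ / d : ℝ) : S1)) = τ / d := ang_add_coe x (by positivity) hlt1
    refine ⟨x + ((τ / d : ℝ) : S1), ⟨by rw [e]; positivity, by rw [e]; exact hlt⟩, ?_, ?_⟩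
    · intro u v huv hu
      rw [e] at hu
      have := hv u ⟨mem_vertices_left huv, hu.1, hu.2.trans hlt⟩
      exact absurd hu.2 (not_lt.2 this)
    · rw [sigma_add_coe]
      congr 2
      field_simp
  induction n with
  | zero =>
    intro x T π τ hT hT1 hcard hS hπ h0 h1 h2
    apply direct x T π τ hT hπ h0 h1 h2
    intro w hw
    rw [Nat.le_zero, Set.ncard_eq_zero (hfin.inter_of_left _)] at hcard
    rw [hcard] at hw
    exact absurd hw (Set.notMem_empty w)
  | succ n ih =>
    intro x T π τ hT hT1 hcard hS hπ h0 h1 h2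
    by_cases hv : ∀ w ∈ vertices C ∩ arc x T, τ / d ≤ ang x w
    · exact direct x T π τ hT hπ h0 h1 h2 hv
    push Not at hv
    obtain ⟨w0, hw0, hw0'⟩ := hv
    -- `q₁` is the first vertex in the arc and `q₂` the last point of its critical class. As `σ_d q₁
    -- = σ_d q₂`, the stretch between them can be skipped: the search restarts at `q₂`, with `π` and
    -- `τ` reduced by the amount `d * ang x q₁` already covered. The remaining arc is saturated,
    -- because a chord leaving it would cross `q₁q₂`, and it has fewer vertices.
    obtain ⟨q₁, ⟨hq₁v, hq₁a⟩, hmin⟩ :=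
      (hfin.inter_of_left (arc x T)).exists_minimalFor (ang x) _ ⟨w0, hw0⟩
    have hmin' : ∀ w ∈ vertices C, w ∈ arc x T → ang x q₁ ≤ ang x w := fun w hw hw' => by
      by_contra h; exact h (hmin ⟨hw, hw'⟩ (not_le.1 h).le)
    have hq₁τ : ang x q₁ < τ / d := (hmin' _ hw0.1 hw0.2).trans_lt hw0'
    obtain ⟨q₂, hq₂, hmax⟩ := (hC.finite_class hd q₁).exists_maximalFor (ang x) _
      ⟨q₁, (chainEquiv C).refl q₁⟩
    have hmax' : ∀ w, chainEquiv C q₁ w → ang x w ≤ ang x q₂ := fun w hw => by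
      by_contra h; exact h (hmax hw (not_le.1 h).le)
    have hq₂a : q₂ ∈ arc x T := hS.chain hq₂ hq₁a
    have hq₂v := mem_vertices_of_chain hq₁v hq₂
    have hq12 : ang x q₁ ≤ ang x q₂ := hmax' q₁ ((chainEquiv C).refl q₁)
    have nocross : ∀ u v, s(u, v) ∈ C → ¬ chainEquiv C q₁ u → ¬ Cross s(q₁, q₂) s(u, v) :=
      fun u v huv hn hc => hn (hC.unlinked _ _ _ _ hq₂ (chainEquiv_of_mem huv) hc)
    have toarc : ∀ {t : ℝ}, t ≤ T - ang x q₂ → ∀ p ∈ arc q₂ t,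
        ang x p = ang x q₂ + ang q₂ p := fun {t} ht p hp =>
      ang_add (by have := hp.2; linarith)
    have ofarc : ∀ {t : ℝ} p, ang x q₂ < ang x p → ang x p < ang x q₂ + t → p ∈ arc q₂ t := by
      intro t p h1 h2
      rcases ang_base x q₂ p with ⟨g1, g2⟩ | ⟨g1, g2⟩
      · exact ⟨by linarith, by linarith⟩
      · linarith
    have hS' : Saturated C (arc q₂ (T - ang x q₂)) := by
      intro u v huv hu
      have hxu := toarc le_rfl u hu
      have huT : u ∈ arc x T := ⟨by linarith [hq₂a.1, hu.1], by linarith [hu.2]⟩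
      have hvT := hS u v huv huT
      have hnu : ¬ chainEquiv C q₁ u := fun h => by have := hmax' u h; linarith [hu.1]
      have hnv : ¬ chainEquiv C q₁ v := fun h => hnu ((chainEquiv C).trans h
        ((chainEquiv C).symm (chainEquiv_of_mem huv)))
      by_contra hv
      have hle : ang x v ≤ ang x q₂ := by
        by_contra h
        exact hv (ofarc v (not_le.1 h) (by linarith [hvT.2]))
      have n1 : ang x v ≠ ang x q₂ := fun h => hnv (ang_inj h ▸ hq₂)
      have n2 : ang x v ≠ ang x q₁ := fun h => hnv (ang_inj h ▸ (chainEquiv C).refl q₁)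
      have n3 := hmin' v (mem_vertices_right huv) hvT
      refine nocross u v huv hnu ((cross_iff_base x).2 ?_)
      have := hu.1
      grind
    have hcard' : (vertices C ∩ arc q₂ (T - ang x q₂)).ncard ≤ n := by
      have hlt : (vertices C ∩ arc q₂ (T - ang x q₂)).ncard < (vertices C ∩ arc x T).ncard := by
        apply Set.ncard_lt_ncard _ (hfin.inter_of_left _)
        refine ⟨fun p hp => ⟨hp.1, ?_, ?_⟩, fun h => ?_⟩
        · rw [toarc le_rfl p hp.2]; linarith [hq₂a.1, hp.2.1]
        · rw [toarc le_rfl p hp.2]; linarith [hp.2.2]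
        · have := h ⟨hq₂v, hq₂a⟩
          have := this.2.1
          rw [ang_self] at this
          exact lt_irrefl _ this
      omega
    have hσ := hC.sigma_eq_of_chain hq₂
    have hσ1 := Lamination.sigma_eq d x q₁
    have hσ2 := Lamination.sigma_eq d x q₂
    have hdq : d * ang x q₁ < τ := by rw [lt_div_iff₀ hd'] at hq₁τ; linarith
    have hdq0 : 0 < d * ang x q₁ := mul_pos hd' hq₁a.1
    obtain ⟨p, hp, hpS, hpσ⟩ := ih q₂ (T - ang x q₂) (π - d * ang x q₁) (τ - d * ang x q₁)
      (by linarith [hq₂a.2]) (by linarith [hq₂a.1]) hcard' hS' (by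
        rw [mul_sub, AddCircle.coe_sub, AddCircle.coe_sub, hπ]
        congr 1
        rw [hσ1, hσ2] at hσ
        exact (add_left_cancel hσ).symm) (by linarith) (by linarith) (by linarith)
    have hxp := toarc le_rfl p hp
    refine ⟨p, ⟨by linarith [hq₂a.1, hp.1], by linarith [hp.2]⟩, ?_, ?_⟩
    · intro u v huv hu
      have huT : u ∈ arc x T := ⟨hu.1, by linarith [hu.2, hp.2]⟩
      have hu1 := hmin' u (mem_vertices_left huv) huT
      have hvT := hS u v huv huT
      refine ⟨hvT.1, ?_⟩
      rcases lt_or_ge (ang x q₂) (ang x u) with h | h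
      · have hu' : u ∈ arc q₂ (ang q₂ p) := ofarc u h (by linarith [hu.2])
        have hv' := hpS u v huv hu'
        rw [toarc (by linarith [hp.2]) v hv', hxp]
        linarith [hv'.2]
      · by_cases hqu : chainEquiv C q₁ u
        · have := hmax' v ((chainEquiv C).trans hqu (chainEquiv_of_mem huv))
          linarith [hp.1]
        · have hnv : ¬ chainEquiv C q₁ v := fun h => hqu ((chainEquiv C).trans h
            ((chainEquiv C).symm (chainEquiv_of_mem huv)))
          have n1 : ang x u ≠ ang x q₂ := fun h => hqu (ang_inj h ▸ hq₂)
          have n2 : ang x u ≠ ang x q₁ := fun h => hqu (ang_inj h ▸ (chainEquiv C).refl q₁)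
          have n3 : ang x v ≠ ang x q₂ := fun h => hnv (ang_inj h ▸ hq₂)
          have := nocross u v huv hqu
          rw [cross_iff_base x] at this
          have := hp.1
          grind
    · rw [hpσ, hσ2, add_assoc, ← AddCircle.coe_add]
      have : ((d * ang x q₂ : ℝ) : S1) = ((d * ang x q₁ : ℝ) : S1) := by
        rw [hσ1, hσ2] at hσ
        exact (add_left_cancel hσ).symm
      rw [AddCircle.coe_add, this, ← AddCircle.coe_add]
      congr 2
      ring

/-- The half-open arc is the difference of two saturated arcs. -/
theorem saturated_Ico {z y y' : S1} (hS : Saturated C (arc z (ang z y)))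
    (hS' : Saturated C (arc z (ang z y'))) (h : ang z y < ang z y') (h0 : y ≠ z) :
    Saturated C {p | ang y p < ang y y'} := by
  have key : ∀ p, ang y p < ang y y' ↔ (p ∈ arc z (ang z y') ∧ p ∉ arc z (ang z y)) := by
    intro p
    have h0 := ang_pos.2 h0
    have := ang_base z y p
    have := ang_base z y y'
    have := ang_nonneg z p
    have := ang_lt_one z p
    have := ang_lt_one z y'
    simp only [arc, Set.mem_ofPred_eq]
    grind
  intro u v huv hu
  have hu := (key u).1 hu
  refine (key v).2 ⟨hS' u v huv hu.1, fun hv => hu.2 (hS v u (by rwa [Sym2.eq_swap]) hv)⟩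

theorem IsFullCriticalCollection.sigma_ne (hC : IsFullCriticalCollection d C) (hd : 0 < d)
    {z y : S1} (hz : z ∉ vertices C) (hy : y ≠ z)
    (hS : Saturated C (arc z (ang z y))) : sigma d y ≠ sigma d z := by
  intro hσ
  refine hC.false_of_saturated hd hy.symm hσ.symm fun u v huv hu => ?_
  have : u ≠ z := fun h => hz (h ▸ mem_vertices_left huv)
  exact (hS u v huv ⟨ang_pos.2 this, hu⟩).2

/-- If the image of `y'` came strictly before that of `y`, it would have a lift `p` in the arc from
`z` to `y`. Then `[p, y')` would be a saturated arc with endpoints in one fibre, which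
`false_of_saturated` excludes. If the images are equal, `[y, y')` is such an arc. -/
theorem IsFullCriticalCollection.sigma_lt (hC : IsFullCriticalCollection d C) (hd : 0 < d)
    {z y y' : S1} (hz : z ∉ vertices C) (hy : y ≠ z)
    (h : ang z y < ang z y') (hS : Saturated C (arc z (ang z y)))
    (hS' : Saturated C (arc z (ang z y'))) :
    ang (sigma d z) (sigma d y) < ang (sigma d z) (sigma d y') := by
  have hy' : y' ≠ z := ang_pos.1 ((ang_nonneg _ _).trans_lt h)
  have hyp := ang_pos.2 hy
  have p' := ang_pos.2 (hC.sigma_ne hd hz hy' hS')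
  by_contra hcon
  rcases (not_lt.1 hcon).lt_or_eq with hlt | heq
  · obtain ⟨p, hp, hpS, hpσ⟩ := hC.1.exists_lift_in_arc hd _ z (ang z y)
      (ang (sigma d z) (sigma d y)) (ang (sigma d z) (sigma d y')) hyp (ang_lt_one _ _).le le_rfl hS
      (by rw [coe_ang, Lamination.sigma_eq d z y]; simp) p' hlt (ang_lt_one _ _).le
    rw [add_coe_ang] at hpσ
    have hlt2 : ang z p < ang z y' := hp.2.trans h
    exact hC.false_of_saturated hd (fun e => by rw [e] at hlt2; exact lt_irrefl _ hlt2) hpσ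
      (saturated_Ico hpS hS' hlt2 (ang_pos.1 hp.1))
  · exact hC.false_of_saturated hd (fun e => by rw [e] at h; exact lt_irrefl _ h)
      (ang_inj heq.symm) (saturated_Ico hS hS' h hy)

theorem IsFullCriticalCollection.exists_lift (hC : IsFullCriticalCollection d C) (hd : 0 < d)
    {z c : S1} (hz : z ∉ vertices C)
    (hc : c ≠ sigma d z) : ∃ y, y ≠ z ∧ Saturated C (arc z (ang z y)) ∧ sigma d y = c := by
  obtain ⟨p, hp, hpS, hpσ⟩ := hC.1.exists_lift_in_arc hd _ z 1 1 (ang (sigma d z) c) one_pos le_rfl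
    le_rfl (by
      intro u v huv _
      exact ⟨ang_pos.2 fun h => hz (h ▸ mem_vertices_right huv), ang_lt_one _ _⟩)
    (coe_eq_coe_iff.2 ⟨d - 1, by simp⟩) (ang_pos.2 hc) (ang_lt_one _ _) le_rfl
  exact ⟨p, ang_pos.1 hp.1, hpS, by rw [hpσ, add_coe_ang]⟩

/-- Here `x` may be a vertex, so the lift starts at a non-vertex `z` slightly after `x`. The image
of the arc from `x` to `z` is too short to reach `b`, so the lift lies beyond `z`, and the arcs from
`x` and from `z` to it contain the same vertices. -/
theorem IsFullCriticalCollection.exists_right_lift (hC : IsFullCriticalCollection d C) (hd : 0 < d)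
    {x b : S1} (hb : b ≠ sigma d x) :
    ∃ y, Saturated C (arc x (ang x y)) ∧ sigma d y = b := by
  have hd' : (0 : ℝ) < d := by exact_mod_cast hd
  have hd1 : (1 : ℝ) ≤ d := by exact_mod_cast hd
  obtain ⟨ε₁, h1, H1⟩ := exists_pos_lt_of_finite
    ((hC.1.finite_vertices hd).sep (fun w => 0 < ang x w))
    (fun w => ang x w) fun w hw => hw.2
  obtain ⟨ε, hε, hε'⟩ := exists_between
    (show 0 < min ε₁ (ang (sigma d x) b / d) from lt_min h1 (div_pos (ang_pos.2 hb) hd'))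
  obtain ⟨e1, e2⟩ := lt_min_iff.1 hε'
  rw [lt_div_iff₀ hd'] at e2
  have hb1 := ang_lt_one (sigma d x) b
  have hε1 : ε < 1 := by nlinarith
  set z := x + ((ε : ℝ) : S1) with hzdef
  have hxz : ang x z = ε := ang_add_coe x hε.le hε1
  have nv : ∀ w ∈ vertices C, ¬ (0 < ang x w ∧ ang x w ≤ ε) := fun w hw h => by
    have := H1 w ⟨hw, h.1⟩; linarith [h.2]
  have hz : z ∉ vertices C := fun h => nv z h ⟨by rw [hxz]; exact hε, hxz.le⟩
  have small : ∀ y, ang x y ≤ ε → sigma d y ≠ b := by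
    rintro y hy rfl
    rw [ang_sigma_of_lt (by nlinarith)] at e2
    nlinarith
  obtain ⟨y, hyz, hyS, hyσ⟩ := hC.exists_lift hd hz (c := b) (fun h => small z hxz.le h.symm)
  have hy : ε < ang x y := by
    by_contra h; exact small y (not_lt.1 h) hyσ
  refine ⟨y, ?_, hyσ⟩
  have key : ∀ w ∈ vertices C, w ∈ arc x (ang x y) ↔ w ∈ arc z (ang z y) := by
    intro w hw
    have := nv w hw
    have := ang_base x z w
    have := ang_base x z y
    have := ang_nonneg x w
    have := ang_lt_one x y
    simp only [arc, Set.mem_ofPred_eq]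
    rw [hxz] at *
    grind
  exact fun u v huv hu => (key v (mem_vertices_right huv)).2
    (hyS u v huv ((key u (mem_vertices_left huv)).1 hu))

/-- If `x'` lay strictly between `x` and `y`, the difference `(x, x']` of the two arcs would be
saturated with endpoints in one fibre. This is the injectivity needed in `fiberMatching_yFamily`. -/
theorem IsFullCriticalCollection.right_lift_injective (hC : IsFullCriticalCollection d C)
    (hd : 0 < d) {x x' y : S1} (hy : sigma d y ≠ sigma d x)
    (hσ : sigma d x = sigma d x') (hS : Saturated C (arc x (ang x y)))
    (hS' : Saturated C (arc x' (ang x' y))) : x = x' := by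
  have main : ∀ x x' : S1, sigma d y ≠ sigma d x → sigma d x = sigma d x' →
      Saturated C (arc x (ang x y)) →
      Saturated C (arc x' (ang x' y)) → ¬ ang x' y < ang x y := by
    intro x x' hy hσ hS hS' hlt
    have hne : x ≠ x' := by rintro rfl; exact lt_irrefl _ hlt
    refine hC.false_of_saturated_left hd hne hσ ?_
    have key : ∀ p, (0 < ang x p ∧ ang x p ≤ ang x x') ↔
        (p ∈ arc x (ang x y) ∧ p ∉ arc x' (ang x' y)) := by
      intro p
      have := ang_base x x' p
      have := ang_base x x' y
      have := ang_pos.2 (fun h : y = x' => hy (h ▸ hσ.symm))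
      have := ang_pos.2 hne.symm
      have := ang_lt_one x y
      have := ang_lt_one x x'
      have := ang_lt_one x p
      have := ang_nonneg x p
      simp only [arc, Set.mem_ofPred_eq]
      grind
    intro u v huv hu
    have hu := (key u).1 hu
    exact (key v).2 ⟨hS u v huv hu.1, fun hv => hu.2 (hS' v u (by rwa [Sym2.eq_swap]) hv)⟩
  have h : ang x y = ang x' y := le_antisymm (not_lt.1 (main x x' hy hσ hS hS'))
    (not_lt.1 (main x' x (hσ ▸ hy) hσ.symm hS' hS))
  have h1 := coe_ang x y
  rw [h, coe_ang] at h1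
  exact (sub_right_injective h1).symm

end Crit

section Crit

variable {d : ℕ} {C : Set Chord}

/-! ### Points that are not separated by critical polygons -/

/-- The chord joining `x` and `y` does not cross edges of polygons of `C⁺`. -/
def Unseparated (C : Set Chord) (x y : S1) : Prop := ∀ e ∈ plusEdges C, ¬ Cross s(x, y) e

theorem Unseparated.symm {x y : S1} (h : Unseparated C x y) : Unseparated C y x := fun e he => by
  rw [Sym2.eq_swap]; exact h e he

theorem exists_of_mem_plusEdges {e : Chord} (he : e ∈ plusEdges C) :
    ∃ p q, e = s(p, q) ∧ chainEquiv C p q ∧ p ∈ vertices C ∧ q ∈ vertices C := by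
  simp only [plusEdges, Set.mem_iUnion] at he
  obtain ⟨V, ⟨v, hv, rfl⟩, p, hp, q, hq, -, rfl, -⟩ := he
  exact ⟨p, q, rfl, (chainEquiv C).trans ((chainEquiv C).symm hp) hq, mem_vertices_of_chain hv hp,
    mem_vertices_of_chain hv hq⟩

theorem mem_plusEdges {w : S1} (hw : w ∈ vertices C) {e : Chord}
    (he : e ∈ hullEdges {x | chainEquiv C w x}) : e ∈ plusEdges C := by
  simp only [plusEdges, Set.mem_iUnion]
  exact ⟨_, ⟨w, hw, rfl⟩, he⟩

/-- Chords of `C` may be diagonals of polygons, while compatibility is tested on edges only. The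
point `y` must be outside the class, since a diagonal crosses no edge of its own polygon. -/
theorem IsCriticalCollection.exists_plusEdge_cross (hC : IsCriticalCollection d C) (hd : 0 < d)
    {p q y z : S1} (hpq : chainEquiv C p q) (hy : ¬ chainEquiv C p y)
    (hc : Cross s(z, y) s(p, q)) : ∃ e ∈ plusEdges C, Cross s(z, y) e := by
  have hp : p ∈ vertices C := by
    by_contra hp
    rw [← eq_of_chain_of_not_mem hp hpq] at hc
    exact not_cross_diag_right _ _ hc
  obtain ⟨e, he, hce⟩ := exists_hullEdge_cross (hC.finite_class hd p) (z := z) hy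
    ((chainEquiv C).refl p) hpq hc
  exact ⟨e, mem_plusEdges hp he, hce⟩

/-- As `z` is not a vertex, it lies strictly on one side of every edge; an edge separating `x` from
`y` would separate `z` from one of them. -/
theorem unseparated_trans {x y z : S1} (hz : z ∉ vertices C) (hx : Unseparated C z x)
    (hy : Unseparated C z y) : Unseparated C x y := by
  intro e he hc
  have h1 := hx e he
  have h2 := hy e he
  obtain ⟨p, q, rfl, -, hp, hq⟩ := exists_of_mem_plusEdges he
  have n1 := ang_pos.2 (fun h : p = z => hz (h ▸ hp))
  have n2 := ang_pos.2 (fun h : q = z => hz (h ▸ hq))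
  rw [cross_iff_base z] at hc h1 h2
  rw [ang_self] at h1 h2
  grind

theorem unseparated_of_saturated {x y : S1} (hS : Saturated C (arc x (ang x y))) :
    Unseparated C x y := by
  intro e he hc
  obtain ⟨p, q, rfl, hpq, -, -⟩ := exists_of_mem_plusEdges he
  have key : ∀ p q, chainEquiv C p q → 0 < ang x p → ang x p < ang x y → ang x y < ang x q →
      False := fun p q hpq h1 h2 h3 => by
    have := (hS.chain hpq ⟨h1, h2⟩).2
    linarith
  rw [cross_iff_base x, ang_self] at hc
  have := ang_nonneg x p
  have := ang_nonneg x q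
  have := ang_nonneg x y
  have k1 := key p q hpq
  have k2 := key q p ((chainEquiv C).symm hpq)
  grind

/-- The first point of the critical class of `y`, seen from `z`. -/
theorem IsCriticalCollection.exists_first (hC : IsCriticalCollection d C) (hd : 0 < d) {y z : S1}
    (hz : z ∉ vertices C) (hyz : y ≠ z) (hy : Unseparated C z y) :
    ∃ y', chainEquiv C y y' ∧ y' ≠ z ∧ Saturated C (arc z (ang z y')) ∧
      ∀ w, chainEquiv C y w → ang z y' ≤ ang z w := by
  obtain ⟨y', hy', hmin⟩ := (hC.finite_class hd y).exists_minimalFor (ang z) _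
    ⟨y, (chainEquiv C).refl y⟩
  have hmin' : ∀ w, chainEquiv C y w → ang z y' ≤ ang z w := fun w hw => by
    by_contra h; exact h (hmin hw (not_le.1 h).le)
  have hy'z : y' ≠ z := by
    rintro rfl
    exact hyz (eq_of_chain_of_not_mem hz ((chainEquiv C).symm hy')).symm
  refine ⟨y', hy', hy'z, ?_, hmin'⟩
  intro p q hpq hp
  have hqz : q ≠ z := fun h => hz (h ▸ mem_vertices_right hpq)
  refine ⟨ang_pos.2 hqz, ?_⟩
  by_contra hlt
  have hnp : ¬ chainEquiv C y p := fun h => by have := hmin' p h; linarith [hp.2]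
  have hnq : ¬ chainEquiv C y q := fun h => hnp ((chainEquiv C).trans h
    ((chainEquiv C).symm (chainEquiv_of_mem hpq)))
  have n1 : ang z q ≠ ang z y' := fun h => hnq (ang_inj h ▸ hy')
  have hle := hmin' y ((chainEquiv C).refl y)
  -- A chord leaving the arc before `y'` either ends between `y'` and `y`, and then links with the
  -- class of `y`, or ends beyond `y`, and then separates `z` from `y`.
  have hyq : ang z y < ang z q := by
    by_contra hcon
    have n2 : ang z q ≠ ang z y := fun h => hnq (ang_inj h ▸ (chainEquiv C).refl y)
    refine hnp ((chainEquiv C).trans hy' (hC.unlinked _ _ _ _ ((chainEquiv C).symm hy')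
      (chainEquiv_of_mem hpq) ((cross_iff_base z).2 ?_)))
    have := hp.2
    grind
  obtain ⟨e, he, hce⟩ := hC.exists_plusEdge_cross hd (z := z) (y := y) (chainEquiv_of_mem hpq)
    (fun h => hnp ((chainEquiv C).symm h)) (by
      rw [cross_iff_base z, ang_self]
      have := hp.1; have := hp.2
      grind)
  exact hy e he hce

/-- Replacing points by the first points of their critical classes reduces this to `sigma_lt`. With
the next two lemmas it describes `σ_d` on the boundary of the gap of `z`: monotone, injective up to
critical classes, and onto. -/
theorem IsFullCriticalCollection.ang_sigma_le (hC : IsFullCriticalCollection d C) (hd : 0 < d)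
    {y y' z : S1} (hz : z ∉ vertices C) (hy : Unseparated C z y) (hy' : Unseparated C z y')
    (h : ang z y ≤ ang z y') : ang (sigma d z) (sigma d y) ≤ ang (sigma d z) (sigma d y') := by
  rcases eq_or_ne y z with rfl | hyz
  · rw [ang_self]; exact ang_nonneg _ _
  have hy'z : y' ≠ z := ang_pos.1 ((ang_pos.2 hyz).trans_le h)
  obtain ⟨w, hw, hwz, hwS, hwm⟩ := hC.1.exists_first hd hz hyz hy
  obtain ⟨w', hw', hwz', hwS', hwm'⟩ := hC.1.exists_first hd hz hy'z hy'
  rw [hC.1.sigma_eq_of_chain hw, hC.1.sigma_eq_of_chain hw']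
  have hle : ang z w ≤ ang z w' := by
    by_contra hlt
    by_cases hyy : chainEquiv C y y'
    · exact hlt (hwm w' ((chainEquiv C).trans hyy hw'))
    · have h1 := hwm y ((chainEquiv C).refl y)
      have h2 : ang z y ≠ ang z y' := fun h => hyy (ang_inj h ▸ (chainEquiv C).refl y)
      obtain ⟨e, he, hce⟩ := hC.1.exists_plusEdge_cross hd (z := z) (y := y)
        ((chainEquiv C).symm hw')
        (fun h => hyy ((chainEquiv C).symm ((chainEquiv C).trans hw' h))) (by
          rw [cross_iff_base z, ang_self]
          have := ang_pos.2 hwz'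
          grind)
      exact hy e he hce
  rcases hle.lt_or_eq with hlt | heq
  · exact (hC.sigma_lt hd hz hwz hlt hwS hwS').le
  · rw [ang_inj heq]

theorem IsFullCriticalCollection.chain_of_unseparated (hC : IsFullCriticalCollection d C)
    (hd : 0 < d) {y y' z : S1} (hz : z ∉ vertices C) (hy : Unseparated C z y)
    (hy' : Unseparated C z y') (h : sigma d y = sigma d y') : chainEquiv C y y' := by
  have self : ∀ y, Unseparated C z y → sigma d y = sigma d z → y = z := by
    intro y hy h
    by_contra hyz
    obtain ⟨w, hw, hwz, hwS, -⟩ := hC.1.exists_first hd hz hyz hy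
    exact hC.sigma_ne hd hz hwz hwS ((hC.1.sigma_eq_of_chain hw).symm.trans h)
  rcases eq_or_ne y z with rfl | hyz
  · rw [self y' hy' h.symm]
  rcases eq_or_ne y' z with rfl | hyz'
  · rw [self y hy h]
  obtain ⟨w, hw, hwz, hwS, hwm⟩ := hC.1.exists_first hd hz hyz hy
  obtain ⟨w', hw', hwz', hwS', hwm'⟩ := hC.1.exists_first hd hz hyz' hy'
  have hσ : sigma d w = sigma d w' := by
    rw [← hC.1.sigma_eq_of_chain hw, ← hC.1.sigma_eq_of_chain hw', h]
  have : w = w' := by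
    rcases lt_trichotomy (ang z w) (ang z w') with hlt | heq | hlt
    · have := hC.sigma_lt hd hz hwz hlt hwS hwS'
      rw [hσ] at this; exact absurd this (lt_irrefl _)
    · exact ang_inj heq
    · have := hC.sigma_lt hd hz hwz' hlt hwS' hwS
      rw [hσ] at this; exact absurd this (lt_irrefl _)
  subst this
  exact (chainEquiv C).trans hw ((chainEquiv C).symm hw')

theorem IsFullCriticalCollection.exists_unseparated_lift (hC : IsFullCriticalCollection d C)
    (hd : 0 < d) {z : S1} (hz : z ∉ vertices C) (c : S1) :
    ∃ y, Unseparated C z y ∧ sigma d y = c := by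
  by_cases h : c = sigma d z
  · exact ⟨z, fun e _ => not_cross_diag_left z e, h.symm⟩
  · obtain ⟨y, -, hS, hy⟩ := hC.exists_lift hd hz h
    exact ⟨y, unseparated_of_saturated hS, hy⟩

/-- `σ_d` is only weakly monotone on the gap; strict alternation survives because no endpoint of one
chord is identified with an endpoint of the other. -/
theorem IsFullCriticalCollection.cross_sigma (hC : IsFullCriticalCollection d C) (hd : 0 < d)
    {x y u v z : S1} (hz : z ∉ vertices C) (hx : Unseparated C z x) (hy : Unseparated C z y)
    (hu : Unseparated C z u) (hv : Unseparated C z v) (hc : Cross s(x, y) s(u, v))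
    (h1 : sigma d x ≠ sigma d u) (h2 : sigma d x ≠ sigma d v) (h3 : sigma d y ≠ sigma d u)
    (h4 : sigma d y ≠ sigma d v) : Cross s(sigma d x, sigma d y) s(sigma d u, sigma d v) := by
  have m : ∀ {a b : S1}, a ≠ b → ang (sigma d z) a ≠ ang (sigma d z) b := fun h h' => h (ang_inj h')
  have := hC.ang_sigma_le hd hz hx hu
  have := hC.ang_sigma_le hd hz hx hv
  have := hC.ang_sigma_le hd hz hy hu
  have := hC.ang_sigma_le hd hz hy hv
  have := hC.ang_sigma_le hd hz hu hx
  have := hC.ang_sigma_le hd hz hv hx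
  have := hC.ang_sigma_le hd hz hu hy
  have := hC.ang_sigma_le hd hz hv hy
  have := m h1; have := m h2; have := m h3; have := m h4
  rw [cross_iff_base z] at hc
  rw [cross_iff_base (sigma d z)]
  grind

/-- Unseparated points have a common unseparated point that is not a vertex. -/
theorem IsCriticalCollection.exists_common (hC : IsCriticalCollection d C) (hd : 0 < d) {x y : S1}
    (hxy : Unseparated C x y) (hσ : sigma d x ≠ sigma d y) :
    ∃ z, z ∉ vertices C ∧ Unseparated C z x ∧ Unseparated C z y := by
  have hfin := hC.finite_vertices hd
  have hne : y ≠ x := fun h => hσ (h ▸ rfl)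
  have hY := ang_pos.2 hne
  have hY1 := ang_lt_one x y
  obtain ⟨ε₁, h1, H1⟩ := exists_pos_lt_of_finite (hfin.sep (fun w => 0 < ang x w))
    (fun w => ang x w) fun w hw => hw.2
  obtain ⟨ε₂, h2, H2⟩ := exists_pos_lt_of_finite hfin
    (fun w => 1 - ang x w) fun w hw => sub_pos.2 (ang_lt_one _ _)
  obtain ⟨ε, hε, hε'⟩ := exists_between
    (show 0 < min (min ε₁ ε₂) (min (ang x y) (1 - ang x y)) from
      lt_min (lt_min h1 h2) (lt_min hY (by linarith)))
  simp only [lt_min_iff] at hε'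
  obtain ⟨⟨e1, e2⟩, e3, e4⟩ := hε'
  have nv : ∀ w ∈ vertices C, ang x w = 0 ∨ (ε < ang x w ∧ ang x w < 1 - ε) := fun w hw => by
    have g2 := H2 w hw
    rcases (ang_nonneg x w).lt_or_eq with g | g
    · have g1 := H1 w ⟨hw, g⟩
      right; constructor <;> linarith
    · exact Or.inl g.symm
  by_cases hcase : ∃ p, s(x, p) ∈ plusEdges C ∧ 0 < ang x p ∧ ang x p < ang x y
  · obtain ⟨p₀, hp₀, hp1, hp2⟩ := hcase
    have hxz : ang x (x + ((1 - ε : ℝ) : S1)) = 1 - ε :=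
      ang_add_coe x (by linarith) (by linarith)
    have hxp₀ : chainEquiv C x p₀ := by
      obtain ⟨a, b, he, hab, -, -⟩ := exists_of_mem_plusEdges hp₀
      rcases Sym2.eq_iff.1 he with ⟨rfl, rfl⟩ | ⟨rfl, rfl⟩
      exacts [hab, (chainEquiv C).symm hab]
    refine ⟨x + ((1 - ε : ℝ) : S1), fun h => ?_, fun e he hc => ?_, fun e he hc => ?_⟩
    · have := nv _ h
      rw [hxz] at this
      rcases this with h | h <;> linarith [h]
    · obtain ⟨p, q, rfl, -, hp, hq⟩ := exists_of_mem_plusEdges he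
      rw [cross_iff_base x, ang_self, hxz] at hc
      have := nv p hp
      have := nv q hq
      grind
    · have hno := hxy e he
      obtain ⟨p, q, rfl, hpq, hp, hq⟩ := exists_of_mem_plusEdges he
      rw [cross_iff_base x, ang_self] at hno
      rw [cross_iff_base x, hxz] at hc
      have np := nv p hp
      have nq := nv q hq
      have hnx : ¬ chainEquiv C x y := fun h => hσ (hC.sigma_eq_of_chain h)
      have bad : ∀ w, chainEquiv C x w → ang x y < ang x w → False := fun w hw hlt => by
        obtain ⟨e, he, hce⟩ := hC.exists_plusEdge_cross hd (z := x) (y := y) (p := p₀) (q := w)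
          ((chainEquiv C).trans ((chainEquiv C).symm hxp₀) hw)
          (fun h => hnx ((chainEquiv C).trans hxp₀ h)) (by
            rw [cross_iff_base x, ang_self]
            grind)
        exact hxy e he hce
      have b1 : ang x q = 0 → ang x y < ang x p → False := fun h h' => by
        rw [ang_eq_zero] at h; subst h
        exact bad p ((chainEquiv C).symm hpq) h'
      have b2 : ang x p = 0 → ang x y < ang x q → False := fun h h' => by
        rw [ang_eq_zero] at h; subst h
        exact bad q hpq h'
      grind
  · push Not at hcase
    have hxz : ang x (x + ((ε : ℝ) : S1)) = ε := ang_add_coe x hε.le (by linarith)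
    refine ⟨x + ((ε : ℝ) : S1), fun h => ?_, fun e he hc => ?_, fun e he hc => ?_⟩
    · have := nv _ h
      rw [hxz] at this
      rcases this with h | h <;> linarith [h]
    · obtain ⟨p, q, rfl, -, hp, hq⟩ := exists_of_mem_plusEdges he
      rw [cross_iff_base x, ang_self, hxz] at hc
      have := nv p hp
      have := nv q hq
      grind
    · have hno := hxy e he
      obtain ⟨p, q, rfl, hpq, hp, hq⟩ := exists_of_mem_plusEdges he
      rw [cross_iff_base x, ang_self] at hno
      rw [cross_iff_base x, hxz] at hc
      have np := nv p hp
      have nq := nv q hq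
      have b1 : ang x q = 0 → 0 < ang x p → ang x y ≤ ang x p := fun h => by
        rw [ang_eq_zero] at h; subst h
        exact hcase p (by rwa [Sym2.eq_swap])
      have b2 : ang x p = 0 → 0 < ang x q → ang x y ≤ ang x q := fun h => by
        rw [ang_eq_zero] at h; subst h
        exact hcase q he
      grind

/-- An edge between `z` and `u` would leave `x`, `y` weakly on one side and `u`, `v` weakly on the
other, so `xy` and `uv` could not cross. -/
theorem unseparated_of_cross {x y u v z : S1} (hz : z ∉ vertices C) (hx : Unseparated C z x)
    (hy : Unseparated C z y) (huv : Unseparated C u v) (hc : Cross s(x, y) s(u, v)) :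
    Unseparated C z u := by
  intro e he hce
  have h1 := hx e he
  have h2 := hy e he
  have h3 := huv e he
  obtain ⟨p, q, rfl, -, hp, hq⟩ := exists_of_mem_plusEdges he
  have n1 := ang_pos.2 (fun h : p = z => hz (h ▸ hp))
  have n2 := ang_pos.2 (fun h : q = z => hz (h ▸ hq))
  rw [cross_iff_base z] at hc h1 h2 h3 hce
  rw [ang_self] at h1 h2 hce
  grind

end Crit

section YTheory

variable {d : ℕ} {C : Set Chord}

/-! ### The family of pullbacks -/

theorem sigma_mem_periodicPts {x : S1} (h : x ∈ Function.periodicPts (sigma d)) :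
    sigma d x ∈ Function.periodicPts (sigma d) := by
  obtain ⟨n, hn, hx⟩ := h
  exact ⟨n, hn, hx.map (fun _ => rfl)⟩

theorem mem_map_of_mem {l : Chord} {x : S1} (h : x ∈ l) : sigma d x ∈ l.map d :=
  Sym2.mem_map.2 ⟨x, h, rfl⟩

/-- Images of periodic points are periodic, so pulling back a chord without periodic endpoints
produces none. -/
theorem YFamily.not_periodic {l : Chord} (hl : YFamily d C l) :
    ∀ x ∈ l, x ∉ Function.periodicPts (sigma d) := by
  induction hl with
  | base V hV hp l hl =>
    obtain ⟨a, ha, b, hb, -, rfl, -⟩ := hl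
    intro x hx
    rcases Sym2.mem_iff.1 hx with rfl | rfl
    exacts [hp _ ha, hp _ hb]
  | pull l l' _ h ih =>
    intro x hx hper
    exact ih (sigma d x) (h.1 ▸ mem_map_of_mem hx) (sigma_mem_periodicPts hper)

theorem YFamily.not_isDiag {l : Chord} (hl : YFamily d C l) : ¬ l.IsDiag := by
  induction hl with
  | base V hV hp l hl =>
    obtain ⟨a, ha, b, hb, hab, rfl, -⟩ := hl
    simpa using hab
  | pull l l' _ h ih =>
    intro hd
    apply ih
    induction l' using Sym2.ind with | _ a b
    have hab : a = b := hd
    rw [← h.1, hab]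
    exact rfl

/-- A critical class containing an endpoint of a chord of the family is proper. -/
theorem YFamily.isProperCritSet (hC : IsCriticalCollection d C) {l : Chord} (hl : YFamily d C l)
    {w : S1} (hw : w ∈ l) : IsProperCritSet d {x | chainEquiv C w x} := by
  intro v hv hper
  cases hl with
  | base V hV hp _ hl =>
    obtain ⟨a, ha, b, hb, -, rfl, -⟩ := hl
    obtain ⟨v₀, -, rfl⟩ := hV
    have hwV : chainEquiv C v₀ w := by
      rcases Sym2.mem_iff.1 hw with rfl | rfl
      exacts [ha, hb]
    exact hp v ((chainEquiv C).trans hwV hv) hper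
  | pull l₀ _ hl₀ h =>
    apply hl₀.not_periodic (sigma d w) (h.1 ▸ mem_map_of_mem hw)
    rw [hC.sigma_eq_of_chain hv]
    exact sigma_mem_periodicPts hper

theorem chainEquiv_mono {L M : Set Chord} (h : L ⊆ M) {x y : S1} (hxy : chainEquiv L x y) :
    chainEquiv M x y := by
  rw [chainEquiv_iff] at *
  exact Relation.ReflTransGen.mono (fun _ _ hl => h hl) _ _ hxy

/-- A proper critical class lies in one class of the relation generated by the family. -/
theorem rel_of_chain_of_isProper (hC : IsCriticalCollection d C) (hd : 0 < d) {y y' : S1}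
    (h : chainEquiv C y y') (hp : IsProperCritSet d {x | chainEquiv C y x}) :
    chainEquiv (YFamily d C) y y' := by
  by_cases hy : y ∈ vertices C
  · exact chainEquiv_mono (fun e he => YFamily.base _ ⟨y, hy, rfl⟩ hp e he)
      (chainEquiv_hullEdges (hC.finite_class hd y) ((chainEquiv C).refl y) h)
  · rw [eq_of_chain_of_not_mem hy h]

theorem rel_of_chain (hC : IsCriticalCollection d C) (hd : 0 < d) {y y' : S1}
    (h : chainEquiv C y y') (hp : sigma d y ∉ Function.periodicPts (sigma d)) :
    chainEquiv (YFamily d C) y y' :=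
  rel_of_chain_of_isProper hC hd h fun _ hv hper =>
    hp (hC.sigma_eq_of_chain hv ▸ sigma_mem_periodicPts hper)

/-- Lifting of relations to a complementary component. -/
theorem rel_of_unseparated (hC : IsFullCriticalCollection d C) (hd : 0 < d) {x c z : S1}
    (hz : z ∉ vertices C) (hx : Unseparated C z x)
    (hp : sigma d x ∉ Function.periodicPts (sigma d))
    (hc : chainEquiv (YFamily d C) (sigma d x) c) :
    ∀ u, Unseparated C z u → sigma d u = c → chainEquiv (YFamily d C) x u := by
  rw [chainEquiv_iff] at hc
  induction hc with
  | refl =>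
    intro u hu h
    exact rel_of_chain hC.1 hd (hC.chain_of_unseparated hd hz hx hu h.symm) hp
  | @tail c' c _ h ih =>
    intro u hu huc
    obtain ⟨u', hu', huc'⟩ := hC.exists_unseparated_lift hd hz c'
    refine (chainEquiv _).trans (ih u' hu' huc') (chainEquiv_of_mem (YFamily.pull s(c', c) _ h ?_))
    refine ⟨?_, unseparated_trans hz hu' hu⟩
    change s(sigma d u', sigma d u) = s(c', c)
    rw [huc', huc]

/-- Induction on generations. Edges of polygons cross nothing in the family. Two crossing pullbacks
share a gap. If endpoints of the two have equal images, they lie in one critical class, which is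
proper because its image is not periodic. Otherwise the images cross, are connected by induction,
and the connection lifts back to the gap. -/
theorem YFamily.rel_of_cross (hC : IsFullCriticalCollection d C) (hd : 0 < d) {l : Chord}
    (hl : YFamily d C l) : ∀ m, YFamily d C m → Cross l m →
      ∀ x ∈ l, ∀ u ∈ m, chainEquiv (YFamily d C) x u := by
  have hplus : ∀ {V l}, V ∈ critSets C → l ∈ hullEdges V → l ∈ plusEdges C := fun hV hl => by
    obtain ⟨v, hv, rfl⟩ := hV
    exact mem_plusEdges hv hl
  induction hl with
  | base V hV hp l hl =>
    intro m hm hc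
    exfalso
    cases hm with
    | base V' hV' hp' _ hl' =>
      have hl₀ := hl
      obtain ⟨a, ha, b, hb, -, rfl, -⟩ := hl
      obtain ⟨a', ha', b', hb', -, rfl, -⟩ := hl'
      obtain ⟨v, -, rfl⟩ := hV
      obtain ⟨v', -, rfl⟩ := hV'
      have T := @(chainEquiv C).trans
      have S := @(chainEquiv C).symm
      have haa := hC.1.unlinked _ _ _ _ (T (S ha) hb) (T (S ha') hb') hc
      exact not_cross_hullEdges hl₀ (x := a') (y := b') (T ha haa) (T (T ha haa) (T (S ha') hb')) hc
    | pull m₀ _ hm₀ h => exact h.2 _ (hplus hV hl) (cross_comm.1 hc)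
  | pull l₀ l hl₀ h ih =>
    intro m hm hc
    cases hm with
    | base V' hV' hp' _ hl' => exact absurd hc (h.2 _ (hplus hV' hl'))
    | pull m₀ _ hm₀ h' =>
      suffices H : ∀ x y u v, l = s(x, y) → m = s(u, v) → chainEquiv (YFamily d C) x u by
        intro x hx u hu
        obtain ⟨y, rfl⟩ := hx
        obtain ⟨v, rfl⟩ := hu
        exact H x y u v rfl rfl
      rintro x y u v rfl rfl
      have T := @(chainEquiv (YFamily d C)).trans
      have S := @(chainEquiv (YFamily d C)).symm
      have hxy : chainEquiv (YFamily d C) x y := chainEquiv_of_mem (YFamily.pull _ _ hl₀ h)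
      have huv : chainEquiv (YFamily d C) u v := chainEquiv_of_mem (YFamily.pull _ _ hm₀ h')
      have el : l₀ = s(sigma d x, sigma d y) := h.1.symm
      have em : m₀ = s(sigma d u, sigma d v) := h'.1.symm
      have nx := hl₀.not_periodic (sigma d x) (by rw [el]; exact Sym2.mem_mk_left _ _)
      have ny := hl₀.not_periodic (sigma d y) (by rw [el]; exact Sym2.mem_mk_right _ _)
      have hσ : sigma d x ≠ sigma d y := fun e => hl₀.not_isDiag (by rw [el, e]; exact rfl)
      obtain ⟨z, hz, hzx, hzy⟩ := hC.1.exists_common hd h.2 hσ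
      have hzu := unseparated_of_cross hz hzx hzy h'.2 hc
      have hzv := unseparated_of_cross hz hzx hzy (Unseparated.symm h'.2)
        (by rwa [Sym2.eq_swap (a := v)])
      have same : ∀ {p q : S1}, Unseparated C z p → Unseparated C z q → sigma d p = sigma d q →
          sigma d p ∉ Function.periodicPts (sigma d) → chainEquiv (YFamily d C) p q :=
        fun hp hq e hn => rel_of_chain hC.1 hd (hC.chain_of_unseparated hd hz hp hq e) hn
      by_cases h1 : sigma d x = sigma d u
      · exact same hzx hzu h1 nx
      by_cases h2 : sigma d x = sigma d v
      · exact T (same hzx hzv h2 nx) (S huv)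
      by_cases h3 : sigma d y = sigma d u
      · exact T hxy (same hzy hzu h3 ny)
      by_cases h4 : sigma d y = sigma d v
      · exact T hxy (T (same hzy hzv h4 ny) (S huv))
      have hcr := hC.cross_sigma hd hz hzx hzy hzu hzv hc h1 h2 h3 h4
      have hR := ih m₀ hm₀ (by rw [el, em]; exact hcr) (sigma d x)
        (by rw [el]; exact Sym2.mem_mk_left _ _) (sigma d u)
        (by rw [em]; exact Sym2.mem_mk_left _ _)
      exact rel_of_unseparated hC hd hz hzx nx hR u hzu rfl

theorem unlinked_yFamily (hC : IsFullCriticalCollection d C) (hd : 0 < d) :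
    Unlinked (chainEquiv (YFamily d C)) := fun _ _ _ _ hab hxy hc =>
  chain_of_cross (fun a _ x _ h1 h2 h3 => YFamily.rel_of_cross hC hd h1 _ h2 h3 a
    (Sym2.mem_mk_left _ _) x (Sym2.mem_mk_left _ _)) hab hxy hc

theorem forward_yFamily (hC : IsCriticalCollection d C) {x y : S1}
    (h : chainEquiv (YFamily d C) x y) : chainEquiv (YFamily d C) (sigma d x) (sigma d y) := by
  rw [chainEquiv_iff] at h
  induction h with
  | refl => exact (chainEquiv _).refl _
  | @tail u v _ h ih =>
    refine (chainEquiv _).trans ih ?_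
    change YFamily d C s(u, v) at h
    generalize hl : s(u, v) = l at h
    cases h with
    | base V hV hp _ hl' =>
      obtain ⟨a, ha, b, hb, -, rfl, -⟩ := hl'
      obtain ⟨v₀, -, rfl⟩ := hV
      have hab := (chainEquiv C).trans ((chainEquiv C).symm ha) hb
      have huv : sigma d u = sigma d v := by
        rcases Sym2.eq_iff.1 hl with ⟨rfl, rfl⟩ | ⟨rfl, rfl⟩
        exacts [hC.sigma_eq_of_chain hab, (hC.sigma_eq_of_chain hab).symm]
      rw [huv]
    | pull l₀ _ hl₀ h =>
      subst hl
      apply chainEquiv_of_mem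
      have : s(sigma d u, sigma d v) = l₀ := h.1
      rw [this]
      exact hl₀

/-! ### Finiteness of the classes generated by `Y_C` -/

/-- The union of the proper critical sets. -/
def properVertices (d : ℕ) (C : Set Chord) : Set S1 :=
  {x | x ∈ vertices C ∧ IsProperCritSet d {y | chainEquiv C x y}}

/-- The level `k` is the time at which the chord becomes an edge of a proper polygon; one step later
it collapses. -/
theorem YFamily.exists_level (hC : IsCriticalCollection d C) {l : Chord} (hl : YFamily d C l) :
    ∃ k, ∀ x ∈ l, ∀ y ∈ l, (sigma d)^[k] x ∈ properVertices d C ∧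
      (sigma d)^[k + 1] x = (sigma d)^[k + 1] y := by
  induction hl with
  | base V hV hp l hl =>
    obtain ⟨a, ha, b, hb, -, rfl, -⟩ := hl
    obtain ⟨v, hv, rfl⟩ := hV
    have key : ∀ x ∈ s(a, b), chainEquiv C v x := by
      intro x hx
      rcases Sym2.mem_iff.1 hx with rfl | rfl
      exacts [ha, hb]
    refine ⟨0, fun x hx y hy => ⟨⟨mem_vertices_of_chain hv (key x hx), fun w hw => hp w
      ((chainEquiv C).trans (key x hx) hw)⟩, hC.sigma_eq_of_chain ((chainEquiv C).trans
      ((chainEquiv C).symm (key x hx)) (key y hy))⟩⟩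
  | pull l l' _ h ih =>
    obtain ⟨k, hk⟩ := ih
    exact ⟨k + 1, fun x hx y hy => hk (sigma d x) (h.1 ▸ mem_map_of_mem hx) (sigma d y)
      (h.1 ▸ mem_map_of_mem hy)⟩

/-- The orbit of `x` meets the finitely many proper vertices finitely often, since a repetition
would make such a vertex periodic. After the last visit, at time `N`, no chord of the class can
still be uncollapsed. So all points of the class have the same image at time `N + 1` and lie in one
finite fibre. -/
theorem finite_class_yFamily (hC : IsCriticalCollection d C) (hd : 0 < d) (x : S1) :
    {y | chainEquiv (YFamily d C) x y}.Finite := by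
  have hfin : (properVertices d C).Finite := (hC.finite_vertices hd).subset fun _ h => h.1
  have hvis : {k | (sigma d)^[k] x ∈ properVertices d C}.Finite := by
    refine Set.Finite.of_injOn (f := fun k => (sigma d)^[k] x) (t := properVertices d C)
      (fun k hk => hk) ?_ hfin
    have key : ∀ k l : ℕ, k < l → (sigma d)^[k] x ∈ properVertices d C →
        (sigma d)^[k] x ≠ (sigma d)^[l] x := by
      intro k l hkl hk he
      refine hk.2 _ ((chainEquiv C).refl _) ⟨l - k, Nat.sub_pos_of_lt hkl, ?_⟩
      change (sigma d)^[l - k] ((sigma d)^[k] x) = (sigma d)^[k] x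
      rw [← Function.iterate_add_apply, Nat.sub_add_cancel hkl.le, he]
    intro k hk l hl he
    rcases lt_trichotomy k l with h | h | h
    · exact absurd he (key k l h hk)
    · exact h
    · exact absurd he.symm (key l k h hl)
  obtain ⟨N, hN⟩ := hvis.bddAbove
  have hN' : ∀ k, N + 1 ≤ k → (sigma d)^[k] x ∉ properVertices d C := fun k hk h => by
    have := hN h; omega
  have main : ∀ y, chainEquiv (YFamily d C) x y →
      (∀ k, N + 1 ≤ k → (sigma d)^[k] y ∉ properVertices d C) ∧
        (sigma d)^[N + 1] y = (sigma d)^[N + 1] x := by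
    intro y hy
    rw [chainEquiv_iff] at hy
    induction hy with
    | refl => exact ⟨hN', rfl⟩
    | @tail u v _ h ih =>
      obtain ⟨k, hk⟩ := YFamily.exists_level hC h
      obtain ⟨h1, h2⟩ := hk u (Sym2.mem_mk_left _ _) v (Sym2.mem_mk_right _ _)
      have hkN : k < N + 1 := by
        by_contra hcon; exact ih.1 k (not_lt.1 hcon) h1
      have heq : ∀ j, k + 1 ≤ j → (sigma d)^[j] v = (sigma d)^[j] u := by
        intro j hj
        rw [← Nat.sub_add_cancel hj, Function.iterate_add_apply _ (j - (k + 1)) (k + 1),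
          Function.iterate_add_apply _ (j - (k + 1)) (k + 1), h2]
      refine ⟨fun j hj => ?_, ?_⟩
      · rw [heq j (by omega)]; exact ih.1 j hj
      · rw [heq _ (by omega), ih.2]
  refine (finite_fiber (n := d ^ (N + 1)) (by positivity) ((sigma d)^[N + 1] x)).subset
    fun y hy => ?_
  have := (main y hy).2
  rw [sigma_iterate] at this ⊢
  exact this

/-! ### Matching of fibres, and piles as classes -/

/-- Related points have fibres that are matched by the relation. -/
def FiberMatching (d : ℕ) (r : Setoid S1) : Prop :=
  ∀ a b, r a b → ∃ φ : S1 → S1, (∀ x, sigma d x = a → sigma d (φ x) = b ∧ r x (φ x)) ∧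
    Set.InjOn φ {x | sigma d x = a}

theorem fiberMatching_of_mem {L : Set Chord}
    (h : ∀ a b, s(a, b) ∈ L → a ≠ b → ∃ φ : S1 → S1, (∀ x, sigma d x = a →
      sigma d (φ x) = b ∧ chainEquiv L x (φ x)) ∧ Set.InjOn φ {x | sigma d x = a}) :
    FiberMatching d (chainEquiv L) := by
  intro a b hab
  rw [chainEquiv_iff] at hab
  induction hab with
  | refl => exact ⟨id, fun x hx => ⟨hx, (chainEquiv L).refl x⟩, Set.injOn_id _⟩
  | @tail b c _ hbc ih =>
    by_cases he : b = c
    · exact he ▸ ih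
    obtain ⟨φ, hφ, hφi⟩ := ih
    obtain ⟨ψ, hψ, hψi⟩ := h b c hbc he
    refine ⟨ψ ∘ φ, fun x hx => ⟨(hψ _ (hφ x hx).1).1, (chainEquiv L).trans (hφ x hx).2
      (hψ _ (hφ x hx).1).2⟩, hψi.comp hφi fun x hx => (hφ x hx).1⟩

/-- A point over `a` is matched with the end over `b` of a saturated arc starting at it. The chord
between them is unseparated, hence a pullback. -/
theorem fiberMatching_yFamily (hC : IsFullCriticalCollection d C) (hd : 0 < d) :
    FiberMatching d (chainEquiv (YFamily d C)) := by
  refine fiberMatching_of_mem fun a b hab hne => ?_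
  have ex : ∀ x, sigma d x = a → ∃ y, Saturated C (arc x (ang x y)) ∧ sigma d y = b :=
    fun x hx => hC.exists_right_lift hd (hx ▸ hne.symm)
  choose! φ hφ using ex
  refine ⟨φ, fun x hx => ⟨(hφ x hx).2, chainEquiv_of_mem (YFamily.pull s(a, b) _ hab ?_)⟩, ?_⟩
  · refine ⟨?_, unseparated_of_saturated (hφ x hx).1⟩
    change s(sigma d x, sigma d (φ x)) = s(a, b)
    rw [hx, (hφ x hx).2]
  · intro x hx x' hx' he
    have hx : sigma d x = a := hx
    have hx' : sigma d x' = a := hx'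
    refine hC.right_lift_injective hd (y := φ x) (by rw [hx, (hφ x hx).2]; exact hne.symm)
      (hx.trans hx'.symm) (hφ x hx).1 ?_
    have := (hφ x' hx').1
    rw [he]
    exact this

/-- Nontrivial classes contain no periodic points. -/
theorem not_periodic_of_rel {x y : S1} (h : chainEquiv (YFamily d C) x y) (hne : x ≠ y) :
    x ∉ Function.periodicPts (sigma d) := by
  rw [chainEquiv_iff, Relation.ReflTransGen.cases_head_iff] at h
  rcases h with h | ⟨c, h, -⟩
  · exact absurd h hne
  · exact YFamily.not_periodic h x (Sym2.mem_mk_left _ _)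

theorem not_disjointChords_iff {l m : Chord} :
    ¬ DisjointChords l m ↔ (∃ x, x ∈ l ∧ x ∈ m) ∨ Cross l m := by
  unfold DisjointChords
  rw [not_and_or, not_not]
  push Not
  rfl

/-- Connection through crossings adds nothing to connection through endpoints, by
`YFamily.rel_of_cross`. -/
theorem pile_vertices (hC : IsFullCriticalCollection d C) (hd : 0 < d) {l : Chord}
    (hl : YFamily d C l) {x : S1} (hx : x ∈ l) :
    vertices {m | Relation.ReflTransGen
      (fun u v => u ∈ YFamily d C ∧ v ∈ YFamily d C ∧ ¬ DisjointChords u v) l m} =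
      {y | chainEquiv (YFamily d C) x y} := by
  ext y
  constructor
  · rintro ⟨m, hm, hy⟩
    replace hm : Relation.ReflTransGen _ l m := hm
    have base : ∀ m ∈ YFamily d C, ∀ u ∈ m, ∀ v ∈ m, chainEquiv (YFamily d C) u v := by
      intro m hm u hu v hv
      obtain ⟨u', rfl⟩ := hu
      rcases Sym2.mem_iff.1 hv with rfl | rfl
      · exact (chainEquiv _).refl _
      · exact chainEquiv_of_mem hm
    have : ∀ y ∈ m, chainEquiv (YFamily d C) x y := by
      clear hy
      induction hm with
      | refl => exact fun y hy => base l hl x hx y hy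
      | @tail u v _ h ih =>
        intro y hy
        obtain ⟨hu, hv, hnd⟩ := h
        rcases not_disjointChords_iff.1 hnd with ⟨w, hw, hw'⟩ | hc
        · exact (chainEquiv _).trans (ih w hw) (base v hv w hw' y hy)
        · obtain ⟨w, hw⟩ : ∃ w, w ∈ u := ⟨u.out.1, Sym2.out_fst_mem u⟩
          exact (chainEquiv _).trans (ih w hw)
            (YFamily.rel_of_cross hC hd hu v hv hc w hw y hy)
    exact this y hy
  · intro hy
    have hy' : Relation.ReflTransGen _ x y := chainEquiv_iff.1 hy
    clear hy
    induction hy' with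
    | refl => exact ⟨l, Relation.ReflTransGen.refl, hx⟩
    | @tail u v _ h ih =>
      obtain ⟨m, hm, hum⟩ := ih
      refine ⟨s(u, v), Relation.ReflTransGen.tail hm ⟨?_, h, ?_⟩, Sym2.mem_mk_right _ _⟩
      · have hm : Relation.ReflTransGen _ l m := hm
        rcases Relation.ReflTransGen.cases_tail_iff _ _ _ |>.1 hm with rfl | ⟨_, _, h'⟩
        exacts [hl, h'.2.1]
      · exact not_disjointChords_iff.2 (Or.inl ⟨u, hum, Sym2.mem_mk_left _ _⟩)

theorem mem_qLam_iff {r : Setoid S1} {l : Chord} : l ∈ qLam r ↔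
    (∃ a b, r a b ∧ a ≠ b ∧ l = s(a, b) ∧ Disjoint (Set.cIoo a b) {x | r a x}) ∨ l.IsDiag := by
  unfold qLam
  rw [Set.mem_union]
  refine or_congr ?_ Iff.rfl
  simp only [Set.mem_iUnion]
  constructor
  · rintro ⟨g, ⟨v, rfl⟩, a, ha, b, hb, hne, rfl, hdis⟩
    refine ⟨a, b, r.trans ha (r.symm hb), hne, rfl, ?_⟩
    convert hdis using 1
    ext x
    exact ⟨fun h => r.trans (r.symm h) ha, fun h => r.trans ha (r.symm h)⟩
  · rintro ⟨a, b, hab, hne, rfl, hdis⟩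
    refine ⟨{x | r x a}, ⟨a, rfl⟩, a, r.refl a, b, r.symm hab, hne, rfl, ?_⟩
    convert hdis using 1
    ext x
    exact ⟨fun h => r.symm h, fun h => r.symm h⟩

theorem pileEdges_eq (hC : IsFullCriticalCollection d C) (hd : 0 < d) :
    pileEdges d C = qLam (chainEquiv (YFamily d C)) := by
  ext l
  rw [mem_qLam_iff]
  unfold pileEdges
  rw [Set.mem_union]
  refine or_congr ?_ Iff.rfl
  simp only [Set.mem_iUnion]
  constructor
  · rintro ⟨P, ⟨m, hm, rfl⟩, hl⟩
    have hx := Sym2.out_fst_mem m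
    rw [pile_vertices hC hd hm hx] at hl
    obtain ⟨a, ha, b, hb, hne, rfl, hdis⟩ := hl
    have ha : chainEquiv (YFamily d C) _ a := ha
    refine ⟨a, b, (chainEquiv _).trans ((chainEquiv _).symm ha) hb, hne, rfl, ?_⟩
    convert hdis using 1
    ext x
    exact ⟨fun h => (chainEquiv _).trans ha h, fun h => (chainEquiv _).trans
      ((chainEquiv _).symm ha) h⟩
  · rintro ⟨a, b, hab, hne, rfl, hdis⟩
    have hab' := chainEquiv_iff.1 hab
    rw [Relation.ReflTransGen.cases_head_iff] at hab'
    rcases hab' with h | ⟨c, h, -⟩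
    · exact absurd h hne
    · refine ⟨_, ⟨s(a, c), h, rfl⟩, ?_⟩
      rw [pile_vertices hC hd h (Sym2.mem_mk_left a c)]
      exact ⟨a, (chainEquiv _).refl a, b, hab, hne, rfl, hdis⟩

/-- Edges of piles do not cross critical chords. -/
theorem not_cross_of_mem_qLam_yFamily (hC : IsFullCriticalCollection d C) (hd : 0 < d) :
    ∀ l ∈ qLam (chainEquiv (YFamily d C)), ∀ c ∈ C, ¬ Cross l c := by
  have hYC : ∀ l ∈ YFamily d C, ∀ c ∈ C, ¬ Cross l c := by
    intro l hl c hc hcr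
    induction c using Sym2.ind with | _ p q
    have hpq := chainEquiv_of_mem hc
    cases hl with
    | base V hV hp _ hl =>
      have hl₀ := hl
      obtain ⟨a, ha, b, hb, -, rfl, -⟩ := hl
      obtain ⟨v, -, rfl⟩ := hV
      have T := @(chainEquiv C).trans
      have h1 := hC.1.unlinked _ _ _ _ (T ((chainEquiv C).symm ha) hb) hpq hcr
      exact not_cross_hullEdges hl₀ (x := p) (y := q) (T ha h1) (T (T ha h1) hpq) hcr
    | pull l₀ _ hl₀ h =>
      induction l using Sym2.ind with | _ x y
      have hσ : sigma d x ≠ sigma d y := fun e => hl₀.not_isDiag (by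
        rw [← h.1]; exact e)
      by_cases hpy : chainEquiv C p y
      · have hpx : ¬ chainEquiv C p x := fun hpx => hσ (hC.1.sigma_eq_of_chain
          ((chainEquiv C).trans ((chainEquiv C).symm hpx) hpy))
        rw [Sym2.eq_swap] at hcr
        obtain ⟨e, he, hce⟩ := hC.1.exists_plusEdge_cross hd hpq hpx hcr
        rw [Sym2.eq_swap] at hce
        exact h.2 e he hce
      · obtain ⟨e, he, hce⟩ := hC.1.exists_plusEdge_cross hd hpq hpy hcr
        exact h.2 e he hce
  intro l hl c hc hcr
  rcases mem_qLam_iff.1 hl with ⟨a, b, hab, hne, rfl, hdis⟩ | hl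
  · induction c using Sym2.ind with | _ p q
    -- No chord of `Y_C` crosses `c`, so the class of `a` meets the critical class of `c`. That
    -- class is proper, hence contained in the class of `a`; then `c` joins two points of the latter
    -- and cannot cross an edge of its hull.
    obtain ⟨w, hw, hpw⟩ := chain_meet_of_cross hYC hab (chainEquiv_of_mem hc) hcr
    have hab' := chainEquiv_iff.1 ((chainEquiv _).symm hw)
    obtain ⟨l, hl, hwl⟩ : ∃ l ∈ YFamily d C, w ∈ l := by
      have hnt : ∃ w', w ≠ w' ∧ chainEquiv (YFamily d C) w w' := by
        by_cases h : w = a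
        · exact ⟨b, h ▸ hne, h ▸ hab⟩
        · exact ⟨a, h, (chainEquiv _).symm hw⟩
      obtain ⟨w', hne', hww'⟩ := hnt
      rw [chainEquiv_iff, Relation.ReflTransGen.cases_head_iff] at hww'
      rcases hww' with h | ⟨c, h, -⟩
      · exact absurd h hne'
      · exact ⟨_, h, Sym2.mem_mk_left _ _⟩
    have hprop := YFamily.isProperCritSet hC.1 hl hwl
    have hap : ∀ t, chainEquiv C w t → chainEquiv (YFamily d C) a t := fun t ht =>
      (chainEquiv _).trans hw (rel_of_chain_of_isProper hC.1 hd ht hprop)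
    have hp := hap p ((chainEquiv C).symm hpw)
    have hq := hap q ((chainEquiv C).trans ((chainEquiv C).symm hpw) (chainEquiv_of_mem hc))
    exact not_cross_hullEdges (X := {x | chainEquiv (YFamily d C) a x})
      ⟨a, (chainEquiv _).refl a, b, hab, hne, rfl, hdis⟩ hp hq hcr
  · induction l using Sym2.ind with | _ x y
    have : x = y := hl
    subst this
    exact not_cross_diag_left _ _ hcr

end YTheory

section Matching

variable {d : ℕ} {r : Setoid S1}

/-! ### Relations with matched fibres -/

/-- The endpoints of a hole of a class are mapped to consecutive points of the image class. -/
theorem FiberMatching.hole_image (hm : FiberMatching d r) (hr : Unlinked r) (hd : 0 < d)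
    {s t w : S1} (hst : r s t) (hne : s ≠ t) (hdis : Disjoint (Set.cIoo s t) {x | r s x})
    (hw : r (sigma d s) w) (hws : w ≠ sigma d s) :
    sigma d t ≠ sigma d s ∧ ¬ sbtw (sigma d s) w (sigma d t) := by
  have hd' : (0 : ℝ) < d := by exact_mod_cast hd
  set ρ := ang (sigma d s) w with hρ
  have hρ0 : 0 < ρ := ang_pos.2 hws
  have hρ1 : ρ < 1 := ang_lt_one _ _
  have hL0 := ang_pos.2 hne.symm
  have hL1 := ang_lt_one s t
  set L := ang s t with hL
  -- The image of the hole makes `k` turns and a further arc `F`; suppose `F` passes `w`. Let `A` be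
  -- the points of `[s, t)` over `σ_d s`. Shifting `A` by `ρ / d` gives points over `w` inside the
  -- hole. Matching returns them to the fibre of `σ_d s`; unlinkedness keeps them in the hole, and
  -- they miss `s`, as the hole has no points of the class of `s`. This injects `A` into `A \ {s}`.
  have main : ∀ F : ℝ, ρ < F → F ≤ 1 → (∃ k : ℤ, d * L = k + F) → False := by
    rintro F hF hF1 ⟨k, hk⟩
    set A : Set S1 := {x | sigma d x = sigma d s ∧ ang s x < L}
    have hA : A.Finite := (finite_fiber hd (sigma d s)).subset fun x hx => hx.1
    have hsA : s ∈ A := ⟨rfl, by rw [ang_self]; exact hL0⟩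
    obtain ⟨φ, hφ, hφi⟩ := hm w (sigma d s) (r.symm hw)
    have shift : ∀ x ∈ A, sigma d (x + ((ρ / d : ℝ) : S1)) = w ∧
        0 < ang s (x + ((ρ / d : ℝ) : S1)) ∧ ang s (x + ((ρ / d : ℝ) : S1)) < L := by
      rintro x ⟨hx, hxL⟩
      have hρd : 0 < ρ / d := by positivity
      have h0 := ang_nonneg s x
      obtain ⟨j, hj⟩ := sigma_eq_sigma_iff.1 hx
      have hjk : j ≤ k := by
        have : (j : ℝ) < k + 1 := by
          rw [← hj]; nlinarith
        have : j < k + 1 := by exact_mod_cast this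
        omega
      have hjk' : (j : ℝ) ≤ k := by exact_mod_cast hjk
      have hlt : ang s x + ρ / d < L := by
        have : d * (ang s x + ρ / d) < d * L := by
          rw [mul_add, mul_div_cancel₀ _ hd'.ne', hj, hk]; linarith
        exact lt_of_mul_lt_mul_left this hd'.le
      have e : ang s (x + ((ρ / d : ℝ) : S1)) = ang s x + ρ / d := by
        apply ang_eq_of (by linarith) (by linarith)
        rw [AddCircle.coe_add, ← add_assoc, add_coe_ang]
      refine ⟨?_, by rw [e]; linarith, by rw [e]; exact hlt⟩
      rw [sigma_add_coe, mul_div_cancel₀ _ hd'.ne', hx, hρ, add_coe_ang]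
    have hmaps : Set.MapsTo (fun x => φ (x + ((ρ / d : ℝ) : S1))) A (A \ {s}) := by
      intro x hx
      obtain ⟨h1, h2, h3⟩ := shift x hx
      obtain ⟨g1, g2⟩ := hφ _ h1
      set y := x + ((ρ / d : ℝ) : S1)
      have hny : ¬ r s y := fun h => Set.disjoint_left.1 hdis (sbtw_iff_ang.2 ⟨h2, h3⟩) h
      have hnφ : ¬ r s (φ y) := fun h => hny (r.trans h (r.symm g2))
      have n1 : φ y ≠ s := fun h => hnφ (h ▸ r.refl s)
      have n2 : ang s (φ y) ≠ ang s t := fun h => hnφ (ang_inj h ▸ hst)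
      refine ⟨⟨g1, ?_⟩, n1⟩
      by_contra hcon
      refine hny (hr s t y (φ y) hst g2 ((cross_iff_base s).2 ?_))
      rw [ang_self]
      have := ang_pos.2 n1
      grind
    have hinj : Set.InjOn (fun x => φ (x + ((ρ / d : ℝ) : S1))) A := by
      intro x hx x' hx' h
      exact add_right_cancel (hφi (shift x hx).1 (shift x' hx').1 h)
    have h1 := Set.ncard_le_ncard_of_injOn _ hmaps hinj (hA.subset Set.sdiff_subset)
    have h2 := Set.ncard_sdiff_singleton_lt_of_mem hsA hA
    omega
  have hdL : ((d * L : ℝ) : S1) = sigma d t - sigma d s := by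
    rw [sigma_eq d s t]; simp [hL]
  constructor
  · intro h
    refine main 1 hρ1 le_rfl ?_
    obtain ⟨k, hk⟩ := sigma_eq_sigma_iff.1 h
    exact ⟨k - 1, by push_cast; linarith⟩
  · intro h
    refine main (ang (sigma d s) (sigma d t)) (sbtw_iff_ang.1 h).2 (ang_lt_one _ _).le ?_
    obtain ⟨k, hk⟩ := coe_eq_coe_iff.1 (hdL.trans (coe_ang (sigma d s) (sigma d t)).symm)
    exact ⟨k, by linarith⟩

/-- Lifting of holes. -/
theorem FiberMatching.exists_hole_lift (hm : FiberMatching d r) (hr : Unlinked r) (hd : 0 < d)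
    (hfin : ∀ x, {y | r x y}.Finite) (hfw : ∀ x y, r x y → r (sigma d x) (sigma d y)) {x b : S1}
    (hab : r (sigma d x) b) (hne : b ≠ sigma d x)
    (hdis : Disjoint (Set.cIoo (sigma d x) b) {y | r (sigma d x) y}) :
    ∃ t, r x t ∧ t ≠ x ∧ Disjoint (Set.cIoo x t) {y | r x y} ∧ sigma d t = b := by
  obtain ⟨φ, hφ, -⟩ := hm _ _ hab
  obtain ⟨h1, h2⟩ := hφ x rfl
  obtain ⟨t, ht, htx, htd⟩ := exists_next (hfin x) (x := x)
    ⟨φ x, h2, fun h => hne (by rw [← h1, h])⟩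
  refine ⟨t, ht, htx, htd, ?_⟩
  obtain ⟨g1, g2⟩ := hm.hole_image hr hd ht htx.symm htd hab hne
  have g3 : ¬ sbtw (sigma d x) (sigma d t) b := fun h => Set.disjoint_left.1 hdis h (hfw _ _ ht)
  rw [sbtw_iff_ang] at g2 g3
  have := ang_pos.2 g1
  have := ang_pos.2 hne
  exact ang_inj (z := sigma d x) (by grind)

/-- Every chord of the family that is not collapsed belongs to a full collection of disjoint
siblings. -/
def HasSiblings (d : ℕ) (L : Set Chord) : Prop :=
  ∀ x y, s(x, y) ∈ L → sigma d x ≠ sigma d y → ∃ π : Fin d → Fin d, Function.Injective π ∧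
    (∃ j : Fin d, (j : ℕ) = 0 ∧ (π j : ℕ) = 0) ∧
      ∀ j : Fin d, s(x + (((j : ℕ) / d : ℝ) : S1), y + (((π j : ℕ) / d : ℝ) : S1)) ∈ L

/-- The image hole lifts to a hole starting at each of the `d` preimages of `σ_d x`. The arrival
points are distinct because predecessors in a class are unique, and the lift starting at `x` is the
given chord. -/
theorem FiberMatching.hasSiblings_qLam (hm : FiberMatching d r) (hr : Unlinked r) (hd : 0 < d)
    (hfin : ∀ x, {y | r x y}.Finite) (hfw : ∀ x y, r x y → r (sigma d x) (sigma d y)) :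
    HasSiblings d (qLam r) := by
  have main : ∀ x y, r x y → x ≠ y → Disjoint (Set.cIoo x y) {z | r x z} →
      sigma d x ≠ sigma d y → ∃ π : Fin d → Fin d, Function.Injective π ∧
    (∃ j : Fin d, (j : ℕ) = 0 ∧ (π j : ℕ) = 0) ∧
      ∀ j : Fin d, s(x + (((j : ℕ) / d : ℝ) : S1), y + (((π j : ℕ) / d : ℝ) : S1)) ∈ qLam r := by
    intro x y hxy hne hdis hσ
    have hrσ := hfw _ _ hxy
    have hdσ : Disjoint (Set.cIoo (sigma d x) (sigma d y)) {z | r (sigma d x) z} := by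
      refine Set.disjoint_left.2 fun w hw hw' => ?_
      have hw1 : w ≠ sigma d x := ang_pos.1 (sbtw_iff_ang.1 hw).1
      exact (hm.hole_image hr hd hxy hne hdis hw' hw1).2 hw
    have ex : ∀ j : Fin d, ∃ i : Fin d, r (x + (((j : ℕ) / d : ℝ) : S1))
        (y + (((i : ℕ) / d : ℝ) : S1)) ∧
        y + (((i : ℕ) / d : ℝ) : S1) ≠ x + (((j : ℕ) / d : ℝ) : S1) ∧
        Disjoint (Set.cIoo (x + (((j : ℕ) / d : ℝ) : S1)) (y + (((i : ℕ) / d : ℝ) : S1)))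
          {z | r (x + (((j : ℕ) / d : ℝ) : S1)) z} := by
      intro j
      have e := sigma_add_div hd x j
      obtain ⟨t, h1, h2, h3, h4⟩ := hm.exists_hole_lift hr hd hfin hfw
        (x := x + (((j : ℕ) / d : ℝ) : S1)) (b := sigma d y) (by rwa [e]) (by rw [e]; exact hσ.symm)
        (by rwa [e])
      obtain ⟨i, rfl⟩ := exists_fin_of_sigma_eq hd h4
      exact ⟨i, h1, h2, h3⟩
    choose π h1 h2 h3 using ex
    refine ⟨π, ?_, ?_, fun j => mem_qLam_iff.2 (Or.inl ⟨_, _, h1 j, (h2 j).symm, rfl, h3 j⟩)⟩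
    · intro i j hij
      apply fin_add_div_injective hd x
      have hrij : r (x + (((i : ℕ) / d : ℝ) : S1)) (x + (((j : ℕ) / d : ℝ) : S1)) :=
        r.trans (h1 i) (hij ▸ r.symm (h1 j))
      refine prev_unique (X := {z | r (x + (((i : ℕ) / d : ℝ) : S1)) z}) (r.refl _) hrij (h2 i)
        (hij ▸ h2 j) (h3 i) ?_
      rw [hij]
      convert h3 j using 1
      ext z
      exact ⟨fun h => r.trans (r.symm hrij) h, fun h => r.trans hrij h⟩
    · refine ⟨⟨0, hd⟩, rfl, ?_⟩
      have e : x + ((((⟨0, hd⟩ : Fin d) : ℕ) / d : ℝ) : S1) = x := by simp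
      have g1 := h1 ⟨0, hd⟩
      have g2 := h2 ⟨0, hd⟩
      have g3 := h3 ⟨0, hd⟩
      rw [e] at g1 g2 g3
      have := next_unique (X := {z | r x z}) hxy g1 hne.symm g2 hdis g3
      have hinj : π ⟨0, hd⟩ = ⟨0, hd⟩ :=
        fin_add_div_injective hd y (by simpa using this.symm)
      rw [hinj]
  intro x y hl hσ
  have hne : x ≠ y := fun h => hσ (h ▸ rfl)
  rcases mem_qLam_iff.1 hl with ⟨a, b, hab, hne', he, hdis⟩ | hl
  · rcases Sym2.eq_iff.1 he with ⟨rfl, rfl⟩ | ⟨rfl, rfl⟩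
    · exact main x y hab hne hdis hσ
    -- When the hole runs from `y` to `x`, the roles of the endpoints are exchanged and the inverse
    -- permutation is used.
    · obtain ⟨π, hπ, ⟨j, hj, hπj⟩, H⟩ := main y x hab hne.symm hdis hσ.symm
      let e := Equiv.ofBijective π (Finite.injective_iff_bijective.1 hπ)
      have he : ∀ i, π (e.symm i) = i := e.apply_symm_apply
      refine ⟨e.symm, e.symm.injective, ⟨π j, hπj, ?_⟩, fun i => ?_⟩
      · rw [show e.symm (π j) = j from e.symm_apply_apply j, hj]
      · have := H (e.symm i)
        rw [he, Sym2.eq_swap] at this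
        exact this
  · exact absurd hl hne

theorem FiberMatching.forward_qLam (hm : FiberMatching d r) (hr : Unlinked r) (hd : 0 < d)
    (hfw : ∀ x y, r x y → r (sigma d x) (sigma d y)) : ∀ l ∈ qLam r, l.map d ∈ qLam r := by
  intro l hl
  rcases mem_qLam_iff.1 hl with ⟨a, b, hab, hne, rfl, hdis⟩ | hl
  · change s(sigma d a, sigma d b) ∈ qLam r
    rw [mem_qLam_iff]
    by_cases h : sigma d a = sigma d b
    · exact Or.inr h
    · refine Or.inl ⟨_, _, hfw _ _ hab, h, rfl, Set.disjoint_left.2 fun w hw hw' => ?_⟩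
      exact (hm.hole_image hr hd hab hne hdis hw' (ang_pos.1 (sbtw_iff_ang.1 hw).1)).2 hw
  · induction l using Sym2.ind with | _ a b
    have hab : a = b := hl
    subst hab
    exact mem_qLam_iff.2 (Or.inr rfl)

theorem FiberMatching.backward_qLam (hm : FiberMatching d r) (hr : Unlinked r) (hd : 0 < d)
    (hfin : ∀ x, {y | r x y}.Finite) (hfw : ∀ x y, r x y → r (sigma d x) (sigma d y)) :
    ∀ a b, s(a, b) ∈ qLam r → ∃ x y, s(x, y) ∈ qLam r ∧ sigma d x = a ∧ sigma d y = b := by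
  have main : ∀ a b, r a b → a ≠ b → Disjoint (Set.cIoo a b) {x | r a x} →
      ∃ x y, s(x, y) ∈ qLam r ∧ sigma d x = a ∧ sigma d y = b := by
    intro a b hab hne hdis
    obtain ⟨x, rfl⟩ := exists_sigma_eq hd a
    obtain ⟨t, h1, h2, h3, h4⟩ := hm.exists_hole_lift hr hd hfin hfw hab hne.symm hdis
    exact ⟨x, t, mem_qLam_iff.2 (Or.inl ⟨x, t, h1, h2.symm, rfl, h3⟩), rfl, h4⟩
  intro a b hl
  rcases mem_qLam_iff.1 hl with ⟨a', b', hab, hne, he, hdis⟩ | hl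
  · obtain ⟨x, y, hxy, hx, hy⟩ := main a' b' hab hne hdis
    rcases Sym2.eq_iff.1 he with ⟨rfl, rfl⟩ | ⟨rfl, rfl⟩
    · exact ⟨x, y, hxy, hx, hy⟩
    · exact ⟨y, x, by rwa [Sym2.eq_swap], hy, hx⟩
  · have hab : a = b := hl
    obtain ⟨x, hx⟩ := exists_sigma_eq hd a
    exact ⟨x, x, mem_qLam_iff.2 (Or.inr rfl), hx, hab ▸ hx⟩

theorem not_cross_qLam (hr : Unlinked r) : ∀ l ∈ qLam r, ∀ m ∈ qLam r, ¬ Cross l m := by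
  intro l hl m hm hc
  rcases mem_qLam_iff.1 hl with ⟨a, b, hab, hne, rfl, hdis⟩ | hl
  · rcases mem_qLam_iff.1 hm with ⟨a', b', hab', hne', rfl, hdis'⟩ | hm
    · have h := hr _ _ _ _ hab hab' hc
      exact not_cross_hullEdges (X := {x | r a x}) ⟨a, r.refl a, b, hab, hne, rfl, hdis⟩ h
        (r.trans h hab') hc
    · induction m using Sym2.ind with | _ x y
      have : x = y := hm
      subst this
      exact not_cross_diag_right _ _ hc
  · induction l using Sym2.ind with | _ x y
    have : x = y := hl
    subst this
    exact not_cross_diag_left _ _ hc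

end Matching

/-! ### Closures of families of chords -/

section Closure

variable {d : ℕ} {L : Set Chord}

theorem mem_closureFamily {x y : S1} :
    s(x, y) ∈ closureFamily L ↔ (x, y) ∈ closure (endpointPairs L) := by
  have hswap : ∀ p : S1 × S1, p ∈ closure (endpointPairs L) →
      p.swap ∈ closure (endpointPairs L) := by
    intro p hp
    refine map_mem_closure continuous_swap hp fun q hq => ?_
    change s(q.2, q.1) ∈ L
    rw [Sym2.eq_swap]; exact hq
  constructor
  · rintro ⟨⟨u, v⟩, hp, he⟩
    rcases Sym2.eq_iff.1 he with ⟨rfl, rfl⟩ | ⟨rfl, rfl⟩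
    · exact hp
    · exact hswap _ hp
  · exact fun h => ⟨_, h, rfl⟩

theorem subset_closureFamily : L ⊆ closureFamily L := by
  intro l hl
  induction l using Sym2.ind with | _ x y
  exact mem_closureFamily.2 (subset_closure hl)

theorem isClosedFamily_closureFamily : IsClosedFamily (closureFamily L) := by
  have : endpointPairs (closureFamily L) = closure (endpointPairs L) := by
    ext ⟨x, y⟩
    exact mem_closureFamily
  unfold IsClosedFamily
  rw [this]
  exact isClosed_closure

theorem not_cross_closureFamily {M : Set Chord} (h : ∀ l ∈ L, ∀ m ∈ M, ¬ Cross l m) :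
    ∀ l ∈ closureFamily L, ∀ m ∈ closureFamily M, ¬ Cross l m := by
  intro l hl m hm hc
  induction l using Sym2.ind with | _ x y
  induction m using Sym2.ind with | _ u v
  rw [mem_closureFamily] at hl hm
  have hmem : ((x, y), (u, v)) ∈ closure (endpointPairs L ×ˢ endpointPairs M) := by
    rw [closure_prod_eq]; exact ⟨hl, hm⟩
  obtain ⟨⟨p, q⟩, hpq, hp, hq⟩ := mem_closure_iff.1 hmem _ isOpen_cross hc
  exact h _ hp _ hq hpq

theorem forward_closureFamily (h : ∀ l ∈ L, l.map d ∈ L) :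
    ∀ l ∈ closureFamily L, l.map d ∈ closureFamily L := by
  intro l hl
  induction l using Sym2.ind with | _ x y
  rw [mem_closureFamily] at hl
  refine mem_closureFamily.2 (map_mem_closure (f := Prod.map (sigma d) (sigma d))
    ((continuous_sigma d).prodMap (continuous_sigma d)) hl fun p hp => ?_)
  exact h _ hp

theorem backward_closureFamily
    (h : ∀ a b, s(a, b) ∈ L → ∃ x y, s(x, y) ∈ L ∧ sigma d x = a ∧ sigma d y = b) :
    ∀ a b, s(a, b) ∈ closureFamily L →
      ∃ x y, s(x, y) ∈ closureFamily L ∧ sigma d x = a ∧ sigma d y = b := by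
  intro a b hab
  rw [mem_closureFamily] at hab
  have hcont : Continuous (Prod.map (sigma d) (sigma d)) :=
    (continuous_sigma d).prodMap (continuous_sigma d)
  have hsub : endpointPairs L ⊆ Prod.map (sigma d) (sigma d) '' endpointPairs L := by
    rintro ⟨a, b⟩ hab
    obtain ⟨x, y, hxy, hx, hy⟩ := h a b hab
    exact ⟨(x, y), hxy, by simp [hx, hy]⟩
  have := closure_mono hsub hab
  rw [← image_closure_of_isCompact isClosed_closure.isCompact hcont.continuousOn] at this
  obtain ⟨⟨x, y⟩, hxy, he⟩ := this
  rw [Prod.map_apply, Prod.mk.injEq] at he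
  exact ⟨x, y, mem_closureFamily.2 hxy, he.1, he.2⟩

/-- There are finitely many permutations, so one of them serves chords of `L` arbitrarily close to
the given one; it then also serves the limit. -/
theorem hasSiblings_closureFamily (h : HasSiblings d L) : HasSiblings d (closureFamily L) := by
  intro x y hxy hσ
  rw [mem_closureFamily] at hxy
  let S : (Fin d → Fin d) → Set (S1 × S1) := fun π => {p | ∀ j : Fin d,
    s(p.1 + (((j : ℕ) / d : ℝ) : S1), p.2 + (((π j : ℕ) / d : ℝ) : S1)) ∈ L}
  let P : Set (Fin d → Fin d) := {π | Function.Injective π ∧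
    ∃ j : Fin d, (j : ℕ) = 0 ∧ (π j : ℕ) = 0}
  have hopen : IsOpen {p : S1 × S1 | sigma d p.1 ≠ sigma d p.2} :=
    isOpen_ne_fun ((continuous_sigma d).comp continuous_fst)
      ((continuous_sigma d).comp continuous_snd)
  have h1 : (x, y) ∈ closure (⋃ π ∈ P, S π) := by
    rw [mem_closure_iff] at hxy ⊢
    intro o ho hxyo
    obtain ⟨p, ⟨hpo, hpσ⟩, hpL⟩ := hxy _ (ho.inter hopen) ⟨hxyo, hσ⟩
    obtain ⟨π, hπ, hj, H⟩ := h p.1 p.2 hpL hpσ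
    exact ⟨p, hpo, Set.mem_biUnion (show π ∈ P from ⟨hπ, hj⟩) H⟩
  rw [Set.Finite.closure_biUnion (Set.toFinite P)] at h1
  obtain ⟨π, hπ, hmem⟩ := Set.mem_iUnion₂.1 h1
  refine ⟨π, hπ.1, hπ.2, fun j => mem_closureFamily.2 ?_⟩
  exact map_mem_closure (f := fun p : S1 × S1 =>
    (p.1 + (((j : ℕ) / d : ℝ) : S1), p.2 + (((π j : ℕ) / d : ℝ) : S1))) (by fun_prop) hmem
    fun p hp => hp j

theorem isInvariantLamination_of (hd : 0 < d) (hcl : IsClosedFamily L) (hpts : points ⊆ L)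
    (hun : ∀ l ∈ L, ∀ m ∈ L, ¬ Cross l m) (hfw : ∀ l ∈ L, l.map d ∈ L) (hsib : HasSiblings d L)
    (hbw : ∀ a b, s(a, b) ∈ L → ∃ x y, s(x, y) ∈ L ∧ sigma d x = a ∧ sigma d y = b) :
    IsInvariantLamination d L where
  prelamination := ⟨hun, hpts⟩
  closed := hcl
  invariantWeb :=
    { forward := hfw
      points_subset := hpts
      backward := by
        intro l hl
        induction l using Sym2.ind with | _ a b
        obtain ⟨x, y, hxy, rfl, rfl⟩ := hbw a b hl
        exact ⟨_, hxy, rfl⟩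
      web := by
        intro l hl hcrit
        induction l using Sym2.ind with | _ x y
        by_cases hxy : x = y
        · subst hxy
          refine ⟨fun j => s(x + (((j : ℕ) / d : ℝ) : S1), x + (((j : ℕ) / d : ℝ) : S1)),
            ⟨⟨0, hd⟩, by simp⟩, fun j => hpts rfl, fun j => ?_, fun i j hij => ⟨?_, ?_⟩⟩
          · change s(sigma d _, sigma d _) = s(sigma d x, sigma d x)
            rw [sigma_add_div hd]
          · intro z hz hz'
            simp only [Sym2.mem_iff, or_self] at hz hz'
            exact hij (fin_add_div_injective hd x (hz.symm.trans hz'))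
          · exact not_cross_diag_left _ _
        · have hσ : sigma d x ≠ sigma d y := fun h => hcrit ⟨hxy, h⟩
          obtain ⟨π, hπ, ⟨j₀, hj₀, hπ₀⟩, H⟩ := hsib x y hl hσ
          refine ⟨fun j => s(x + (((j : ℕ) / d : ℝ) : S1), y + (((π j : ℕ) / d : ℝ) : S1)),
            ⟨j₀, by simp [hj₀, hπ₀]⟩, H, fun j => ?_, fun i j hij => ⟨?_, hun _ (H i) _ (H j)⟩⟩
          · change s(sigma d _, sigma d _) = s(sigma d x, sigma d y)
            rw [sigma_add_div hd, sigma_add_div hd]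
          · intro z hz hz'
            rcases Sym2.mem_iff.1 hz with rfl | rfl <;> rcases Sym2.mem_iff.1 hz' with h | h
            · exact hij (fin_add_div_injective hd x h)
            · have := congrArg (sigma d) h
              rw [sigma_add_div hd, sigma_add_div hd] at this
              exact hσ this
            · have := congrArg (sigma d) h
              rw [sigma_add_div hd, sigma_add_div hd] at this
              exact hσ this.symm
            · exact hij (hπ (fin_add_div_injective hd y h)) }

end Closure

/-! ### Properness of the closure -/

theorem eventually_ang_lt {x w : S1} (hw : w ≠ x) {ε : ℝ} (hε : 0 < ε) :
    ∀ᶠ u in 𝓝 w, |ang x u - ang x w| < ε := by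
  have hne : ((0 : ℝ) : S1) ≠ w - x := by
    intro h
    exact hw (sub_eq_zero.1 (h.symm.trans (AddCircle.coe_zero _)))
  have h1 : ContinuousAt (fun u => AddCircle.equivIco (1 : ℝ) 0 (u - x)) w :=
    ContinuousAt.comp (f := fun u => u - x) (AddCircle.continuousAt_equivIco (1 : ℝ) 0 hne.symm)
      (by fun_prop)
  have h2 : ContinuousAt (ang x) w := continuous_subtype_val.continuousAt.comp h1
  exact Metric.tendsto_nhds.1 h2 ε hε

theorem eventually_ang_self (x : S1) {ε : ℝ} (hε : 0 < ε) :
    ∀ᶠ u in 𝓝 x, ang x u < ε ∨ 1 - ε < ang x u := by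
  have ho : IsOpenMap (fun t : ℝ => x + (t : S1)) :=
    (isOpenMap_add_left x).comp QuotientAddGroup.isOpenMap_coe
  have hm : (fun t : ℝ => x + (t : S1)) '' Set.Ioo (-min ε 1) (min ε 1) ∈ 𝓝 x := by
    refine (ho _ isOpen_Ioo).mem_nhds ⟨0, ?_, by simp⟩
    have : 0 < min ε 1 := lt_min hε one_pos
    exact ⟨by linarith, this⟩
  filter_upwards [hm]
  rintro _ ⟨t, ⟨ht1, ht2⟩, rfl⟩
  have h1 := min_le_left ε 1
  have h2 := min_le_right ε 1
  rcases le_or_gt 0 t with h | h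
  · left
    change ang x (x + (t : S1)) < ε
    rw [ang_add_coe x h (by linarith)]; linarith
  · right
    change 1 - ε < ang x (x + (t : S1))
    rw [ang_eq_of (t := t + 1) (by linarith) (by linarith)
      (by rw [AddCircle.coe_add, coe_one, add_zero])]
    linarith

/-- The coordinate of the image of `u` when `u` is close to `w`. -/
theorem ang_sigma_eq {D : ℕ} {x w u : S1} {t : ℝ} (k : ℤ)
    (ht : t = ang x (sigma D w) + D * (ang x u - ang x w) + k) (h0 : 0 ≤ t) (h1 : t < 1) :
    ang x (sigma D u) = t := by
  refine ang_eq_of h0 h1 ?_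
  have e : u = w + ((ang x u - ang x w : ℝ) : S1) := by
    rw [AddCircle.coe_sub, coe_ang, coe_ang]; abel
  have hk : ((k : ℝ) : S1) = 0 := by
    simp
  have e2 : sigma D u = sigma D w + ((D * (ang x u - ang x w) : ℝ) : S1) := by
    conv_lhs => rw [e]
    rw [sigma_add_coe]
  rw [e2, ht, AddCircle.coe_add, AddCircle.coe_add, coe_ang, hk]
  abel

/-- If `y` is not fixed, the closure contains both `xy` and the chord from `x` to `σ_D y`. Take `ab`
in `L` close to `xy`; then `a ≠ x`, as `x` is fixed. Say `a` lies just after `x`; so does its image.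
If `σ_D y` comes before `y`, then `ab` crosses the chord from `x` to `σ_D y`. If it comes after `y`,
the image of `ab` crosses `xy`. If `σ_D y = x`, either the image of `b` falls just before `x` and
the image of `ab` crosses `xy`, or `b = y` and the image of `ab` is a nondegenerate chord of `L`
ending at the fixed point `x`. -/
theorem sigma_eq_self_of_mem_closureFamily {D : ℕ} (hD : 2 ≤ D) {L : Set Chord}
    (hun : ∀ l ∈ L, ∀ m ∈ L, ¬ Cross l m) (hfw : ∀ l ∈ L, l.map D ∈ L)
    (hper : ∀ a b, s(a, b) ∈ L → a ≠ b → sigma D a ≠ a) {x y : S1} (hx : sigma D x = x)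
    (hxy : s(x, y) ∈ closureFamily L) : sigma D y = y := by
  by_contra hy
  have hyx : y ≠ x := fun h => hy (h ▸ hx)
  have hun' := not_cross_closureFamily hun
  have hxfy : s(x, sigma D y) ∈ closureFamily L := by
    have := forward_closureFamily hfw _ hxy
    change s(sigma D x, sigma D y) ∈ _ at this
    rwa [hx] at this
  have hD' : (2 : ℝ) ≤ D := by exact_mod_cast hD
  have hη0 := ang_pos.2 hyx
  have hη1 := ang_lt_one x y
  set η := ang x y with hη
  have hζ1 := ang_lt_one x (sigma D y)
  have hζ0 := ang_nonneg x (sigma D y)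
  have hζη : ang x (sigma D y) ≠ η := fun h => hy (ang_inj h)
  set ζ := ang x (sigma D y) with hζ
  -- If `b` is within `ε / D` of `y`, its image is within `ε` of `σ_D y`; the bounds keep both away
  -- from `x` and from each other. For `ζ = 0`, that is `σ_D y = x`, no distance between `σ_D y` and
  -- `x` can be required.
  obtain ⟨ε, hε, h1, h2, h3, h4⟩ : ∃ ε > 0, ε < η ∧ ε < 1 - η ∧ ε < |ζ - η| ∧
      (ζ ≠ 0 → ε < ζ ∧ ε < 1 - ζ) := by
    have hp : 0 < |ζ - η| := abs_pos.2 (sub_ne_zero.2 hζη)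
    have hm : 0 < min (min η (1 - η)) (min |ζ - η| (if ζ = 0 then 1 else min ζ (1 - ζ))) := by
      refine lt_min (lt_min hη0 (by linarith)) (lt_min hp ?_)
      split_ifs with h
      · exact one_pos
      · exact lt_min (lt_of_le_of_ne hζ0 (Ne.symm h)) (by linarith)
    obtain ⟨ε, h0, hε⟩ := exists_between hm
    simp only [lt_min_iff] at hε
    refine ⟨ε, h0, hε.1.1, hε.1.2, hε.2.1, fun h => ?_⟩
    have := hε.2.2
    rw [if_neg h, lt_min_iff] at this
    exact this
  have hDpos : (0 : ℝ) < D := by linarith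
  have hδ : 0 < ε / D := by positivity
  have hDδ : D * (ε / D) = ε := by field_simp
  have hδε : ε / D ≤ ε / 2 := by gcongr
  obtain ⟨⟨a, b⟩, ⟨ha, hb⟩, hab⟩ : ∃ p : S1 × S1, ((ang x p.1 < ε / D ∨ 1 - ε / D < ang x p.1) ∧
      |ang x p.2 - η| < ε / D) ∧ s(p.1, p.2) ∈ L := by
    have := mem_closure_iff_frequently.1 (mem_closureFamily.1 hxy)
    have h := this.and_eventually
      (Filter.Eventually.prodMk_nhds (eventually_ang_self x hδ) (eventually_ang_lt hyx hδ))
    obtain ⟨p, hp, hp'⟩ := h.exists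
    exact ⟨p, hp', hp⟩
  simp only at ha hb hab
  rw [abs_lt] at hb
  generalize ε / D = δ at *
  have hab' := subset_closureFamily hab
  have hfab : s(sigma D a, sigma D b) ∈ L := hfw _ hab
  have hfab' := subset_closureFamily hfab
  have hne : a ≠ b := by
    rintro rfl
    rcases ha with ha | ha <;> linarith
  have hax : a ≠ x := fun h => hper a b hab hne (h ▸ hx)
  have hα0 := ang_pos.2 hax
  have c1 := hun' _ hab' _ hxy
  have c2 := hun' _ hab' _ hxfy
  have c3 := hun' _ hfab' _ hxy
  rw [cross_iff_base x, ang_self] at c1 c2 c3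
  rw [← hη] at c1 c3
  rw [← hζ] at c2
  set α := ang x a
  set β := ang x b
  have hβ1 : D * (β - η) < ε := by rw [← hDδ]; gcongr; linarith
  have hβ2 : -ε < D * (β - η) := by
    rw [← hDδ, ← mul_neg]; gcongr; linarith
  have hfb : ζ ≠ 0 → ang x (sigma D b) = ζ + D * (β - η) := fun h =>
    ang_sigma_eq (w := y) 0 (by simp [hζ, hη, β]) (by linarith [(h4 h).1])
      (by linarith [(h4 h).2])
  have hfx : ang x (sigma D x) = 0 := by rw [hx, ang_self]
  have hbz : ζ = 0 → sigma D y = x := fun h => ang_eq_zero.1 h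
  rcases ha with ha | ha
  · have hDα : D * α < ε := by rw [← hDδ]; gcongr
    have hDα0 : 0 < D * α := by positivity
    have hfa : ang x (sigma D a) = D * α :=
      ang_sigma_eq (w := x) 0 (by simp [hfx, ang_self, α]) (by linarith) (by linarith)
    have hβη : β ≤ η := by grind
    rw [hfa] at c3
    rcases eq_or_ne ζ 0 with hz | hz
    · rcases hβη.lt_or_eq with hlt | heq
      · have hneg : D * (β - η) < 0 := mul_neg_of_pos_of_neg hDpos (by linarith)
        have : ang x (sigma D b) = 1 + D * (β - η) :=
          ang_sigma_eq (w := y) 1 (by rw [← hζ, hz]; simp [hη, β]; ring) (by linarith)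
            (by linarith)
        rw [this] at c3
        grind
      · have hby : b = y := ang_inj heq
        rw [hby, hbz hz] at hfab
        rw [Sym2.eq_swap] at hfab
        refine hper _ _ hfab ?_ hx
        intro h
        rw [← h, ang_self] at hfa
        linarith
    · rw [hfb hz] at c3
      have := h4 hz
      rcases lt_abs.1 h3 with h | h
      · grind
      · grind
  -- The mirror image: `a` lies just before `x`, with coordinate close to `1`.
  · have e : D * (α - 1) = - (D * (1 - α)) := by ring
    have hα1 : α < 1 := ang_lt_one x a
    have hDα : -ε < D * (α - 1) := by
      rw [← hDδ, ← mul_neg]; gcongr; linarith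
    have hDα0 : D * (α - 1) < 0 := mul_neg_of_pos_of_neg hDpos (by linarith)
    have hfa : ang x (sigma D a) = 1 + D * (α - 1) :=
      ang_sigma_eq (w := x) (1 - D) (by simp [hfx, ang_self, α]; ring) (by linarith)
        (by linarith)
    have hβη : η ≤ β := by grind
    rw [hfa] at c3
    rcases eq_or_ne ζ 0 with hz | hz
    · rcases hβη.lt_or_eq with hlt | heq
      · have hneg : 0 < D * (β - η) := mul_pos hDpos (by linarith)
        have : ang x (sigma D b) = D * (β - η) :=
          ang_sigma_eq (w := y) 0 (by rw [← hζ, hz]; simp [hη, β]) (by linarith)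
            (by linarith)
        rw [this] at c3
        grind
      · have hby : b = y := ang_inj heq.symm
        rw [hby, hbz hz] at hfab
        rw [Sym2.eq_swap] at hfab
        refine hper _ _ hfab ?_ hx
        intro h
        rw [← h, ang_self] at hfa
        linarith
    · rw [hfb hz] at c3
      have := h4 hz
      rcases lt_abs.1 h3 with h | h
      · grind
      · grind

theorem iterate_map_mem {d : ℕ} {L : Set Chord} (h : ∀ l ∈ L, l.map d ∈ L) (k : ℕ) :
    ∀ l ∈ L, l.map (d ^ k) ∈ L := by
  intro l hl
  induction k with
  | zero => 
    induction l using Sym2.ind with | _ x y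
    simpa [Chord.map, sigma] using hl
  | succ k ih =>
    have := h _ ih
    induction l using Sym2.ind with | _ x y
    change s(sigma _ x, sigma _ y) ∈ L
    change s(sigma d (sigma _ x), sigma d (sigma _ y)) ∈ L at this
    rw [← sigma_iterate, Function.iterate_succ_apply', Function.iterate_succ_apply',
      sigma_iterate]
    exact this

/-- Periodic points are only joined to points of the same period. -/
theorem minimalPeriod_eq_of_mem_closureFamily {d : ℕ} (hd : 2 ≤ d) {L : Set Chord}
    (hun : ∀ l ∈ L, ∀ m ∈ L, ¬ Cross l m) (hfw : ∀ l ∈ L, l.map d ∈ L)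
    (hper : ∀ a b, s(a, b) ∈ L → a ≠ b → a ∉ Function.periodicPts (sigma d)) {x y : S1}
    (hx : x ∈ Function.periodicPts (sigma d)) (hxy : s(x, y) ∈ closureFamily L) :
    Function.minimalPeriod (sigma d) y = Function.minimalPeriod (sigma d) x := by
  have key : ∀ u v : S1, s(u, v) ∈ closureFamily L → ∀ n, 0 < n →
      Function.IsPeriodicPt (sigma d) n u → Function.IsPeriodicPt (sigma d) n v := by
    intro u v huv n hn hu
    unfold Function.IsPeriodicPt Function.IsFixedPt at hu ⊢
    rw [sigma_iterate] at hu ⊢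
    refine sigma_eq_self_of_mem_closureFamily (le_trans hd (Nat.le_self_pow hn.ne' d)) hun
      (iterate_map_mem hfw n) (fun a b hab hne h => hper a b hab hne ⟨n, hn, ?_⟩) hu huv
    rw [← sigma_iterate] at h
    exact h
  have hpos := Function.minimalPeriod_pos_of_mem_periodicPts hx
  have h1 := key x y hxy _ hpos (Function.isPeriodicPt_minimalPeriod _ _)
  have hposy := Function.minimalPeriod_pos_of_mem_periodicPts (Function.mk_mem_periodicPts hpos h1)
  have h2 := key y x (by rwa [Sym2.eq_swap]) _ hposy (Function.isPeriodicPt_minimalPeriod _ _)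
  exact Nat.dvd_antisymm h1.minimalPeriod_dvd h2.minimalPeriod_dvd

theorem isProperChord_of {d : ℕ} {L : Set Chord} (hfw : ∀ l ∈ L, l.map d ∈ L)
    (h : ∀ x y, x ∈ Function.periodicPts (sigma d) → s(x, y) ∈ L →
      Function.minimalPeriod (sigma d) y = Function.minimalPeriod (sigma d) x) :
    ∀ l ∈ L, IsProperChord d l := by
  rintro l hl k n x y he ⟨hn, hx⟩
  have hmem : s(x, y) ∈ L := by
    rw [← he]
    clear he
    induction k with
    | zero => exact hl
    | succ k ih => rw [Function.iterate_succ_apply']; exact hfw _ ih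
  exact ⟨hn, (h x y (Function.minimalPeriod_pos_iff_mem_periodicPts.1 (hx ▸ hn)) hmem).trans hx⟩

/-! ### There are no wandering polygons with many vertices -/

section Wandering

variable {d : ℕ} {C : Set Chord}

theorem saturated_arc_of_not_cross {z y : S1} (hz : z ∉ vertices C) (hy : y ∉ vertices C)
    (h : ∀ c ∈ C, ¬ Cross s(z, y) c) : Saturated C (arc z (ang z y)) := by
  rintro u v huv ⟨hu1, hu2⟩
  have hvz : v ≠ z := fun e => hz (e ▸ mem_vertices_right huv)
  have hvy : ang z v ≠ ang z y := fun e => hy (ang_inj e ▸ mem_vertices_right huv)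
  have hv0 := ang_pos.2 hvz
  have := h _ huv
  rw [cross_iff_base z, ang_self] at this
  exact ⟨hv0, by grind⟩

theorem not_cross_trans {z y w : S1} (hy : y ∉ vertices C)
    (h : ∀ c ∈ C, ¬ Cross s(z, y) c) (h' : ∀ c ∈ C, ¬ Cross s(y, w) c) :
    ∀ c ∈ C, ¬ Cross s(z, w) c := by
  intro c hc
  induction c using Sym2.ind with | _ u v
  have hu : ang z u ≠ ang z y := fun e => hy (ang_inj e ▸ mem_vertices_left hc)
  have hv : ang z v ≠ ang z y := fun e => hy (ang_inj e ▸ mem_vertices_right hc)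
  have h1 := h _ hc
  have h2 := h' _ hc
  have := ang_nonneg z u
  have := ang_nonneg z v
  have := ang_nonneg z y
  have := ang_nonneg z w
  rw [cross_iff_base z, ang_self] at h1 ⊢
  rw [cross_iff_base z] at h2
  generalize ang z u = u, ang z v = v, ang z y = y, ang z w = w at *
  grind

/-- An indexed finite set whose forward images are pairwise disjoint and unlinked, and which never
meets or is separated by the critical chords. -/
structure Wandering (d : ℕ) (C : Set Chord) {ι : Type*} (x : ℕ → ι → S1) : Prop where
  map : ∀ k g, x (k + 1) g = sigma d (x k g)
  inj : Function.Injective (x 0)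
  not_mem : ∀ k g, x k g ∉ vertices C
  not_cross_crit : ∀ k g h, ∀ c ∈ C, ¬ Cross s(x k g, x k h) c
  ne : ∀ k j g h, k ≠ j → x k g ≠ x j h
  not_cross : ∀ k j g h g' h', k ≠ j → ¬ Cross s(x k g, x k h) s(x j g', x j h')

namespace Wandering

variable {ι : Type*} {x : ℕ → ι → S1}

theorem saturated (hw : Wandering d C x) (k : ℕ) (g h : ι) :
    Saturated C (arc (x k g) (ang (x k g) (x k h))) :=
  saturated_arc_of_not_cross (hw.not_mem k g) (hw.not_mem k h) (hw.not_cross_crit k g h)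

theorem injective (hw : Wandering d C x) (hC : IsFullCriticalCollection d C) (hd : 0 < d) (k : ℕ) :
    Function.Injective (x k) := by
  induction k with
  | zero => exact hw.inj
  | succ k ih =>
    intro g h e
    by_contra hne
    rw [hw.map, hw.map] at e
    exact hC.sigma_ne hd (hw.not_mem k g) (fun h' => hne (ih h'.symm)) (hw.saturated k g h) e.symm

theorem lt_of_lt (hw : Wandering d C x) (hC : IsFullCriticalCollection d C) (hd : 0 < d) (k : ℕ)
    {g h i : ι} (hlt : ang (x k g) (x k h) < ang (x k g) (x k i)) :
    ang (x (k + 1) g) (x (k + 1) h) < ang (x (k + 1) g) (x (k + 1) i) := by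
  by_cases hgh : h = g
  · subst hgh
    rw [ang_self] at hlt ⊢
    have : i ≠ h := fun e => (ang_pos.1 hlt) (by rw [e])
    exact ang_pos.2 fun e => this (hw.injective hC hd _ e)
  · rw [hw.map, hw.map, hw.map]
    exact hC.sigma_lt hd (hw.not_mem k g) (fun e => hgh (hw.injective hC hd _ e)) hlt
      (hw.saturated k g h) (hw.saturated k g i)

/-! ### Holes of a wandering set -/

/-- `nxt g` is the successor of `g` in the cyclic order of the points of a wandering set. -/
def IsNext (x : ℕ → ι → S1) (nxt : ι → ι) : Prop :=
  ∀ k g, nxt g ≠ g ∧ ∀ h, h ≠ g → ang (x k g) (x k (nxt g)) ≤ ang (x k g) (x k h)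

theorem exists_isNext [Fintype ι] [Nontrivial ι] (hw : Wandering d C x)
    (hC : IsFullCriticalCollection d C) (hd : 0 < d) : ∃ nxt, IsNext x nxt := by
  classical
  have : ∀ g, ∃ n, n ≠ g ∧ ∀ h, h ≠ g → ang (x 0 g) (x 0 n) ≤ ang (x 0 g) (x 0 h) := by
    intro g
    obtain ⟨g', hg'⟩ := exists_ne g
    obtain ⟨n, hn, hmin⟩ := (Finset.univ.erase g).exists_min_image
      (fun h => ang (x 0 g) (x 0 h)) ⟨g', by simp [hg']⟩
    exact ⟨n, by simpa using hn, fun h hh => hmin h (by simp [hh])⟩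
  choose nxt hn using this
  refine ⟨nxt, fun k g => ⟨(hn g).1, ?_⟩⟩
  induction k with
  | zero => exact (hn g).2
  | succ k ih =>
    intro h hh
    rcases (ih h hh).lt_or_eq with hlt | he
    · exact (hw.lt_of_lt hC hd k hlt).le
    · rw [hw.injective hC hd k (ang_inj he)]

variable {nxt : ι → ι}

theorem hole_pos (hw : Wandering d C x) (hC : IsFullCriticalCollection d C) (hd : 0 < d)
    (hn : IsNext x nxt) (k : ℕ) (g : ι) : 0 < ang (x k g) (x k (nxt g)) :=
  ang_pos.2 fun e => (hn k g).1 (hw.injective hC hd k e)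

theorem hole_unique (hn : IsNext x nxt) {k : ℕ} {g g' : ι} {q : S1}
    (hq : q ∈ arc (x k g) (ang (x k g) (x k (nxt g))))
    (hq' : q ∈ arc (x k g') (ang (x k g') (x k (nxt g')))) : g = g' := by
  by_contra hne
  obtain ⟨h1, h2⟩ := hq
  obtain ⟨h3, h4⟩ := hq'
  have h5 := (hn k g).2 g' (Ne.symm hne)
  have h6 := (hn k g').2 g hne
  have := ang_base (x k g) (x k g') q
  have := ang_base (x k g) (x k g') (x k g)
  rw [ang_self] at this
  grind

/-- A hole without critical vertices is expanded. -/
theorem hole_expand (hw : Wandering d C x) (hC : IsFullCriticalCollection d C) (hd : 0 < d)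
    {k : ℕ} {g h : ι}
    (hv : ∀ q ∈ vertices C, q ∉ arc (x k g) (ang (x k g) (x k h))) :
    ang (x (k + 1) g) (x (k + 1) h) = d * ang (x k g) (x k h) := by
  rw [hw.map, hw.map]
  have hd' : (0 : ℝ) < d := by exact_mod_cast hd
  refine ang_sigma_of_lt ?_
  by_contra hcon
  push Not at hcon
  have hlt1 := ang_lt_one (x k g) (x k h)
  have h1d : (1 : ℝ) / d ≤ ang (x k g) (x k h) := by rw [div_le_iff₀ hd']; linarith
  have h1d0 : (0 : ℝ) < 1 / d := by positivity
  -- Were the hole at least `1 / d` long, this point would lie in it or be its end, with the same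
  -- image as `x k g`. A critical chord separating the two would need an endpoint in the hole.
  set u := x k g + ((((1 : ℕ) : ℝ) / d : ℝ) : S1) with hu
  have hau : ang (x k g) u = 1 / d := ang_eq_of h1d0.le (by linarith) (by simp [hu])
  have hσ : sigma d u = sigma d (x k g) := sigma_add_div hd _ 1
  have hux : u ≠ x k g := ang_pos.1 (by rw [hau]; exact h1d0)
  rcases h1d.lt_or_eq with hlt | he
  · have huv : u ∉ vertices C := fun h' => hv u h' ⟨by rw [hau]; exact h1d0, by rw [hau]; exact hlt⟩
    obtain ⟨c, hc, hcr⟩ := hC.exists_cross (hw.not_mem k g) huv hux.symm hσ.symm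
    induction c using Sym2.ind with | _ p q
    have hp := hv p (mem_vertices_left hc)
    have hq := hv q (mem_vertices_right hc)
    rw [cross_iff_base (x k g), ang_self, hau] at hcr
    have := ang_nonneg (x k g) p
    have := ang_nonneg (x k g) q
    simp only [arc, Set.mem_ofPred_eq] at hp hq
    grind
  · have : u = x k h := ang_inj (z := x k g) (hau.trans he)
    exact hC.sigma_ne hd (hw.not_mem k g) hux (this ▸ hw.saturated k g h) hσ

/-- `q` is the first critical vertex in the hole with index `g` at time `t`. -/
def IsFall (C : Set Chord) (x : ℕ → ι → S1) (nxt : ι → ι) (t : ℕ) (g : ι) (q : S1) : Prop :=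
  q ∈ arc (x t g) (ang (x t g) (x t (nxt g))) ∧
    ∀ u ∈ vertices C, ang (x t g) q ≤ ang (x t g) u

/-- By `hole_expand`, a hole can shrink only at a time when it contains a critical vertex. After the
last such time before `K` its length does not decrease. -/
theorem exists_last_fall (hw : Wandering d C x) (hC : IsFullCriticalCollection d C) (hd : 0 < d)
    {c : ℝ} {g : ι} (h0 : c ≤ ang (x 0 g) (x 0 (nxt g))) (K : ℕ)
    (hK : ang (x K g) (x K (nxt g)) < c) : ∃ t < K, ∃ q ∈ vertices C, IsFall C x nxt t g q ∧
      ang (x (t + 1) g) (x (t + 1) (nxt g)) ≤ ang (x K g) (x K (nxt g)) := by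
  induction K with
  | zero => linarith
  | succ K ih =>
    by_cases hv : ∃ q ∈ vertices C, q ∈ arc (x K g) (ang (x K g) (x K (nxt g)))
    · obtain ⟨q₀, hq₀, hq₀'⟩ := hv
      obtain ⟨q, hq, hmin⟩ := (hC.1.finite_vertices hd).exists_minimalFor (ang (x K g)) _ ⟨q₀, hq₀⟩
      have hmin' : ∀ u ∈ vertices C, ang (x K g) q ≤ ang (x K g) u := fun u hu => by
        by_contra hcon
        push Not at hcon
        exact absurd (hmin hu hcon.le) (by linarith)
      refine ⟨K, K.lt_succ_self, q, hq, ⟨⟨ang_pos.2 fun e => hw.not_mem K g (e ▸ hq), ?_⟩, hmin'⟩,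
        le_rfl⟩
      exact (hmin' q₀ hq₀).trans_lt hq₀'.2
    · push Not at hv
      have he := hw.hole_expand hC hd hv
      have hle : ang (x K g) (x K (nxt g)) ≤ ang (x (K + 1) g) (x (K + 1) (nxt g)) := by
        rw [he]
        exact le_mul_of_one_le_left (ang_nonneg _ _) (by exact_mod_cast hd)
      obtain ⟨t, ht, q, hq, h1, h2⟩ := ih (hle.trans_lt hK)
      exact ⟨t, ht.trans K.lt_succ_self, q, hq, h1, h2.trans hle⟩

theorem forall_mem_hole (hw : Wandering d C x) {t t' : ℕ} (htt : t ≠ t') {g h₀ : ι}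
    (h0 : x t' h₀ ∈ arc (x t g) (ang (x t g) (x t (nxt g)))) (h : ι) :
    x t' h ∈ arc (x t g) (ang (x t g) (x t (nxt g))) := by
  have h1 := ang_pos.2 (hw.ne t t' g h htt).symm
  have h2 : ang (x t g) (x t' h) ≠ ang (x t g) (x t (nxt g)) := fun e =>
    hw.ne t t' _ h htt (ang_inj e).symm
  have := hw.not_cross t t' g (nxt g) h₀ h htt
  rw [cross_iff_base (x t g), ang_self] at this
  obtain ⟨h3, h4⟩ := h0
  exact ⟨h1, by grind⟩

/-- Both base points see `q` as their first critical vertex, so no critical chord separates them.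
The whole set at time `t'` is therefore unseparated from `x t g`, and monotonicity of `σ_d` keeps
its image in the image hole. -/
theorem image_mem_hole (hw : Wandering d C x) (hC : IsFullCriticalCollection d C) (hd : 0 < d)
    {t t' : ℕ} (htt : t ≠ t') {g g' : ι} {q : S1}
    (hq : ∀ u ∈ vertices C, ang (x t g) q ≤ ang (x t g) u)
    (hq' : ∀ u ∈ vertices C, ang (x t' g') q ≤ ang (x t' g') u)
    (hin : ∀ h, x t' h ∈ arc (x t g) (ang (x t g) (x t (nxt g)))) (h : ι) :
    x (t' + 1) h ∈ arc (x (t + 1) g) (ang (x (t + 1) g) (x (t + 1) (nxt g))) := by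
  have hss : ∀ c ∈ C, ¬ Cross s(x t g, x t' g') c := by
    have key : ∀ u v, s(u, v) ∈ C → 0 < ang (x t g) u → ang (x t g) u < ang (x t g) (x t' g') →
        ang (x t g) (x t' g') < ang (x t g) v → False := by
      intro u v huv h1 h2 h3
      have h4 := hq u (mem_vertices_left huv)
      have h5 := hq' v (mem_vertices_right huv)
      have := ang_base (x t g) (x t' g') q
      have := ang_base (x t g) (x t' g') v
      have := ang_nonneg (x t g) q
      have := ang_lt_one (x t g) v
      grind
    intro c hc hcr
    induction c using Sym2.ind with | _ u v
    have hc' : s(v, u) ∈ C := by rwa [Sym2.eq_swap]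
    have h1 := key u v hc
    have h2 := key v u hc'
    have := ang_nonneg (x t g) u
    have := ang_nonneg (x t g) v
    rw [cross_iff_base (x t g), ang_self] at hcr
    grind
  have hS := saturated_arc_of_not_cross (hw.not_mem t g) (hw.not_mem t' h)
    (not_cross_trans (hw.not_mem t' g') hss (hw.not_cross_crit t' g' h))
  have hne := (hw.ne t t' g h htt).symm
  rw [hw.map, hw.map, hw.map]
  exact ⟨ang_pos.2 (hC.sigma_ne hd (hw.not_mem t g) hne hS),
    hC.sigma_lt hd (hw.not_mem t g) hne (hin h).2 hS (hw.saturated t g (nxt g))⟩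

/-- Two falls at different times with the same first critical vertex are nested. -/
theorem nested_of_isFall (hw : Wandering d C x) (hC : IsFullCriticalCollection d C) (hd : 0 < d)
    {t t' : ℕ} (htt : t ≠ t') {g g' : ι} {q : S1} (hq : IsFall C x nxt t g q)
    (hq' : IsFall C x nxt t' g' q) :
    (∀ h, x (t' + 1) h ∈ arc (x (t + 1) g) (ang (x (t + 1) g) (x (t + 1) (nxt g)))) ∨
      ∀ h, x (t + 1) h ∈ arc (x (t' + 1) g') (ang (x (t' + 1) g') (x (t' + 1) (nxt g'))) := by
  by_cases hex : ∃ h₀, x t' h₀ ∈ arc (x t g) (ang (x t g) (x t (nxt g)))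
  · obtain ⟨h₀, h0⟩ := hex
    exact Or.inl (hw.image_mem_hole hC hd htt hq.2 hq'.2 (hw.forall_mem_hole htt h0))
  · push Not at hex
    refine Or.inr (hw.image_mem_hole hC hd htt.symm hq'.2 hq.2
      (hw.forall_mem_hole (h₀ := g) htt.symm ?_))
    -- Both holes contain `q`. As the hole at time `t` contains no point of the other set, the hole
    -- at time `t'` must contain its starting point.
    have h1 := hex g'
    have h2 := hex (nxt g')
    have h3 := ang_pos.2 (hw.ne t t' g g' htt).symm
    have h4 := ang_pos.2 (hw.ne t t' g (nxt g') htt).symm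
    obtain ⟨⟨h5, h6⟩, -⟩ := hq
    obtain ⟨⟨h7, h8⟩, -⟩ := hq'
    simp only [arc, Set.mem_ofPred_eq] at h1 h2 ⊢
    have := ang_base (x t g) (x t' g') q
    have := ang_base (x t g) (x t' g') (x t' (nxt g'))
    have := ang_base (x t g) (x t' g') (x t g)
    rw [ang_self] at this
    have hlt := ang_lt_one (x t g) (x t' g')
    clear hex
    grind

/-- In a short arc only one hole is long. -/
theorem eq_of_long (hn : IsNext x nxt) {k : ℕ} {z : S1} {l : ℝ}
    (hin : ∀ h, x k h ∈ arc z l) {g g' : ι} (hg : l ≤ ang (x k g) (x k (nxt g)))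
    (hg' : l ≤ ang (x k g') (x k (nxt g'))) : g = g' := by
  by_contra hne
  have h1 := hin g
  have h2 := hin g'
  have h3 := hin (nxt g)
  have h4 := hin (nxt g')
  have h5 := (hn k g).2 g' (Ne.symm hne)
  have h6 := (hn k g').2 g hne
  simp only [arc, Set.mem_ofPred_eq] at h1 h2 h3 h4
  have := ang_base z (x k g) (x k g')
  have := ang_base z (x k g') (x k g)
  grind

/-- The hole containing the complement of the arc is longer than one half, so a shorter hole lies
inside the arc. -/
theorem lt_of_short {k : ℕ} {z : S1} {l : ℝ}
    (hin : ∀ h, x k h ∈ arc z l) (hl : l ≤ 1 / 2) {g : ι}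
    (hg : ang (x k g) (x k (nxt g)) < 1 / 2) : ang (x k g) (x k (nxt g)) < l := by
  have h1 := hin g
  have h3 := hin (nxt g)
  simp only [arc, Set.mem_ofPred_eq] at h1 h3
  have := ang_base z (x k g) (x k (nxt g))
  grind

/-- Descent on the times with at most two long holes. At such a time more holes are short than there
are critical vertices, so two of them had their last fall at the same first vertex. These falls
happen at different times and are nested: at an earlier time, or at `K` itself, the whole set sits
in an arc shorter than `c`, which leaves room for one long hole only. -/
theorem exists_earlier [Fintype ι] (hw : Wandering d C x) (hC : IsFullCriticalCollection d C)
    (hd : 0 < d) (hn : IsNext x nxt) (hcard : (vertices C).ncard + 3 ≤ Fintype.card ι) {c : ℝ}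
    (hc : c ≤ 1 / 2) (h0 : ∀ g, c ≤ ang (x 0 g) (x 0 (nxt g))) {K : ℕ}
    (hK : (Finset.univ.filter fun g => c ≤ ang (x K g) (x K (nxt g))).card ≤ 2) :
    ∃ k < K, (Finset.univ.filter fun g => c ≤ ang (x k g) (x k (nxt g))).card ≤ 2 := by
  classical
  have hfin := hC.1.finite_vertices hd
  have hfew : ∀ k z l, (∀ h, x k h ∈ arc z l) → l ≤ c →
      (Finset.univ.filter fun g => c ≤ ang (x k g) (x k (nxt g))).card ≤ 2 := by
    intro k z l hin hl
    refine le_trans (Finset.card_le_one.2 fun g hg g' hg' => ?_) one_le_two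
    simp only [Finset.mem_filter, Finset.mem_univ, true_and] at hg hg'
    exact eq_of_long hn hin (hl.trans hg) (hl.trans hg')
  have hex : ∀ g, ang (x K g) (x K (nxt g)) < c → ∃ t < K, ∃ q ∈ vertices C,
      IsFall C x nxt t g q ∧
        ang (x (t + 1) g) (x (t + 1) (nxt g)) ≤ ang (x K g) (x K (nxt g)) :=
    fun g hg => hw.exists_last_fall hC hd (h0 g) K hg
  choose! t ht q hq hfall hle using hex
  set S := Finset.univ.filter fun g => ang (x K g) (x K (nxt g)) < c with hS
  have hScard : hfin.toFinset.card < S.card := by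
    have h1 := Finset.card_filter_add_card_filter_not (s := (Finset.univ : Finset ι))
      (fun g => c ≤ ang (x K g) (x K (nxt g)))
    simp only [not_le] at h1
    rw [Finset.card_univ] at h1
    have h2 := Set.ncard_eq_toFinset_card _ hfin
    rw [← hS] at h1
    omega
  obtain ⟨g, hg, g', hg', hne, hqq⟩ := Finset.exists_ne_map_eq_of_card_lt_of_maps_to hScard
    (f := q) (fun g hg => by simpa using hq g (by simpa [hS] using hg))
  simp only [hS, Finset.mem_filter, Finset.mem_univ, true_and] at hg hg'
  have main : ∀ g g', ang (x K g) (x K (nxt g)) < c → ang (x K g') (x K (nxt g')) < c →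
      t g < t g' → q g = q g' →
      ∃ k < K, (Finset.univ.filter fun g => c ≤ ang (x k g) (x k (nxt g))).card ≤ 2 := by
    intro g g' hg hg' hlt hqq
    have h1 := hle g hg
    have h2 := hle g' hg'
    have h3 := ht g' hg'
    rcases hw.nested_of_isFall hC hd hlt.ne (hfall g hg) (hqq ▸ hfall g' hg') with hin | hin
    · rcases (Nat.succ_le_of_lt h3).lt_or_eq with hK' | hK'
      · exact ⟨t g' + 1, hK', hfew _ _ _ hin (by linarith)⟩
      -- If the nested set is the one at time `K`, its short hole `g` lies in the arc left by its
      -- own fall and is strictly shorter than it, against the choice of the last fall.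
      · have hK'' : t g' + 1 = K := hK'
        rw [hK''] at hin
        have := lt_of_short (nxt := nxt) hin (by linarith) (g := g) (by linarith)
        linarith
    · exact ⟨t g + 1, by omega, hfew _ _ _ hin (by linarith)⟩
  rcases lt_trichotomy (t g) (t g') with h | h | h
  · exact main g g' hg hg' h hqq
  -- At a single time the holes are disjoint, so only one of them contains `q`.
  · refine absurd (hole_unique hn (hfall g hg).1 ?_) hne
    rw [h, hqq]
    exact (hfall g' hg').1
  · exact main g' g hg' hg h hqq.symm

theorem norm_sub_ge {a b : S1} {c : ℝ} (hab : c ≤ ang a b) (hba : c ≤ ang b a) (hne : a ≠ b) :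
    c ≤ ‖b - a‖ := by
  have h0 := ang_pos.2 hne.symm
  have h1 := ang_lt_one a b
  have h2 := ang_base a b a
  rw [ang_self] at h2
  have h3 : ang b a = 1 - ang a b := by grind
  rw [← coe_ang a b, UnitAddCircle.norm_eq, abs_sub_round_eq_min, Int.fract_eq_self.2 ⟨h0.le, h1⟩]
  exact le_min hab (by linarith)

/-- If three holes were long at every time, three points would stay `c` apart. Near a cluster point
of the configurations, the sets at two different times come close to the same three points, and
hence cross. -/
theorem exists_few [Fintype ι] (hw : Wandering d C x) (hC : IsFullCriticalCollection d C)
    (hd : 0 < d) (hn : IsNext x nxt) {c : ℝ} (hc : 0 < c) :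
    ∃ K, (Finset.univ.filter fun g => c ≤ ang (x K g) (x K (nxt g))).card ≤ 2 := by
  by_contra hno
  push Not at hno
  set S : Set (ι → S1) := ⋃ p : ι × ι × ι, {X | c ≤ ‖X p.2.1 - X p.1‖ ∧ c ≤ ‖X p.2.2 - X p.1‖ ∧
    c ≤ ‖X p.2.2 - X p.2.1‖} with hS
  have hSc : IsClosed S := by
    refine isClosed_iUnion_of_finite fun p => ?_
    have key : ∀ i j : ι, IsClosed {X : ι → S1 | c ≤ ‖X i - X j‖} := fun i j =>
      isClosed_le continuous_const (by fun_prop)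
    exact (key _ _).inter ((key _ _).inter (key _ _))
  have hmem : ∀ k, x k ∈ S := by
    intro k
    obtain ⟨g, hg, g', hg', g'', hg'', h1, h2, h3⟩ := Finset.two_lt_card.1 (hno k)
    simp only [Finset.mem_filter, Finset.mem_univ, true_and] at hg hg' hg''
    have key : ∀ g g', g ≠ g' → c ≤ ang (x k g) (x k (nxt g)) → c ≤ ang (x k g') (x k (nxt g')) →
        c ≤ ‖x k g' - x k g‖ := fun g g' hne hg hg' =>
      norm_sub_ge (hg.trans ((hn k g).2 _ hne.symm)) (hg'.trans ((hn k g').2 _ hne))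
        fun e => hne (hw.injective hC hd k e)
    exact Set.mem_iUnion.2 ⟨(g, g', g''), key _ _ h1 hg hg', key _ _ h2 hg hg'',
      key _ _ h3 hg' hg''⟩
  obtain ⟨X, hX, hcl⟩ := hSc.isCompact.exists_mapClusterPt (f := Filter.atTop) (u := x)
    (Filter.le_principal_iff.2 (Filter.mem_map.2 (Filter.univ_mem' hmem)))
  obtain ⟨⟨g, g', g''⟩, h1, h2, h3⟩ := Set.mem_iUnion.1 hX
  have hne : ∀ a b : S1, c ≤ ‖b - a‖ → a ≠ b := by
    rintro a _ h rfl
    rw [sub_self, norm_zero] at h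
    linarith
  obtain ⟨U, hU, V, hV, W, hW, H⟩ := exists_nhds_cross (hne _ _ h1) (hne _ _ h2) (hne _ _ h3)
  have hfreq : ∃ᶠ k in Filter.atTop, x k g ∈ U ∧ x k g' ∈ V ∧ x k g'' ∈ W := by
    refine hcl.frequently (p := fun Y => Y g ∈ U ∧ Y g' ∈ V ∧ Y g'' ∈ W) ?_
    filter_upwards [(continuous_apply g).continuousAt.preimage_mem_nhds hU,
      (continuous_apply g').continuousAt.preimage_mem_nhds hV,
      (continuous_apply g'').continuousAt.preimage_mem_nhds hW] with Y h1 h2 h3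
    exact ⟨h1, h2, h3⟩
  obtain ⟨k, hk⟩ := hfreq.exists
  obtain ⟨j, hj, hkj⟩ := (hfreq.and_eventually (Filter.eventually_gt_atTop k)).exists
  rcases H _ hk.1 _ hj.1 _ hk.2.1 _ hj.2.1 _ hk.2.2 _ hj.2.2 (hw.ne k j g g hkj.ne) with h | h
  · exact hw.not_cross k j _ _ _ _ hkj.ne h
  · exact hw.not_cross k j _ _ _ _ hkj.ne h

/-- The number of points of a wandering set is bounded. -/
theorem card_lt [Fintype ι] (hw : Wandering d C x) (hC : IsFullCriticalCollection d C)
    (hd : 0 < d) : Fintype.card ι < (vertices C).ncard + 3 := by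
  by_contra hcard
  push Not at hcard
  have : Nontrivial ι := Fintype.one_lt_card_iff_nontrivial.1 (by omega)
  obtain ⟨nxt, hn⟩ := hw.exists_isNext hC hd
  obtain ⟨c, hc, hc'⟩ := exists_pos_lt_of_finite (Set.finite_univ (α := ι))
    (fun g => ang (x 0 g) (x 0 (nxt g))) fun g _ => hw.hole_pos hC hd hn 0 g
  have h0 : ∀ g, min c (1 / 2) ≤ ang (x 0 g) (x 0 (nxt g)) := fun g =>
    (min_le_left _ _).trans (hc' g trivial).le
  obtain ⟨K, hK⟩ := hw.exists_few hC hd hn (c := min c (1 / 2)) (lt_min hc (by norm_num))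
  induction K using Nat.strong_induction_on with
  | _ K ih =>
    obtain ⟨k, hk, hk'⟩ := hw.exists_earlier hC hd hn hcard (min_le_right _ _) h0 hK
    exact ih k hk hk'

end Wandering

end Wandering

/-! ### Concatenations of chords -/

section Paths

variable {d : ℕ} {L : Set Chord}

theorem chainEquiv_of_path {c : ℕ → S1} {a b : ℕ}
    (h : ∀ j, a ≤ j → j < b → s(c j, c (j + 1)) ∈ L) {i : ℕ} (hai : a ≤ i) (hib : i ≤ b) :
    chainEquiv L (c a) (c i) := by
  induction i, hai using Nat.le_induction with
  | base => exact (chainEquiv L).refl _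
  | succ i hi ih =>
    exact (chainEquiv L).trans (ih (by omega)) (chainEquiv_of_mem (h i hi (by omega)))

/-- An infinite injective path of unlinked chords has finitely many cluster points. -/
theorem finite_mapClusterPt_of_path (hun : ∀ l ∈ L, ∀ m ∈ L, ¬ Cross l m) {c : ℕ → S1}
    (hc : Function.Injective c) (hL : ∀ j, s(c j, c (j + 1)) ∈ L) :
    {p | MapClusterPt p Filter.atTop c}.Finite := by
  by_contra hinf
  obtain ⟨t, ht, hcard⟩ := Set.Infinite.exists_subset_card_eq hinf 3
  obtain ⟨p, q, w, h1, h2, h3, rfl⟩ := Finset.card_eq_three.1 hcard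
  obtain ⟨U, hU, V, hV, W, hW, H⟩ := exists_nhds_cross h1 h2 h3
  have fr : ∀ {u : S1} {O : Set S1}, u ∈ ({p, q, w} : Finset S1) → O ∈ 𝓝 u →
      ∀ n, ∃ j > n, c j ∈ O :=
    fun {u O} hu hO n => by
      have hcl : MapClusterPt u Filter.atTop c := ht hu
      obtain ⟨j, hj, hn⟩ := ((hcl.frequently (p := (· ∈ O)) hO).and_eventually
        (Filter.eventually_gt_atTop n)).exists
      exact ⟨j, hn, hj⟩
  have hits : ∀ n, ∃ b, ∃ i₁ i₂ i₃, n ≤ i₁ ∧ i₁ ≤ b ∧ n ≤ i₂ ∧ i₂ ≤ b ∧ n ≤ i₃ ∧ i₃ ≤ b ∧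
      c i₁ ∈ U ∧ c i₂ ∈ V ∧ c i₃ ∈ W := by
    intro n
    obtain ⟨i₁, g1, g1'⟩ := fr (by simp) hU n
    obtain ⟨i₂, g2, g2'⟩ := fr (by simp) hV n
    obtain ⟨i₃, g3, g3'⟩ := fr (by simp) hW n
    exact ⟨i₁ + i₂ + i₃, i₁, i₂, i₃, by omega, by omega, by omega, by omega, by omega, by omega,
      g1', g2', g3'⟩
  let M : ℕ → ℕ → Set Chord := fun a b => {l | ∃ j, a ≤ j ∧ j < b ∧ l = s(c j, c (j + 1))}
  have hMM : ∀ a b a' b', ∀ l ∈ M a b, ∀ m ∈ M a' b', ¬ Cross l m := by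
    rintro a b a' b' _ ⟨j, -, -, rfl⟩ _ ⟨j', -, -, rfl⟩
    exact hun _ (hL j) _ (hL j')
  have hMc : ∀ a b i j, a ≤ i → i ≤ b → a ≤ j → j ≤ b → chainEquiv (M a b) (c i) (c j) := by
    intro a b i j h1 h2 h3 h4
    have hp : ∀ j, a ≤ j → j < b → s(c j, c (j + 1)) ∈ M a b := fun j h h' => ⟨j, h, h', rfl⟩
    exact (chainEquiv _).trans ((chainEquiv _).symm (chainEquiv_of_path hp h1 h2))
      (chainEquiv_of_path hp h3 h4)
  have hMv : ∀ a b i u, a ≤ i → i ≤ b → chainEquiv (M a b) (c i) u →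
      ∃ j, a ≤ j ∧ j ≤ b ∧ u = c j := by
    intro a b i u h1 h2 h
    rw [chainEquiv_iff] at h
    induction h with
    | refl => exact ⟨i, h1, h2, rfl⟩
    | tail _ h _ =>
      obtain ⟨j, hj1, hj2, he⟩ := h
      rcases Sym2.eq_iff.1 he with ⟨-, rfl⟩ | ⟨-, rfl⟩
      · exact ⟨j + 1, by omega, by omega, rfl⟩
      · exact ⟨j, by omega, by omega, rfl⟩
  -- Two disjoint stretches of the path both come close to the three cluster points. Crossing points
  -- of the two stretches would force the stretches to meet, against injectivity.
  obtain ⟨b, i₁, i₂, i₃, a1, a2, a3, a4, a5, a6, a7, a8, a9⟩ := hits 0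
  obtain ⟨b', j₁, j₂, j₃, b1, b2, b3, b4, b5, b6, b7, b8, b9⟩ := hits (b + 1)
  have hfalse : ∀ i i' j j', i ≤ b → i' ≤ b → b + 1 ≤ j → j ≤ b' → b + 1 ≤ j' → j' ≤ b' →
      ¬ Cross s(c i, c i') s(c j, c j') := by
    intro i i' j j' h1 h2 h3 h4 h5 h6 hcr
    obtain ⟨u, hu, hu'⟩ := chain_meet_of_cross (hMM 0 b (b + 1) b')
      (hMc 0 b i i' (by omega) h1 (by omega) h2) (hMc (b + 1) b' j j' h3 h4 h5 h6) hcr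
    obtain ⟨k, -, hk, rfl⟩ := hMv _ _ _ _ (by omega) h1 hu
    obtain ⟨k', hk', -, he⟩ := hMv _ _ _ _ h3 h4 hu'
    have := hc he
    omega
  have hne : c i₁ ≠ c j₁ := fun e => by have := hc e; omega
  rcases H _ a7 _ b7 _ a8 _ b8 _ a9 _ b9 hne with h | h
  · exact hfalse _ _ _ _ a2 a4 b1 b2 b5 b6 h
  · exact hfalse _ _ _ _ a2 a6 b1 b2 b3 b4 h

/-! ### Expanding orbits and periodic points in classes -/

theorem norm_sigma_of_le {D : ℕ} (hD : 0 < D) {x : S1} (hx : D * ‖x‖ ≤ 1 / 2) :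
    ‖sigma D x‖ = D * ‖x‖ := by
  have hD' : (1 : ℝ) ≤ D := by exact_mod_cast hD
  obtain ⟨t, ht, rfl⟩ : ∃ t : ℝ, |t| = ‖x‖ ∧ (t : S1) = x := by
    obtain ⟨t, rfl⟩ := QuotientAddGroup.mk_surjective x
    refine ⟨t - round t, UnitAddCircle.norm_eq.symm, ?_⟩
    exact coe_eq_coe_iff.2 ⟨- round t, by push_cast; ring⟩
  rw [← ht] at hx ⊢
  have : sigma D (t : S1) = ((D * t : ℝ) : S1) := by
    simp [sigma]
  rw [this, (AddCircle.norm_coe_eq_abs_iff (1 : ℝ) one_ne_zero).2, abs_mul, Nat.abs_cast]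
  rw [abs_mul, Nat.abs_cast, abs_one]
  exact hx

/-- An orbit of an expanding map with finitely many cluster points is preperiodic. -/
theorem not_injective_of_finite_mapClusterPt {D : ℕ} (hD : 2 ≤ D) {y : ℕ → S1}
    (hy : ∀ j, y (j + 1) = sigma D (y j)) (hfin : {p | MapClusterPt p Filter.atTop y}.Finite) :
    ¬ Function.Injective y := by
  intro hinj
  set Λ := {p | MapClusterPt p Filter.atTop y} with hΛ
  have hD' : (2 : ℝ) ≤ D := by exact_mod_cast hD
  have hfwd : ∀ p ∈ Λ, sigma D p ∈ Λ := by
    intro p hp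
    have h1 : MapClusterPt (sigma D p) Filter.atTop (sigma D ∘ y) :=
      MapClusterPt.continuousAt_comp (continuous_sigma D).continuousAt hp
    have h2 : sigma D ∘ y = y ∘ (· + 1) := funext fun j => (hy j).symm
    rw [h2] at h1
    exact MapClusterPt.of_comp (Filter.tendsto_add_atTop_nat 1) h1
  obtain ⟨ε, hε, hsep⟩ := exists_pos_lt_of_finite (hfin.prod hfin)
    (fun p => if p.1 = p.2 then 1 else ‖p.1 - p.2‖) (fun p _ => by
      split_ifs with h
      · exact one_pos
      · exact norm_pos_iff.2 (sub_ne_zero.2 h))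
  -- The first bound gives `D * δ + δ ≤ ε`, so that a point within `δ` of one cluster point and
  -- within `D * δ` of another forces them to coincide. The second makes `σ_D` multiply distances
  -- below `δ` exactly by `D`.
  set δ := min (ε / (D + 1)) (1 / (2 * D)) with hδ
  have hδ0 : 0 < δ := lt_min (by positivity) (by positivity)
  have hδ1 : D * δ + δ ≤ ε := by
    have : δ ≤ ε / (D + 1) := min_le_left _ _
    rw [le_div_iff₀ (by positivity)] at this
    linarith
  have hδ2 : D * δ ≤ 1 / 2 := by
    have : δ ≤ 1 / (2 * D) := min_le_right _ _
    rw [le_div_iff₀ (by positivity)] at this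
    linarith
  have hev : ∀ᶠ j in Filter.atTop, ∃ p ∈ Λ, ‖y j - p‖ < δ := by
    by_contra hcon
    rw [Filter.not_eventually] at hcon
    have hcl : IsClosed {u : S1 | ∀ p ∈ Λ, δ ≤ ‖u - p‖} := by
      have : {u : S1 | ∀ p ∈ Λ, δ ≤ ‖u - p‖} = ⋂ p ∈ Λ, {u | δ ≤ ‖u - p‖} := by ext; simp
      rw [this]
      exact isClosed_biInter fun p _ => isClosed_le continuous_const (by fun_prop)
    obtain ⟨a, ha, ha'⟩ := hcl.isCompact.exists_mapClusterPt_of_frequently (l := Filter.atTop)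
      (f := y) (hcon.mono fun j hj => by simpa using hj)
    have := ha a ha'
    rw [sub_self, norm_zero] at this
    linarith
  obtain ⟨J, hJ⟩ := Filter.eventually_atTop.1 hev
  have hJ' : ∀ j, ∃ p ∈ Λ, ‖y (J + j) - p‖ < δ := fun j => hJ _ (by omega)
  choose p hp hpδ using hJ'
  -- The cluster point shadowing the orbit moves along with it, so the distance to it grows
  -- geometrically unless it is zero. Hence the tail of the orbit lies in the finite set `Λ`.
  have hstep : ∀ j, p (j + 1) = sigma D (p j) ∧
      ‖y (J + (j + 1)) - p (j + 1)‖ = D * ‖y (J + j) - p j‖ := by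
    intro j
    have h1 : D * ‖y (J + j) - p j‖ ≤ D * δ := by gcongr; exact (hpδ j).le
    have h2 : ‖y (J + (j + 1)) - sigma D (p j)‖ = D * ‖y (J + j) - p j‖ := by
      rw [← norm_sigma_of_le (by omega) (h1.trans hδ2), ← add_assoc, hy]
      congr 1
      exact (smul_sub D _ _).symm
    have h3 : p (j + 1) = sigma D (p j) := by
      by_contra hne
      have h4 := hsep (p (j + 1), sigma D (p j)) ⟨hp _, hfwd _ (hp j)⟩
      simp only [if_neg hne] at h4
      have h5 : ‖p (j + 1) - sigma D (p j)‖ ≤ ‖y (J + (j + 1)) - p (j + 1)‖ +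
          ‖y (J + (j + 1)) - sigma D (p j)‖ := by
        rw [norm_sub_rev (y (J + (j + 1))) (p (j + 1))]
        have : p (j + 1) - sigma D (p j) = (p (j + 1) - y (J + (j + 1))) +
          (y (J + (j + 1)) - sigma D (p j)) := by abel
        rw [this]
        exact norm_add_le _ _
      have := hpδ (j + 1)
      linarith
    exact ⟨h3, by rw [h3, h2]⟩
  have hgrow : ∀ i j, 2 ^ i * ‖y (J + j) - p j‖ ≤ ‖y (J + (j + i)) - p (j + i)‖ := by
    intro i j
    induction i with
    | zero => simp
    | succ i ih =>
      rw [← add_assoc j i 1, (hstep (j + i)).2, pow_succ]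
      have := norm_nonneg (y (J + (j + i)) - p (j + i))
      nlinarith
  have hzero : ∀ j, y (J + j) = p j := by
    intro j
    by_contra hne
    have hpos : 0 < ‖y (J + j) - p j‖ := norm_pos_iff.2 (sub_ne_zero.2 hne)
    obtain ⟨i, hi⟩ := pow_unbounded_of_one_lt (δ / ‖y (J + j) - p j‖) (one_lt_two (α := ℝ))
    rw [div_lt_iff₀ hpos] at hi
    have := hgrow i j
    have := hpδ (j + i)
    linarith
  refine Set.infinite_of_injective_forall_mem (f := fun j => y (J + j)) (fun i j h => ?_)
    (fun j => ?_) hfin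
  · have := hinj h
    omega
  · rw [hzero]; exact hp j

theorem exists_path_of_chainEquiv {x y : S1} (h : chainEquiv L x y) :
    ∃ (m : ℕ) (c : ℕ → S1), c 0 = x ∧ c m = y ∧ ∀ j < m, s(c j, c (j + 1)) ∈ L := by
  rw [chainEquiv_iff] at h
  induction h with
  | refl => exact ⟨0, fun _ => x, rfl, rfl, fun j hj => by omega⟩
  | @tail b e _ hbe ih =>
    obtain ⟨m, c, h0, hm, hc⟩ := ih
    refine ⟨m + 1, fun j => if j ≤ m then c j else e, by simpa using h0, by simp, fun j hj => ?_⟩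
    rcases Nat.lt_succ_iff_lt_or_eq.1 hj with h | rfl
    · have h1 : j ≤ m := h.le
      have h2 : j + 1 ≤ m := h
      simp only [h1, h2, if_true]
      exact hc j h
    · simpa [hm] using hbe

theorem chainEquiv_sigma (hfw : ∀ l ∈ L, l.map d ∈ L) {x y : S1} (h : chainEquiv L x y) :
    chainEquiv L (sigma d x) (sigma d y) := by
  rw [chainEquiv_iff] at h ⊢
  induction h with
  | refl => exact Relation.ReflTransGen.refl
  | tail _ h ih => exact ih.tail (hfw _ h)

theorem chainEquiv_iterate (hfw : ∀ l ∈ L, l.map d ∈ L) {x y : S1} (h : chainEquiv L x y) (k : ℕ) :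
    chainEquiv L ((sigma d)^[k] x) ((sigma d)^[k] y) := by
  induction k with
  | zero => exact h
  | succ k ih =>
    rw [Function.iterate_succ_apply', Function.iterate_succ_apply']
    exact chainEquiv_sigma hfw ih

/-- A class that is mapped into itself by an iterate of `σ_d` contains a periodic point. -/
theorem exists_periodic_of_rel_iterate (hd : 2 ≤ d) (hun : ∀ l ∈ L, ∀ m ∈ L, ¬ Cross l m)
    (hfw : ∀ l ∈ L, l.map d ∈ L) {x : S1} {n : ℕ} (hn : 0 < n)
    (hx : chainEquiv L x ((sigma d)^[n] x)) :
    ∃ p, chainEquiv L x p ∧ p ∈ Function.periodicPts (sigma d) := by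
  classical
  by_contra hno
  push Not at hno
  -- A shortest path from a point of the class to an iterate of that point is taken, over all points
  -- and iterates. Concatenated with its images it becomes the infinite path `e`, which minimality
  -- makes injective. Then `e` has finitely many cluster points, although `e (j * m)` is an
  -- injective orbit of an expanding map.
  let P : ℕ → Prop := fun m => ∃ (c : ℕ → S1) (k : ℕ), 0 < k ∧ chainEquiv L x (c 0) ∧
    c m = (sigma d)^[k] (c 0) ∧ ∀ j < m, s(c j, c (j + 1)) ∈ L
  have hex : ∃ m, P m := by
    obtain ⟨m, c, h0, hm, hc⟩ := exists_path_of_chainEquiv hx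
    exact ⟨m, c, n, hn, h0 ▸ (chainEquiv L).refl _, by rw [hm, h0], hc⟩
  have hmin : ∀ r < Nat.find hex, ¬ P r := fun r hr => Nat.find_min hex hr
  obtain ⟨c, k, hk, hc0, hcm, hcL⟩ := Nat.find_spec hex
  generalize Nat.find hex = m at *
  have hm0 : 0 < m := by
    rcases Nat.eq_zero_or_pos m with rfl | h
    · exact absurd ⟨k, hk, hcm.symm⟩ (hno _ hc0)
    · exact h
  set f := (sigma d)^[k] with hf
  let e : ℕ → S1 := fun j => f^[j / m] (c (j % m))
  have hfL : ∀ q u v, s(u, v) ∈ L → s(f^[q] u, f^[q] v) ∈ L := by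
    intro q u v huv
    have := iterate_map_mem hfw (k * q) _ huv
    rw [hf, ← Function.iterate_mul, sigma_iterate]
    exact this
  have hstep : ∀ j, s(e j, e (j + 1)) ∈ L := by
    intro j
    have hlt := Nat.mod_lt j hm0
    have hdm := Nat.div_add_mod j m
    rcases Nat.lt_or_ge (j % m + 1) m with h | h
    · have h1 : (j + 1) / m = j / m := by
        rw [Nat.div_eq_iff hm0]
        constructor
        · have := Nat.div_mul_le_self j m; omega
        · have : j / m * m = m * (j / m) := mul_comm _ _
          omega
      have h2 : (j + 1) % m = j % m + 1 := by
        have := Nat.div_add_mod (j + 1) m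
        rw [h1] at this; omega
      simp only [e, h1, h2]
      exact hfL _ _ _ (hcL _ hlt)
    · have h0 : j + 1 = m * (j / m + 1) := by rw [mul_add, mul_one]; omega
      have h1 : (j + 1) / m = j / m + 1 := by rw [h0, Nat.mul_div_cancel_left _ hm0]
      have h2 : (j + 1) % m = 0 := by rw [h0, Nat.mul_mod_right]
      have h3 : j % m = m - 1 := by omega
      simp only [e, h1, h2, Function.iterate_succ_apply]
      rw [← hcm, h3]
      have := hcL (m - 1) (by omega)
      rw [Nat.sub_add_cancel hm0] at this
      exact hfL _ _ _ this
  have hshift : ∀ q j, e (j + q * m) = f^[q] (e j) := by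
    intro q j
    simp only [e]
    rw [Nat.add_mul_div_right _ _ hm0, Nat.add_mul_mod_self_right, add_comm,
      Function.iterate_add_apply]
  have hcls : ∀ j, chainEquiv L x (e j) := by
    intro j
    have h0 : e 0 = c 0 := by simp [e]
    have := chainEquiv_of_path (c := e) (a := 0) (b := j) (fun i _ _ => hstep i) (i := j)
      (Nat.zero_le _) le_rfl
    rw [h0] at this
    exact (chainEquiv L).trans hc0 this
  have hinj : ∀ i j, i < j → e i ≠ e j := by
    intro i j hij he
    obtain ⟨q, r, hr, hj⟩ : ∃ q r, r < m ∧ j = i + r + q * m :=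
      ⟨(j - i) / m, (j - i) % m, Nat.mod_lt _ hm0, by
        have := Nat.div_add_mod (j - i) m
        rw [mul_comm] at this
        omega⟩
    rw [hj, hshift] at he
    rcases Nat.eq_zero_or_pos q with rfl | hq
    · simp only [Function.iterate_zero, id_eq] at he
      -- A repetition after `r < m` steps gives the shorter path from `e (i + r)` to `e (i + m)`,
      -- the image of `e i = e (i + r)`.
      refine hmin (m - r) (by omega) ⟨fun s => e (i + r + s), k, hk, hcls _, ?_, fun s _ => hstep _⟩
      have := hshift 1 i
      simp only [one_mul, Function.iterate_one] at this
      simp only [add_zero]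
      rw [← he, ← hf, ← this]
      congr 1; omega
    · have hkq : 0 < k * q := Nat.mul_pos hk hq
      rw [hf, ← Function.iterate_mul] at he
      rcases Nat.eq_zero_or_pos r with rfl | hr0
      · exact hno _ (hcls i) ⟨k * q, hkq, he.symm⟩
      -- Read backwards, the stretch from `e i` to `e (i + r)` leads from a point to an iterate of
      -- it in `r < m` steps.
      · refine hmin r hr ⟨fun s => e (i + r - s), k * q, hkq, hcls _, ?_, fun s hs => ?_⟩
        · simpa using he
        · have := hstep (i + r - (s + 1))
          rw [show i + r - (s + 1) + 1 = i + r - s by omega, Sym2.eq_swap] at this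
          exact this
  have hinj' : Function.Injective e := by
    intro i j h
    rcases lt_trichotomy i j with h' | h' | h'
    · exact absurd h (hinj i j h')
    · exact h'
    · exact absurd h.symm (hinj j i h')
  have hmul : Filter.Tendsto (fun j => j * m) Filter.atTop Filter.atTop :=
    Filter.tendsto_atTop_mono (fun j => Nat.le_mul_of_pos_right j hm0) Filter.tendsto_id
  refine not_injective_of_finite_mapClusterPt (D := d ^ k) (y := fun j => e (j * m))
    (le_trans hd (Nat.le_self_pow hk.ne' d)) (fun j => ?_) ?_ ?_
  · have := hshift 1 (j * m)
    simp only [one_mul, Function.iterate_one] at this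
    rw [add_mul, one_mul, this, hf, sigma_iterate]
  · refine (finite_mapClusterPt_of_path hun hinj' hstep).subset fun p hp => ?_
    exact MapClusterPt.of_comp (u := e) hmul hp
  · exact hinj'.comp fun i j h => Nat.eq_of_mul_eq_mul_right hm0 h

theorem finite_class_of_periodic (hd : 2 ≤ d)
    (hper : ∀ x y, x ∈ Function.periodicPts (sigma d) → s(x, y) ∈ L →
      Function.minimalPeriod (sigma d) y = Function.minimalPeriod (sigma d) x) {p : S1}
    (hp : p ∈ Function.periodicPts (sigma d)) : {y | chainEquiv L p y}.Finite := by
  have hpos := Function.minimalPeriod_pos_of_mem_periodicPts hp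
  have hsub : ∀ y, chainEquiv L p y →
      Function.minimalPeriod (sigma d) y = Function.minimalPeriod (sigma d) p := by
    intro y hy
    rw [chainEquiv_iff] at hy
    induction hy with
    | refl => rfl
    | tail _ h ih =>
      exact (hper _ _ (Function.minimalPeriod_pos_iff_mem_periodicPts.1 (ih ▸ hpos)) h).trans ih
  set n := Function.minimalPeriod (sigma d) p
  have hD : 2 ≤ d ^ n := le_trans hd (Nat.le_self_pow hpos.ne' d)
  -- All points of the class have period `n`, hence are killed by `d ^ n - 1`.
  refine (finite_fiber (n := d ^ n - 1) (by omega) 0).subset fun y hy => ?_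
  have h1 := Function.isPeriodicPt_minimalPeriod (sigma d) y
  rw [hsub y hy] at h1
  unfold Function.IsPeriodicPt Function.IsFixedPt at h1
  rw [sigma_iterate] at h1
  change (d ^ n - 1) • y = 0
  have h2 : (d ^ n - 1 + 1) • y = y := by rw [Nat.sub_add_cancel (by omega)]; exact h1
  rw [add_smul, one_smul] at h2
  simpa using h2

/-- Classes of a proper lamination that is compatible with a full critical collection are
finite. -/
theorem finite_class {C : Set Chord} (hC : IsFullCriticalCollection d C) (hd : 2 ≤ d)
    (hun : ∀ l ∈ L, ∀ m ∈ L, ¬ Cross l m) (hfw : ∀ l ∈ L, l.map d ∈ L)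
    (hLC : ∀ l ∈ L, ∀ c ∈ C, ¬ Cross l c)
    (hper : ∀ x y, x ∈ Function.periodicPts (sigma d) → s(x, y) ∈ L →
      Function.minimalPeriod (sigma d) y = Function.minimalPeriod (sigma d) x) (x : S1) :
    {y | chainEquiv L x y}.Finite := by
  have hd0 : 0 < d := by omega
  have T := @(chainEquiv L).trans
  have Sy := @(chainEquiv L).symm
  by_contra hinf
  have hinfk : ∀ k, ¬ {y | chainEquiv L ((sigma d)^[k] x) y}.Finite := by
    intro k hk
    refine hinf ((finite_preimage_sigma (n := d ^ k) (by positivity) hk).subset fun y hy => ?_)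
    change chainEquiv L _ (sigma (d ^ k) y)
    rw [← sigma_iterate]
    exact chainEquiv_iterate hfw hy k
  -- Two related iterates would put a periodic point into an iterated class, making that class
  -- finite.
  have hdist : ∀ i j, i < j → ¬ chainEquiv L ((sigma d)^[i] x) ((sigma d)^[j] x) := by
    intro i j hij h
    rw [← Nat.sub_add_cancel hij.le, Function.iterate_add_apply] at h
    obtain ⟨p, hp, hpp⟩ := exists_periodic_of_rel_iterate hd hun hfw (Nat.sub_pos_of_lt hij) h
    refine hinfk i ((finite_class_of_periodic hd hper hpp).subset fun y hy => ?_)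
    exact T (Sy hp) hy
  -- The iterated classes are distinct, so each of the finitely many critical vertices lies in at
  -- most one of them.
  obtain ⟨K, hK⟩ : ∃ K, ∀ k ≥ K, ∀ v ∈ vertices C, ¬ chainEquiv L ((sigma d)^[k] x) v := by
    rw [← Filter.eventually_atTop, Filter.eventually_all_finite (hC.1.finite_vertices hd0)]
    intro v _
    by_cases h : ∃ k, chainEquiv L ((sigma d)^[k] x) v
    · obtain ⟨k, hk⟩ := h
      filter_upwards [Filter.eventually_gt_atTop k] with j hj hjv
      exact hdist k j hj (T hk (Sy hjv))
    · exact Filter.Eventually.of_forall fun k hk => h ⟨k, hk⟩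
  obtain ⟨F, hF, hcard⟩ := Set.Infinite.exists_subset_card_eq (hinfk K) ((vertices C).ncard + 3)
  have hcls : ∀ k (g : F), chainEquiv L ((sigma d)^[K + k] x) ((sigma d)^[k] g) := by
    intro k g
    rw [add_comm, Function.iterate_add_apply]
    exact chainEquiv_iterate hfw (hF g.2) k
  have hdist' : ∀ i j, i ≠ j → ¬ chainEquiv L ((sigma d)^[K + i] x) ((sigma d)^[K + j] x) := by
    intro i j hij h
    rcases lt_or_gt_of_ne hij with h' | h'
    · exact hdist _ _ (by omega) h
    · exact hdist _ _ (by omega) (Sy h)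
  have hrel : ∀ k (g h : F), chainEquiv L ((sigma d)^[k] g) ((sigma d)^[k] h) := fun k g h =>
    T (Sy (hcls k g)) (hcls k h)
  have hw : Wandering d C (fun k (g : F) => (sigma d)^[k] (g : S1)) :=
    { map := fun k g => Function.iterate_succ_apply' _ _ _
      inj := fun g h e => Subtype.ext e
      not_mem := fun k g hv => hK (K + k) (by omega) _ hv (hcls k g)
      not_cross_crit := by
        intro k g h c hc hcr
        induction c using Sym2.ind with | _ u v
        obtain ⟨w, hw, hw'⟩ := chain_meet_of_cross hLC (hrel k g h) (chainEquiv_of_mem hc) hcr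
        exact hK (K + k) (by omega) w (mem_vertices_of_chain (mem_vertices_left hc) hw')
          (T (hcls k g) hw)
      ne := fun k j g h hkj e => hdist' k j hkj (T (hcls k g) (e ▸ Sy (hcls j h)))
      not_cross := fun k j g h g' h' hkj hcr => hdist' k j hkj
        (T (T (hcls k g) (unlinked_chainEquiv hun _ _ _ _ (hrel k g h) (hrel j g' h') hcr))
          (Sy (hcls j g'))) }
  have := hw.card_lt hC hd0
  rw [Fintype.card_coe, hcard] at this
  exact lt_irrefl _ this

end Paths

/-! ### The laminational equivalence relation generated by a lamination -/

section Laminational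

variable {d : ℕ} {L : Set Chord}

/-- Let related pairs converge to `(x, y)`. If there were no chord of `L` between small
neighbourhoods of `x` and `y`, each class would have a third point away from both. In the limit
these give three distinct points. By `exists_nhds_cross` all nearby triples then belong to a single
class, which is finite, hence closed, and so contains `x` and `y`. -/
theorem isClosed_chainEquiv (hcl : IsClosedFamily L) (hun : ∀ l ∈ L, ∀ m ∈ L, ¬ Cross l m)
    (hfin : ∀ x, {y | chainEquiv L x y}.Finite) :
    IsClosed {p : S1 × S1 | chainEquiv L p.1 p.2} := by
  have T := @(chainEquiv L).trans
  have Sy := @(chainEquiv L).symm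
  have hr := unlinked_chainEquiv hun
  refine isClosed_of_closure_subset ?_
  rintro ⟨x, y⟩ hxy
  by_contra hno
  change ¬ chainEquiv L x y at hno
  have hne : x ≠ y := fun h => hno (h ▸ (chainEquiv L).refl _)
  obtain ⟨A, B, hA, hB, hxA, hyB, hAB⟩ := t2_separation hne
  have hL : (endpointPairs L)ᶜ ∈ 𝓝 (x, y) :=
    hcl.isOpen_compl.mem_nhds fun h => hno (chainEquiv_of_mem h)
  obtain ⟨A', hA', B', hB', hA'B'⟩ := mem_nhds_prod_iff.1 hL
  obtain ⟨A'', hA''s, hA'', hxA''⟩ := mem_nhds_iff.1 hA'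
  obtain ⟨B'', hB''s, hB'', hyB''⟩ := mem_nhds_iff.1 hB'
  set O₁ := A ∩ A''
  set O₂ := B ∩ B''
  have hO₁ : IsOpen O₁ := hA.inter hA''
  have hO₂ : IsOpen O₂ := hB.inter hB''
  have hdisj : ∀ u ∈ O₁, u ∉ O₂ := fun u hu hu' => Set.disjoint_left.1 hAB hu.1 hu'.1
  have hnoL : ∀ u ∈ O₁, ∀ v ∈ O₂, s(u, v) ∉ L := fun u hu v hv h =>
    hA'B' (⟨hA''s hu.2, hB''s hv.2⟩ : (u, v) ∈ A' ×ˢ B') h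
  have third : ∀ a b, chainEquiv L a b → a ∈ O₁ → b ∈ O₂ →
      ∃ w, chainEquiv L a w ∧ w ∈ (O₁ ∪ O₂)ᶜ := by
    intro a b hab ha hb
    by_contra hcon
    push Not at hcon
    have hall : ∀ w, chainEquiv L a w → w ∈ O₁ := by
      intro w hw
      have hw' := chainEquiv_iff.1 hw
      induction hw' with
      | refl => exact ha
      | @tail u w hu huw ih =>
        have hu1 := ih (chainEquiv_iff.2 hu)
        rcases not_not.1 (hcon w hw) with h | h
        · exact h
        · exact absurd huw (hnoL u hu1 w h)
    exact hdisj b (hall b hab) hb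
  set S : Set (S1 × S1 × S1) := {p | chainEquiv L p.1 p.2.1 ∧ chainEquiv L p.1 p.2.2 ∧
    p.2.2 ∈ (O₁ ∪ O₂)ᶜ} with hS
  have hproj : Continuous fun p : S1 × S1 × S1 => (p.1, p.2.1) := by fun_prop
  have hmem : (x, y) ∈ closure ((fun p : S1 × S1 × S1 => (p.1, p.2.1)) '' S) := by
    rw [mem_closure_iff] at hxy ⊢
    intro o ho hxo
    obtain ⟨⟨a, b⟩, ⟨hab1, hab2⟩, hab⟩ := hxy _ (ho.inter (hO₁.prod hO₂))
      ⟨hxo, ⟨hxA, hxA''⟩, ⟨hyB, hyB''⟩⟩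
    obtain ⟨w, hw, hw'⟩ := third a b hab hab2.1 hab2.2
    exact ⟨(a, b), hab1, (a, b, w), ⟨hab, hw, hw'⟩, rfl⟩
  rw [← image_closure_of_isCompact isClosed_closure.isCompact hproj.continuousOn] at hmem
  obtain ⟨⟨x', y', w⟩, hw, he⟩ := hmem
  obtain ⟨rfl, rfl⟩ := Prod.mk.inj he
  simp only at hno hne hxA hyB hxA'' hyB''
  have hwO : w ∈ (O₁ ∪ O₂)ᶜ := by
    have hc : IsClosed {p : S1 × S1 × S1 | p.2.2 ∈ (O₁ ∪ O₂)ᶜ} :=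
      (hO₁.union hO₂).isClosed_compl.preimage (by fun_prop)
    exact closure_minimal (fun p hp => hp.2.2) hc hw
  have hxw : x' ≠ w := fun h => hwO (Or.inl (h ▸ ⟨hxA, hxA''⟩))
  have hyw : y' ≠ w := fun h => hwO (Or.inr (h ▸ ⟨hyB, hyB''⟩))
  obtain ⟨U, hU, V, hV, W, hW, H⟩ := exists_nhds_cross hne hxw hyw
  have hN : U ×ˢ V ×ˢ W ∈ 𝓝 (x', y', w) := prod_mem_nhds hU (prod_mem_nhds hV hW)
  obtain ⟨⟨a, b, e⟩, ⟨haU, hbV, heW⟩, hab, hae, -⟩ := mem_closure_iff_nhds.1 hw _ hN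
  simp only at haU hbV heW hab hae
  have hsame : ∀ p ∈ U ×ˢ V ×ˢ W, p ∈ S → chainEquiv L a p.1 ∧ chainEquiv L a p.2.1 := by
    rintro ⟨a', b', e'⟩ ⟨ha', hb', he'⟩ ⟨h1, h2, -⟩
    simp only at ha' hb' he' h1 h2 ⊢
    have haa : chainEquiv L a a' := by
      by_cases heq : a = a'
      · exact heq ▸ (chainEquiv L).refl _
      · rcases H _ haU _ ha' _ hbV _ hb' _ heW _ he' heq with h | h
        · exact hr _ _ _ _ hab h2 h
        · exact hr _ _ _ _ hae h1 h
    exact ⟨haa, T haa h1⟩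
  have hcA := (hfin a).isClosed.isOpen_compl
  have hx' : chainEquiv L a x' := by
    by_contra hcon
    have : {p : S1 × S1 × S1 | p.1 ∈ {y | chainEquiv L a y}ᶜ} ∈ 𝓝 (x', y', w) :=
      (hcA.preimage continuous_fst).mem_nhds hcon
    obtain ⟨p, ⟨hp1, hp2⟩, hp3⟩ := mem_closure_iff_nhds.1 hw _ (Filter.inter_mem hN this)
    exact hp2 (hsame p hp1 hp3).1
  have hy' : chainEquiv L a y' := by
    by_contra hcon
    have : {p : S1 × S1 × S1 | p.2.1 ∈ {y | chainEquiv L a y}ᶜ} ∈ 𝓝 (x', y', w) :=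
      (hcA.preimage (continuous_fst.comp continuous_snd)).mem_nhds hcon
    obtain ⟨p, ⟨hp1, hp2⟩, hp3⟩ := mem_closure_iff_nhds.1 hw _ (Filter.inter_mem hN this)
    exact hp2 (hsame p hp1 hp3).2
  exact hno (T (Sy hx') hy')

theorem fiberMatching_of_hasSiblings (hd : 0 < d) (hsib : HasSiblings d L)
    (hbw : ∀ a b, s(a, b) ∈ L → ∃ x y, s(x, y) ∈ L ∧ sigma d x = a ∧ sigma d y = b) :
    FiberMatching d (chainEquiv L) := by
  refine fiberMatching_of_mem fun a b hab hne => ?_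
  obtain ⟨x, y, hxy, rfl, rfl⟩ := hbw a b hab
  obtain ⟨π, hπ, -, H⟩ := hsib x y hxy hne
  have hj : ∀ u, sigma d u = sigma d x → ∃ j : Fin d, u = x + (((j : ℕ) / d : ℝ) : S1) :=
    fun u hu => exists_fin_of_sigma_eq hd hu
  have : Nonempty (Fin d) := ⟨⟨0, hd⟩⟩
  choose! j hj using hj
  refine ⟨fun u => y + (((π (j u) : ℕ) / d : ℝ) : S1), fun u hu => ⟨sigma_add_div hd _ _, ?_⟩, ?_⟩
  · have := chainEquiv_of_mem (H (j u))
    rwa [← hj u hu] at this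
  · intro u hu v hv h
    have := hπ (fin_add_div_injective hd y h)
    rw [hj u hu, hj v hv, this]

theorem isInvariantLaminationalEquiv_chainEquiv (hd : 0 < d) (hcl : IsClosedFamily L)
    (hun : ∀ l ∈ L, ∀ m ∈ L, ¬ Cross l m) (hfw : ∀ l ∈ L, l.map d ∈ L) (hsib : HasSiblings d L)
    (hbw : ∀ a b, s(a, b) ∈ L → ∃ x y, s(x, y) ∈ L ∧ sigma d x = a ∧ sigma d y = b)
    (hfin : ∀ x, {y | chainEquiv L x y}.Finite) :
    IsInvariantLaminationalEquiv d (chainEquiv L) := by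
  have T := @(chainEquiv L).trans
  have Sy := @(chainEquiv L).symm
  have hr := unlinked_chainEquiv hun
  have hm := fiberMatching_of_hasSiblings hd hsib hbw
  have hclass : ∀ g ∈ (chainEquiv L).classes, ∀ x ∈ g, g = {y | chainEquiv L x y} := by
    rintro _ ⟨y, rfl⟩ x hx
    ext z
    exact ⟨fun hz => T hx (Sy hz), fun hz => T (Sy hz) hx⟩
  have hclass' : ∀ x, {y | chainEquiv L x y} ∈ (chainEquiv L).classes := fun x =>
    ⟨x, Set.ext fun z => ⟨fun h => Sy h, fun h => Sy h⟩⟩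
  have hne : ∀ g ∈ (chainEquiv L).classes, ∃ x, x ∈ g := by
    rintro _ ⟨y, rfl⟩
    exact ⟨y, (chainEquiv L).refl y⟩
  have hfing : ∀ g ∈ (chainEquiv L).classes, g.Finite := by
    intro g hg
    obtain ⟨x, hx⟩ := hne g hg
    rw [hclass g hg x hx]
    exact hfin x
  refine ⟨isClosed_chainEquiv hcl hun hfin, ?_, hfing, ?_, ?_, ?_⟩
  · intro g hg h hh hgh
    have hrel : ∀ a ∈ g, ∀ x ∈ h, ¬ chainEquiv L a x := by
      intro a ha x hx hax
      refine hgh ?_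
      rw [hclass g hg a ha, hclass h hh x hx]
      ext z
      exact ⟨fun hz => T (Sy hax) hz, fun hz => T hax hz⟩
    refine disjoint_convexHull_of_unlinked (hfing g hg) (Set.disjoint_left.2 fun z hz hz' =>
      hrel z hz z hz' ((chainEquiv L).refl z)) fun a ha b hb x hx y hy hc => ?_
    rw [hclass g hg a ha] at hb
    refine hrel a ha x hx (hr a b x y hb ?_ hc)
    rw [hclass h hh x hx] at hy
    exact hy
  · intro g hg
    obtain ⟨x, hx⟩ := hne g hg
    have : sigma d '' g = {y | chainEquiv L (sigma d x) y} := by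
      rw [hclass g hg x hx]
      ext b
      constructor
      · rintro ⟨y, hy, rfl⟩
        exact chainEquiv_sigma hfw hy
      · intro hb
        obtain ⟨φ, hφ, -⟩ := hm _ _ hb
        exact ⟨φ x, (hφ x rfl).2, (hφ x rfl).1⟩
    rw [this]
    exact hclass' _
  · intro g hg
    refine ⟨{h | h ∈ (chainEquiv L).classes ∧ h ⊆ sigma d ⁻¹' g}, fun h hh => hh.1, ?_⟩
    ext x
    constructor
    · intro hx
      refine ⟨{y | chainEquiv L x y}, ⟨hclass' x, fun y hy => ?_⟩, (chainEquiv L).refl x⟩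
      have hx' : sigma d x ∈ g := hx
      change sigma d y ∈ g
      rw [hclass g hg _ hx']
      exact chainEquiv_sigma hfw hy
    · rintro ⟨h, hh, hx⟩
      exact hh.2 hx
  · intro g hg _ s hs t ht hst hdis
    -- The second alternative always holds: a point of the image class inside the arc would
    -- contradict `hole_image`, and the arc is empty when its endpoints coincide.
    right
    refine Set.disjoint_left.2 ?_
    rintro _ hw ⟨u, hu, rfl⟩
    rw [hclass g hg s hs] at ht hu hdis
    have hus : sigma d u ≠ sigma d s := fun h => by
      rw [Set.mem_cIoo, h, sbtw_iff_ang, ang_self] at hw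
      exact lt_irrefl _ hw.1
    exact (hm.hole_image hr hd ht hst hdis (chainEquiv_sigma hfw hu) hus).2 hw

end Laminational

/-! ### The preroot q-lamination -/

theorem generates_preroot {d : ℕ} (hd : 2 ≤ d) {C : Set Chord}
    (hC : IsFullCriticalCollection d C) : Generates d (YBar d C) (preroot d C) := by
  have hd0 : 0 < d := by omega
  set L := qLam (chainEquiv (YFamily d C)) with hL
  have hY : YBar d C = closureFamily L := congrArg closureFamily (pileEdges_eq hC hd0)
  have hr := unlinked_yFamily hC hd0
  have hm := fiberMatching_yFamily hC hd0
  have hfin := finite_class_yFamily hC.1 hd0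
  have hfwY : ∀ x y, chainEquiv (YFamily d C) x y →
      chainEquiv (YFamily d C) (sigma d x) (sigma d y) := fun _ _ h => forward_yFamily hC.1 h
  have hnp : ∀ a b, s(a, b) ∈ L → a ≠ b → a ∉ Function.periodicPts (sigma d) := by
    intro a b hab hne
    rcases mem_qLam_iff.1 hab with ⟨u, v, huv, hne', he, -⟩ | h
    · rcases Sym2.eq_iff.1 he with ⟨rfl, rfl⟩ | ⟨rfl, rfl⟩
      · exact not_periodic_of_rel huv hne
      · exact not_periodic_of_rel ((chainEquiv _).symm huv) hne
    · exact absurd h hne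
  have hun₀ : ∀ l ∈ L, ∀ m ∈ L, ¬ Cross l m := not_cross_qLam hr
  have hfw₀ : ∀ l ∈ L, l.map d ∈ L := hm.forward_qLam hr hd0 hfwY
  have hpts : points ⊆ closureFamily L := fun l hl =>
    subset_closureFamily (mem_qLam_iff.2 (Or.inr hl))
  have hcl := isClosedFamily_closureFamily (L := L)
  have hun := not_cross_closureFamily hun₀
  have hfw := forward_closureFamily hfw₀
  have hsib := hasSiblings_closureFamily (hm.hasSiblings_qLam hr hd0 hfin hfwY)
  have hbw := backward_closureFamily (hm.backward_qLam hr hd0 hfin hfwY)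
  have hLC : ∀ l ∈ closureFamily L, ∀ c ∈ C, ¬ Cross l c := fun l hl c hc =>
    not_cross_closureFamily (not_cross_of_mem_qLam_yFamily hC hd0) l hl c (subset_closureFamily hc)
  have hper : ∀ x y, x ∈ Function.periodicPts (sigma d) → s(x, y) ∈ closureFamily L →
      Function.minimalPeriod (sigma d) y = Function.minimalPeriod (sigma d) x := fun _ _ =>
    minimalPeriod_eq_of_mem_closureFamily hd hun₀ hfw₀ hnp
  refine ⟨?_, ?_, rfl⟩
  · rw [hY]
    exact ⟨isInvariantLamination_of hd0 hcl hpts hun hfw hsib hbw, isProperChord_of hfw hper⟩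
  · rw [hY]
    exact isInvariantLaminationalEquiv_chainEquiv hd0 hcl hun hfw hsib hbw
      (finite_class hC hd hun hfw hLC hper)

end Lamination

end

theorem theoremt (d : ℕ) (hd : 2 ≤ d) (C : Set Lamination.Chord)
    (hC : Lamination.IsFullCriticalCollection d C) :
    Lamination.IsProperInvariantLamination d (Lamination.YBar d C) ∧
      Lamination.Generates d (Lamination.YBar d C) (Lamination.preroot d C) := by
  have h := Lamination.generates_preroot hd hC
  exact ⟨h.proper, h⟩
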